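/- Let $S$ be a Noetherian local ring with maximal ideal $\mathfrak m$ and residue field $k$ (for example a regular local ring), let $f_1,\dots,f_c\in S$ be a regular sequence, and put $R=S/(f_1,\dots,f_c)$. A \emph{higher matrix factorization} $(d,h)$ with respect to $f_1,\dots,f_c$ consists of finitely generated free $S$-modules $A_0,A_1$ with filtrations $0=A_s(0)\subseteq A_s(1)\subseteq\cdots\subseteq A_s(c)=A_s$ ($s=0,1$) such that each $A_s(p-1)$ is a free direct summand of the free module $A_s(p)$, and of filtration-preserving maps $d\colon A_1\to A_0$ and $h=(h_1|\cdots|h_c)\colon\bigoplus_{q=1}^c A_0(q)\to A_1$ such that, for all $p$, with $d_p\colon A_1(p)\to A_0(p)$ and $h_p\colon A_0(p)\to A_1(p)$ the induced maps and $\pi_p\colon A_1(p)\to A_1(p)/A_1(p-1)$ the projection, $$d_ph_p\equiv f_p\,\mathrm{Id}\ \bmod (f_1,\dots,f_{p-1})A_0(p),\qquad \pi_ph_pd_p\equiv f_p\,\pi_p\ \bmod (f_1,\dots,f_{p-1})\bigl(A_1(p)/A_1(p-1)\bigr).$$ Its module is $M=\operatorname{Coker}(R\otimes_S d)$. It is \emph{minimal}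 if the images of $d$ and $h$ are contained in $\mathfrak m A_0$ and $\mathfrak m A_1$ respectively. Let $(d,h)$ be minimal, let $M$ be its module, choose splittings $A_s(p)=A_s(p-1)\oplus B_s(p)$ for $s=0,1$ and $1\le p\le c$, and set $B(p)=B_0(p)\oplus B_1(p)$ with $B_s(p)$ in degree $s$. Then: (1) There is an isomorphism of graded $k$-vector spaces $$\operatorname{Ext}_S(M,k)\cong\bigoplus_{p=1}^c k\langle e_1,\dots,e_{p-1}\rangle\otimes_k\operatorname{Hom}_S(B(p),k),$$ where $k\langle e_1,\dots,e_{p-1}\rangle$ is the exterior algebra on variables of degree $1$. (2) There is an isomorphism of graded $k$-vector spaces $$\operatorname{Ext}_R(M,k)\cong\bigoplus_{p=1}^c k[\chi_p,\dots,\chi_c]\otimes_k\operatorname{Hom}_S(B(p),k),$$ where $k[\chi_p,\dots,\chi_c]$ is the polynomial ring on variables of degree $2$, such that, for all $i\ge p$, the CI operator $\chi_i$ on $\operatorname{Ext}_R(M,k)$ preserves the $p$-th summand and acts on it as multiplication by $\chi_i$ on the first factor. Here the CI operators are defined as follows. Take any free resolution $(V,\partial)$ of $M$ over $R$, any lifting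 of it to free $S$-modules $\widetilde V_n$ and maps $\widetilde\partial$, and any maps $\widetilde t_j\colon\widetilde V_{n+2}\to\widetilde V_n$ with $\widetilde\partial^2=\sum_j f_j\widetilde t_j$. The maps $t_j=R\otimes\widetilde t_j$ commute with $\partial$, and $\chi_j\colon\operatorname{Ext}^n_R(M,k)\to\operatorname{Ext}^{n+2}_R(M,k)$ is induced by composition with $t_j$. The isomorphism in (2) can be chosen independently of $V$, $\widetilde V$, $\widetilde\partial$ and $\widetilde t_j$. -/

import Mathlib

open CategoryTheory TensorProduct
open scoped ModuleCat.Algebra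

universe u

/-! ### Regular sequences -/

theorem mem_span_of_mul_mem_span_of_isWeaklyRegular {S : Type*} [CommRing S] {c : ℕ}
    (f : Fin c → S) (hf : RingTheory.Sequence.IsWeaklyRegular S (List.ofFn f)) (p : Fin c) (x : S)
    (hx : f p * x ∈ Ideal.span (f '' {q | q < p})) : x ∈ Ideal.span (f '' {q | q < p}) := by
  have key : Ideal.ofList ((List.ofFn f).take p) = Ideal.span (f '' {q | q < p}) := by
    unfold Ideal.ofList
    congr 1
    ext y
    simp only [List.mem_take_iff_getElem, List.getElem_ofFn, Set.mem_ofPred_eq, Set.mem_image,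
      List.length_ofFn]
    constructor
    · rintro ⟨i, hi, rfl⟩
      exact ⟨⟨i, by omega⟩, by simp only [Fin.lt_def]; omega, rfl⟩
    · rintro ⟨q, hq, rfl⟩
      exact ⟨q, by have := q.2; simp only [Fin.lt_def] at hq; omega, rfl⟩
  have h := hf.regular_mod_prev p (by simp)
  rw [key, isSMulRegular_iff_right_eq_zero_of_smul] at h
  have h2 := h (Submodule.Quotient.mk x)
  rw [← Submodule.Quotient.mk_smul, Submodule.Quotient.mk_eq_zero,
    Submodule.Quotient.mk_eq_zero] at h2
  simpa using h2 (by simpa using hx)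

theorem mem_span_of_sum_mul_eq_zero {S : Type*} [CommRing S] : ∀ {c : ℕ} (f : Fin c → S)
    (_ : ∀ (p : Fin c) (x : S), f p * x ∈ Ideal.span (f '' {q | q < p}) →
      x ∈ Ideal.span (f '' {q | q < p}))
    (a : Fin c → S) (_ : ∑ j, f j * a j = 0) (j : Fin c), a j ∈ Ideal.span (Set.range f) := by
  intro c
  induction c with
  | zero => intro f _ a _ j; exact j.elim0
  | succ c ih =>
    intro f hf a ha j
    have himg : f '' {q | q < Fin.last c} = Set.range (fun i : Fin c => f i.castSucc) := by
      ext y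
      constructor
      · rintro ⟨q, hq, rfl⟩
        exact ⟨q.castLT hq, rfl⟩
      · rintro ⟨i, rfl⟩
        exact ⟨i.castSucc, Fin.castSucc_lt_last i, rfl⟩
    have hsub : Ideal.span (Set.range (fun i : Fin c => f i.castSucc)) ≤
        Ideal.span (Set.range f) := by
      refine Ideal.span_mono ?_
      rintro _ ⟨i, rfl⟩
      exact ⟨_, rfl⟩
    rw [Fin.sum_univ_castSucc] at ha
    have hlast : a (Fin.last c) ∈ Ideal.span (Set.range (fun i : Fin c => f i.castSucc)) := by
      have := hf (Fin.last c) (a (Fin.last c))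
      rw [himg] at this
      refine this ?_
      rw [eq_neg_of_add_eq_zero_right ha]
      exact neg_mem (sum_mem fun i _ => Ideal.mul_mem_right _ _ (Ideal.subset_span ⟨i, rfl⟩))
    obtain ⟨g, hg⟩ := Ideal.mem_span_range_iff_exists_fun.1 hlast
    have hreg : ∀ (p : Fin c) (x : S),
        f p.castSucc * x ∈ Ideal.span ((fun i : Fin c => f i.castSucc) '' {q | q < p}) →
        x ∈ Ideal.span ((fun i : Fin c => f i.castSucc) '' {q | q < p}) := by
      intro p x
      have : (fun i : Fin c => f i.castSucc) '' {q | q < p} = f '' {q | q < p.castSucc} := by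
        ext y
        constructor
        · rintro ⟨q, hq, rfl⟩
          exact ⟨q.castSucc, hq, rfl⟩
        · rintro ⟨q, hq, rfl⟩
          exact ⟨q.castLT (lt_trans hq (Fin.castSucc_lt_last p)), hq, rfl⟩
      rw [this]
      exact hf p.castSucc x
    have hih := ih (fun i : Fin c => f i.castSucc) hreg
      (fun i => a i.castSucc + g i * f (Fin.last c)) (by
        rw [← ha, ← hg, Finset.mul_sum, ← Finset.sum_add_distrib]
        exact Finset.sum_congr rfl fun i _ => by ring)
    refine Fin.lastCases (hsub hlast) (fun i => ?_) j
    have h1 := hsub (hih i)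
    have h2 : g i * f (Fin.last c) ∈ Ideal.span (Set.range f) :=
      Ideal.mul_mem_left _ _ (Ideal.subset_span ⟨_, rfl⟩)
    simpa using sub_mem h1 h2

theorem span_range_le_maximalIdeal {S : Type*} [CommRing S] [IsLocalRing S] {c : ℕ} (f : Fin c → S)
    (hf : RingTheory.Sequence.IsRegular S (List.ofFn f)) :
    Ideal.span (Set.range f) ≤ IsLocalRing.maximalIdeal S := by
  refine IsLocalRing.le_maximalIdeal fun h => hf.top_ne_smul ?_
  have : Ideal.ofList (List.ofFn f) = Ideal.span (Set.range f) := by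
    unfold Ideal.ofList
    congr 1
    ext y
    simp [List.mem_ofFn]
  rw [this, h]
  simp

/-! ### Existence of free resolutions -/

namespace FreeResolution

variable {R : Type u} [CommRing R]

/-- The free module on the elements of `X`. -/
noncomputable def cover (X : ModuleCat.{u} R) : ModuleCat.{u} R := ModuleCat.of R (X →₀ R)

/-- The canonical surjection from the free cover. -/
noncomputable def coverMap (X : ModuleCat.{u} R) : cover X ⟶ X :=
  ModuleCat.ofHom (Finsupp.linearCombination R id)

instance epi_coverMap (X : ModuleCat.{u} R) : Epi (coverMap X) :=
  (ModuleCat.epi_iff_surjective _).2 (Finsupp.linearCombination_id_surjective R X)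

instance free_cover (X : ModuleCat.{u} R) : Module.Free R (cover X) := by
  unfold cover
  infer_instance

/-- Iterated kernels of free covers. -/
noncomputable def syzygy (M : ModuleCat.{u} R) : ℕ → ModuleCat.{u} R
  | 0 => M
  | n + 1 => Limits.kernel (coverMap (syzygy M n))

/-- The inclusion of a syzygy. -/
noncomputable def incl (M : ModuleCat.{u} R) (n : ℕ) : syzygy M (n + 1) ⟶ cover (syzygy M n) :=
  Limits.kernel.ι (coverMap (syzygy M n))

instance mono_incl (M : ModuleCat.{u} R) (n : ℕ) : Mono (incl M n) :=
  inferInstanceAs (Mono (Limits.kernel.ι (coverMap (syzygy M n))))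

theorem incl_coverMap (M : ModuleCat.{u} R) (n : ℕ) : incl M n ≫ coverMap (syzygy M n) = 0 :=
  Limits.kernel.condition _

/-- The differential of the free resolution. -/
noncomputable def diff (M : ModuleCat.{u} R) (n : ℕ) :
    cover (syzygy M (n + 1)) ⟶ cover (syzygy M n) :=
  coverMap _ ≫ incl M n

theorem diff_diff (M : ModuleCat.{u} R) (n : ℕ) : diff M (n + 1) ≫ diff M n = 0 := by
  unfold diff
  rw [Category.assoc, ← Category.assoc (incl M (n + 1)), incl_coverMap, Limits.zero_comp,
    Limits.comp_zero]

theorem diff_coverMap (M : ModuleCat.{u} R) (n : ℕ) : diff M n ≫ coverMap (syzygy M n) = 0 := by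
  unfold diff
  rw [Category.assoc, incl_coverMap, Limits.comp_zero]

theorem exact_coverMap (M : ModuleCat.{u} R) (n : ℕ) :
    (ShortComplex.mk (diff M n) (coverMap (syzygy M n)) (diff_coverMap M n)).Exact := by
  let α : ShortComplex.mk (diff M n) (coverMap (syzygy M n)) (diff_coverMap M n) ⟶
      ShortComplex.mk (incl M n) (coverMap (syzygy M n)) (incl_coverMap M n) :=
    { τ₁ := coverMap _
      τ₂ := 𝟙 _
      τ₃ := 𝟙 _
      comm₁₂ := by simp [diff] }
  have : Epi α.τ₁ := inferInstanceAs (Epi (coverMap _))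
  have : IsIso α.τ₂ := inferInstanceAs (IsIso (𝟙 _))
  have : Mono α.τ₃ := inferInstanceAs (Mono (𝟙 _))
  rw [ShortComplex.exact_iff_of_epi_of_isIso_of_mono α]
  exact ShortComplex.exact_of_f_is_kernel _ (Limits.kernelIsKernel _)

theorem exact_diff (M : ModuleCat.{u} R) (n : ℕ) :
    (ShortComplex.mk (diff M (n + 1)) (diff M n) (diff_diff M n)).Exact := by
  let α : ShortComplex.mk (diff M (n + 1)) (coverMap (syzygy M (n + 1)))
      (diff_coverMap M (n + 1)) ⟶
      ShortComplex.mk (diff M (n + 1)) (diff M n) (diff_diff M n) :=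
    { τ₁ := 𝟙 _
      τ₂ := 𝟙 _
      τ₃ := incl M n
      comm₂₃ := by simp [diff] }
  have : Epi α.τ₁ := inferInstanceAs (Epi (𝟙 _))
  have : IsIso α.τ₂ := inferInstanceAs (IsIso (𝟙 _))
  have : Mono α.τ₃ := inferInstanceAs (Mono (incl M n))
  exact (ShortComplex.exact_iff_of_epi_of_isIso_of_mono α).1 (exact_coverMap M (n + 1))

/-- The free resolution as a complex. -/
noncomputable def complex (M : ModuleCat.{u} R) : ChainComplex (ModuleCat.{u} R) ℕ :=
  ChainComplex.of (fun n => cover (syzygy M n)) (diff M) (diff_diff M)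

theorem complex_d (M : ModuleCat.{u} R) (n : ℕ) : (complex M).d (n + 1) n = diff M n :=
  ChainComplex.of_d (fun n => cover (syzygy M n)) (diff M) n

theorem exactAt_succ (M : ModuleCat.{u} R) (n : ℕ) : (complex M).ExactAt (n + 1) := by
  rw [HomologicalComplex.exactAt_iff' _ (n + 1 + 1) (n + 1) n (by simp) (by simp)]
  refine ShortComplex.exact_of_iso ?_ (exact_diff M n)
  exact ShortComplex.isoMk (Iso.refl _) (Iso.refl _) (Iso.refl _)
    ((Category.id_comp _).trans ((complex_d M (n + 1)).trans (Category.comp_id _).symm))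
    ((Category.id_comp _).trans ((complex_d M n).trans (Category.comp_id _).symm))

/-- A free resolution of an arbitrary module. -/
noncomputable def resolution (M : ModuleCat.{u} R) : ProjectiveResolution M where
  complex := complex M
  projective n := inferInstanceAs (Projective (ModuleCat.of R (syzygy M n →₀ R)))
  π := (ChainComplex.toSingle₀Equiv _ _).symm ⟨coverMap (syzygy M 0), by
    rw [complex_d]
    exact diff_coverMap M 0⟩
  quasiIso := ⟨fun n => by
    cases n
    · rw [ChainComplex.quasiIsoAt₀_iff, ShortComplex.quasiIso_iff_of_zeros']
      · refine (ShortComplex.exact_and_epi_g_iff_of_iso ?_).2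
          ⟨exact_coverMap M 0, epi_coverMap (syzygy M 0)⟩
        exact ShortComplex.isoMk (Iso.refl _) (Iso.refl _) (Iso.refl _)
          ((Category.id_comp _).trans ((complex_d M 0).symm.trans (Category.comp_id _).symm))
          ((Category.id_comp _).trans (Eq.trans (by simp; rfl) (Category.comp_id _).symm))
      · exact (complex M).shape 0 0 (by simp)
      · rfl
      · rfl
    · rw [quasiIsoAt_iff_exactAt']
      · apply exactAt_succ
      · apply ChainComplex.exactAt_succ_single_obj⟩

theorem free_resolution (M : ModuleCat.{u} R) (n : ℕ) :
    Module.Free R ((resolution M).complex.X n) :=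
  free_cover (syzygy M n)

end FreeResolution

/-- The graded module `Ext(M, N) = ⨁_n Ext^n(M, N)`. If `R` is an `S`-algebra, then it is a module
over `S`, through `S → R`. -/
abbrev TotalExt {R : Type u} [CommRing R] (M N : ModuleCat.{u} R) : Type u :=
  DirectSum ℕ fun n => Abelian.Ext.{u} M N n

/-- The inclusion of `Ext^n(M, N)`. -/
noncomputable abbrev TotalExt.of {R : Type u} [CommRing R] (M N : ModuleCat.{u} R) (n : ℕ)
    (ξ : Abelian.Ext.{u} M N n) : TotalExt M N :=
  DirectSum.of (fun n => Abelian.Ext.{u} M N n) n ξ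

/-! ### CI operators -/

/-- A free resolution `V` of the module `M` over `R = S / (f_1, …, f_c)`, with a lifting
`(lift, del)` of `V` to `S` and maps `t_j` on the lifting such that `del² = ∑ f_j t_j`. -/
structure CIResolution {S : Type u} [CommRing S] {c : ℕ} (f : Fin c → S)
    (M : ModuleCat.{u} (S ⧸ Ideal.span (Set.range f))) where
  res : ProjectiveResolution M
  /-- The free `S`-modules lifting the terms of the resolution. -/
  lift : ℕ → Type u
  [addCommGroup : ∀ n, AddCommGroup (lift n)]
  [module : ∀ n, Module S (lift n)]
  [free : ∀ n, Module.Free S (lift n)]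
  /-- The reduction maps, which exhibit `V_n` as `R ⊗ lift_n`. -/
  red : ∀ n, lift n →ₗ[S] res.complex.X n
  isBaseChange : ∀ n, IsBaseChange (S ⧸ Ideal.span (Set.range f)) (red n)
  /-- The lifting of the differential. -/
  del : ∀ n, lift (n + 1) →ₗ[S] lift n
  red_del : ∀ n x, red n (del n x) = (res.complex.d (n + 1) n).hom (red (n + 1) x)
  /-- The lifted CI operators. -/
  t : Fin c → ∀ n, lift (n + 2) →ₗ[S] lift n
  del_del : ∀ n x, del n (del (n + 1) x) = ∑ j, f j • t j n x

attribute [instance] CIResolution.addCommGroup CIResolution.module CIResolution.free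

namespace CIResolution
variable {S : Type u} [CommRing S] {c : ℕ} {f : Fin c → S}
    {M : ModuleCat.{u} (S ⧸ Ideal.span (Set.range f))} (D : CIResolution f M)

/-- The CI operator `t_j = R ⊗ t_j : V_{n+2} → V_n`. -/
noncomputable def op (j : Fin c) (n : ℕ) : D.res.complex.X (n + 2) ⟶ D.res.complex.X n :=
  ModuleCat.ofHom ((D.isBaseChange (n + 2)).lift (D.red n ∘ₗ D.t j n))

theorem op_red (j : Fin c) (n : ℕ) (x : D.lift (n + 2)) :
    (D.op j n).hom (D.red (n + 2) x) = D.red n (D.t j n x) :=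
  (D.isBaseChange (n + 2)).lift_eq (D.red n ∘ₗ D.t j n) x

end CIResolution

namespace CIResolution

theorem exists_sum_smul {S : Type u} [CommRing S] {c : ℕ} (f : Fin c → S) {ι κ : Type u}
    (g : (κ →₀ S) →ₗ[S] (ι →₀ S)) (hg : ∀ x i, g x i ∈ Ideal.span (Set.range f)) :
    ∃ t : Fin c → (κ →₀ S) →ₗ[S] (ι →₀ S), ∀ x, g x = ∑ j, f j • t j x := by
  classical
  have h : ∀ a, ∃ v : Fin c → ι →₀ S, g (Finsupp.single a 1) = ∑ j, f j • v j := by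
    intro a
    have h1 : ∀ i, ∃ u : Fin c → S, g (Finsupp.single a 1) i = ∑ j, f j * u j := fun i => by
      obtain ⟨u, hu⟩ := Ideal.mem_span_range_iff_exists_fun.1 (hg (Finsupp.single a 1) i)
      exact ⟨u, by rw [← hu]; exact Finset.sum_congr rfl fun j _ => mul_comm _ _⟩
    choose u hu using h1
    refine ⟨fun j => Finsupp.onFinset (g (Finsupp.single a 1)).support
      (fun i => if g (Finsupp.single a 1) i = 0 then 0 else u i j) (fun i hi => by
        rw [Finsupp.mem_support_iff]
        intro h0
        exact hi (if_pos h0)), ?_⟩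
    ext i
    simp only [Finsupp.finsetSum_apply, Finsupp.smul_apply, Finsupp.onFinset_apply, smul_eq_mul]
    by_cases h0 : g (Finsupp.single a 1) i = 0
    · simp [h0]
    · simp only [h0, if_false]
      exact hu i
  choose v hv using h
  refine ⟨fun j => Finsupp.linearCombination S fun a => v a j, fun x => ?_⟩
  induction x using Finsupp.induction_linear with
  | zero => simp
  | add x y hx hy => simp only [map_add, smul_add, Finset.sum_add_distrib, hx, hy]
  | single a s =>
    have : Finsupp.single a s = s • Finsupp.single a (1 : S) := by simp
    rw [this, map_smul, hv, Finset.smul_sum]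
    refine Finset.sum_congr rfl fun j _ => ?_
    rw [map_smul, Finsupp.linearCombination_single, one_smul, smul_comm]

/-- CI operator data exist for every module over `S / (f_1, …, f_c)`. -/
theorem nonempty {S : Type u} [CommRing S] {c : ℕ} (f : Fin c → S)
    (M : ModuleCat.{u} (S ⧸ Ideal.span (Set.range f))) : Nonempty (CIResolution f M) := by
  let P := FreeResolution.resolution M
  have hP := FreeResolution.free_resolution M
  let b := fun n => Module.Free.chooseBasis (S ⧸ Ideal.span (Set.range f)) (P.complex.X n)
  let red := fun n => Finsupp.linearCombination S (fun i => (b n i : P.complex.X n))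
  have hred : ∀ n v i, (b n).repr (red n v) i = Ideal.Quotient.mk _ (v i) := by
    intro n v i
    induction v using Finsupp.induction_linear with
    | zero => simp
    | add x y hx hy => simp only [map_add, Finsupp.add_apply, hx, hy]
    | single a s =>
      have : red n (Finsupp.single a s) = Ideal.Quotient.mk (Ideal.span (Set.range f)) s • b n a :=
        Finsupp.linearCombination_single S s a
      rw [this, map_smul, Module.Basis.repr_self, Finsupp.smul_apply, Finsupp.single_apply,
        Finsupp.single_apply]
      split_ifs <;> simp
  have hsurj : ∀ n y, ∃ v, red n v = y := by
    intro n y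
    refine Submodule.span_induction (p := fun y _ => ∃ v, red n v = y) ?_ ⟨0, map_zero _⟩ ?_ ?_
      ((b n).span_eq ▸ Submodule.mem_top : y ∈ Submodule.span _ (Set.range (b n)))
    · rintro _ ⟨i, rfl⟩
      exact ⟨Finsupp.single i 1, by simp [red]⟩
    · rintro _ _ _ _ ⟨v, rfl⟩ ⟨w, rfl⟩
      exact ⟨v + w, map_add _ _ _⟩
    · rintro a _ _ ⟨v, rfl⟩
      obtain ⟨s, rfl⟩ := Ideal.Quotient.mk_surjective a
      exact ⟨s • v, map_smul _ _ _⟩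
  have hdel : ∀ n, ∃ g : (_ →₀ S) →ₗ[S] (_ →₀ S), ∀ x,
      red n (g x) = (P.complex.d (n + 1) n).hom (red (n + 1) x) := by
    intro n
    choose v hv using fun i => hsurj n ((P.complex.d (n + 1) n).hom (b (n + 1) i))
    refine ⟨Finsupp.linearCombination S v, fun x => ?_⟩
    induction x using Finsupp.induction_linear with
    | zero => simp
    | add x y hx hy => simp only [map_add, hx, hy]
    | single a s =>
      have h1 : red (n + 1) (Finsupp.single a s) =
          Ideal.Quotient.mk (Ideal.span (Set.range f)) s • b (n + 1) a :=
        Finsupp.linearCombination_single S s a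
      rw [h1, Finsupp.linearCombination_single, map_smul, map_smul, hv]
      rfl
  choose del hdel using hdel
  have ht : ∀ n, ∃ t : Fin c → (_ →₀ S) →ₗ[S] (_ →₀ S), ∀ x,
      (del n ∘ₗ del (n + 1)) x = ∑ j, f j • t j x := by
    intro n
    refine exists_sum_smul f _ fun x i => ?_
    rw [← Ideal.Quotient.eq_zero_iff_mem, ← hred]
    have : red n (del n (del (n + 1) x)) = 0 := by
      rw [hdel, hdel, ← LinearMap.comp_apply, ← ModuleCat.hom_comp, P.complex.d_comp_d]
      rfl
    rw [LinearMap.comp_apply, this]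
    simp
  choose t ht using ht
  exact ⟨{  res := P
            lift := fun n => _ →₀ S
            red := red
            isBaseChange := fun n => IsBaseChange.of_basis S (b n)
            del := del
            red_del := hdel
            t := fun j n => t n j
            del_del := ht }⟩

end CIResolution

namespace CIResolution

variable {S : Type u} [CommRing S] {c : ℕ} {f : Fin c → S}
    {M : ModuleCat.{u} (S ⧸ Ideal.span (Set.range f))} (D : CIResolution f M)

theorem red_eq_zero (n : ℕ) (v : D.lift n)
    (hv : ∀ i, (Module.Free.chooseBasis S (D.lift n)).repr v i ∈ Ideal.span (Set.range f)) :
    D.red n v = 0 := by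
  rw [← (Module.Free.chooseBasis S (D.lift n)).linearCombination_repr v,
    Finsupp.linearCombination_apply, Finsupp.sum, map_sum]
  refine Finset.sum_eq_zero fun i _ => ?_
  rw [map_smul, ← algebraMap_smul (S ⧸ Ideal.span (Set.range f)),
    Ideal.Quotient.algebraMap_eq, Ideal.Quotient.eq_zero_iff_mem.2 (hv i), zero_smul]

/-- The CI operators commute with the differential. -/
theorem op_comp_d (hf : RingTheory.Sequence.IsWeaklyRegular S (List.ofFn f))
    (j : Fin c) (n : ℕ) :
    D.op j (n + 1) ≫ D.res.complex.d (n + 1) n =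
      D.res.complex.d (n + 3) (n + 2) ≫ D.op j n := by
  ext1
  refine (D.isBaseChange (n + 3)).algHom_ext _ _ fun x => ?_
  have h1 : (D.res.complex.d (n + 1) n).hom ((D.op j (n + 1)).hom (D.red (n + 3) x)) =
      D.red n (D.del n (D.t j (n + 1) x)) := by
    rw [D.red_del, D.op_red]
  have h2 : (D.op j n).hom ((D.res.complex.d (n + 3) (n + 2)).hom (D.red (n + 3) x)) =
      D.red n (D.t j n (D.del (n + 2) x)) := by
    rw [← D.red_del, D.op_red]
  have h3 : D.red n (D.del n (D.t j (n + 1) x) - D.t j n (D.del (n + 2) x)) = 0 := by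
    refine D.red_eq_zero n _ fun i => ?_
    refine mem_span_of_sum_mul_eq_zero f (mem_span_of_mul_mem_span_of_isWeaklyRegular f hf)
      (fun j => (Module.Free.chooseBasis S (D.lift n)).repr
        (D.del n (D.t j (n + 1) x) - D.t j n (D.del (n + 2) x)) i) ?_ j
    have h4 : ∑ j, f j • (D.del n (D.t j (n + 1) x) - D.t j n (D.del (n + 2) x)) = 0 := by
      simp only [smul_sub, Finset.sum_sub_distrib]
      rw [← D.del_del, sub_eq_zero, D.del_del n, ← D.del_del n, D.del_del (n + 1), map_sum]
      simp only [map_smul]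
    have h5 := congrArg (fun v => (Module.Free.chooseBasis S (D.lift n)).repr v i) h4
    simpa [map_sum, Finsupp.finsetSum_apply] using h5
  rw [map_sub, sub_eq_zero] at h3
  exact h1.trans (h3.trans h2.symm)

variable (Y : ModuleCat.{u} (S ⧸ Ideal.span (Set.range f)))

/-- The cocycles of degree `n` in `Hom(V, Y)`. -/
noncomputable def cocycles (n : ℕ) : Submodule S (D.res.complex.X n ⟶ Y) :=
  LinearMap.ker (Linear.leftComp S Y (D.res.complex.d (n + 1) n))

theorem mem_cocycles {n : ℕ} {φ : D.res.complex.X n ⟶ Y} :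
    φ ∈ D.cocycles Y n ↔ D.res.complex.d (n + 1) n ≫ φ = 0 := Iff.rfl

/-- The class in `Ext^n(M, Y)` of a cocycle. -/
noncomputable def toExt (n : ℕ) : D.cocycles Y n →ₗ[S] Abelian.Ext.{u} M Y n where
  toFun φ := D.res.extMk φ.1 (n + 1) rfl φ.2
  map_add' φ ψ := (D.res.add_extMk _ _ _ _ _ _).symm
  map_smul' r φ := by
    refine Eq.trans ?_ (Abelian.Ext.smul_eq_comp_mk₀ _ _).symm
    refine Eq.trans ?_ (D.res.extMk_comp_mk₀ φ.1 (n + 1) rfl φ.2 (r • 𝟙 Y)).symm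
    have h : (r • φ).1 = φ.1 ≫ (r • 𝟙 Y) := by
      rw [Linear.comp_smul, Category.comp_id]
      rfl
    congr 1

theorem toExt_surjective (n : ℕ) : Function.Surjective (D.toExt Y n) := fun α => by
  obtain ⟨φ, hφ, h⟩ := D.res.extMk_surjective α (n + 1) rfl
  exact ⟨⟨φ, hφ⟩, h⟩

theorem op_comp_mem_cocycles (hf : RingTheory.Sequence.IsWeaklyRegular S (List.ofFn f))
    (j : Fin c) {n : ℕ} {φ : D.res.complex.X n ⟶ Y}
    (hφ : φ ∈ D.cocycles Y n) : D.op j n ≫ φ ∈ D.cocycles Y (n + 2) := by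
  rw [mem_cocycles] at hφ ⊢
  rw [← Category.assoc, ← D.op_comp_d hf j n, Category.assoc, hφ, Limits.comp_zero]

/-- Composition with `t_j`, on cocycles. -/
noncomputable def cocyclesMap (hf : RingTheory.Sequence.IsWeaklyRegular S (List.ofFn f))
    (j : Fin c) (n : ℕ) :
    D.cocycles Y n →ₗ[S] D.cocycles Y (n + 2) :=
  (Linear.leftComp S Y (D.op j n)).restrict fun _ hφ => D.op_comp_mem_cocycles Y hf j hφ

theorem ker_toExt_le (hf : RingTheory.Sequence.IsWeaklyRegular S (List.ofFn f))
    (j : Fin c) (n : ℕ) :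
    LinearMap.ker (D.toExt Y n) ≤
      LinearMap.ker (D.toExt Y (n + 2) ∘ₗ D.cocyclesMap Y hf j n) := by
  rintro ⟨φ, hφ⟩ h
  rw [LinearMap.mem_ker] at h ⊢
  replace hφ : D.res.complex.d (n + 1) n ≫ φ = 0 := hφ
  have hψ : D.res.complex.d (n + 3) (n + 2) ≫ D.op j n ≫ φ = 0 :=
    D.op_comp_mem_cocycles Y hf j hφ
  change D.res.extMk φ (n + 1) rfl hφ = 0 at h
  change D.res.extMk (D.op j n ≫ φ) (n + 3) rfl hψ = 0
  cases n with
  | zero =>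
    have : φ = 0 := by
      rw [← D.res.extEquivCohomologyClass.apply_eq_iff_eq,
        ProjectiveResolution.extEquivCohomologyClass_extMk,
        ProjectiveResolution.extEquivCohomologyClass_zero,
        CochainComplex.HomComplex.CohomologyClass.mk_eq_zero_iff,
        CochainComplex.HomComplex.Cocycle.toSingleMk_mem_coboundaries_iff _ _ _ _ _ 1
          (by simp)] at h
      obtain ⟨g, hg⟩ := h
      have hz : Limits.IsZero (D.res.cochainComplex.X 1) :=
        CochainComplex.isZero_of_isStrictlyLE _ 0 _ (by simp)
      rw [hz.eq_of_src g 0, Limits.comp_zero] at hg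
      rw [← cancel_epi (D.res.cochainComplexXIso (-(0 : ℕ)) 0 rfl).hom, Limits.comp_zero]
      exact hg.symm
    subst this
    simp
  | succ n =>
    rw [D.res.extMk_eq_zero_iff _ _ _ _ n rfl] at h
    obtain ⟨g, rfl⟩ := h
    rw [D.res.extMk_eq_zero_iff _ _ _ _ (n + 2) rfl]
    exact ⟨D.op j n ≫ g, by rw [← Category.assoc, ← D.op_comp_d hf, Category.assoc]⟩

/-- The operator `χ_j : Ext^n(M, Y) → Ext^{n+2}(M, Y)` induced by `t_j`. -/
noncomputable def extOp (hf : RingTheory.Sequence.IsWeaklyRegular S (List.ofFn f))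
    (j : Fin c) (n : ℕ) :
    Abelian.Ext.{u} M Y n →ₗ[S] Abelian.Ext.{u} M Y (n + 2) :=
  (LinearMap.ker (D.toExt Y n)).liftQ (D.toExt Y (n + 2) ∘ₗ D.cocyclesMap Y hf j n)
      (D.ker_toExt_le Y hf j n) ∘ₗ
    ((D.toExt Y n).quotKerEquivOfSurjective (D.toExt_surjective Y n)).symm.toLinearMap

theorem extOp_extMk (hf : RingTheory.Sequence.IsWeaklyRegular S (List.ofFn f))
    (j : Fin c) (n : ℕ) (φ : D.res.complex.X n ⟶ Y)
    (hφ : D.res.complex.d (n + 1) n ≫ φ = 0) :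
    D.extOp Y hf j n (D.res.extMk φ (n + 1) rfl hφ) =
      D.res.extMk (D.op j n ≫ φ) (n + 3) rfl (D.op_comp_mem_cocycles Y hf j hφ) := by
  have h : ((D.toExt Y n).quotKerEquivOfSurjective (D.toExt_surjective Y n)).symm
      (D.toExt Y n ⟨φ, hφ⟩) = Submodule.Quotient.mk ⟨φ, hφ⟩ := by
    rw [LinearEquiv.symm_apply_eq]
    rfl
  refine (congrArg ((LinearMap.ker (D.toExt Y n)).liftQ _ (D.ker_toExt_le Y hf j n)) h).trans ?_
  rfl

/-- The operator `χ_j` on the graded module `Ext(M, Y)`. -/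
noncomputable def ciOperator (hf : RingTheory.Sequence.IsWeaklyRegular S (List.ofFn f))
    (j : Fin c) : TotalExt M Y →ₗ[S] TotalExt M Y :=
  DirectSum.toModule S ℕ _ fun n =>
    DirectSum.lof S ℕ (fun n => Abelian.Ext.{u} M Y n) (n + 2) ∘ₗ D.extOp Y hf j n

end CIResolution

/-! ### Higher matrix factorizations -/

/-- The ideal `(f_1, …, f_{p-1})`; as indices run through `Fin c`, these are the `f q` with
`q < p`. -/
def prevIdeal {S : Type u} [CommRing S] {c : ℕ} (f : Fin c → S) (p : Fin c) : Ideal S :=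
  Ideal.span (f '' {q | q < p})

/-- A higher matrix factorization with respect to `f_1, …, f_c`. The index `p : Fin c` stands for
`p + 1 ∈ {1, …, c}`, so that `fil s p.succ` is `A_s(p)` and `fil s p.castSucc` is `A_s(p-1)`. -/
structure HigherMatrixFactorization {S : Type u} [CommRing S] {c : ℕ} (f : Fin c → S)
    (A : Fin 2 → Type u) [∀ s, AddCommGroup (A s)] [∀ s, Module S (A s)]
    [∀ s, Module.Free S (A s)] [∀ s, Module.Finite S (A s)] where
  /-- The filtrations `0 = A_s(0) ⊆ A_s(1) ⊆ ⋯ ⊆ A_s(c) = A_s`. -/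
  fil : ∀ s, Fin (c + 1) → Submodule S (A s)
  fil_zero : ∀ s, fil s 0 = ⊥
  fil_last : ∀ s, fil s (Fin.last c) = ⊤
  fil_free : ∀ s p, Module.Free S (fil s p)
  /-- `A_s(p-1)` is a direct summand of `A_s(p)`. -/
  fil_summand : ∀ s (p : Fin c), ∃ C : Submodule S (A s),
    fil s p.castSucc ⊔ C = fil s p.succ ∧ Disjoint (fil s p.castSucc) C
  d : A 1 →ₗ[S] A 0
  d_mem : ∀ p, ∀ x ∈ fil 1 p, d x ∈ fil 0 p
  /-- The components `h_p : A_0(p) → A_1(p)`. A map `h : ⨁_q A_0(q) → A_1` preserves the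
  filtrations exactly if its `p`-th component takes values in `A_1(p)`, for all `p`. -/
  h : ∀ p : Fin c, fil 0 p.succ →ₗ[S] fil 1 p.succ
  /-- `d_p h_p ≡ f_p` modulo `(f_1, …, f_{p-1}) A_0(p)`. -/
  d_h : ∀ (p : Fin c) (x : fil 0 p.succ),
    d.restrict (d_mem p.succ) (h p x) - f p • x ∈
      (prevIdeal f p • ⊤ : Submodule S (fil 0 p.succ))
  /-- `π_p h_p d_p ≡ f_p π_p` modulo `(f_1, …, f_{p-1}) (A_1(p) / A_1(p-1))`. -/
  h_d : ∀ (p : Fin c) (x : fil 1 p.succ),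
    ((fil 1 p.castSucc).submoduleOf (fil 1 p.succ)).mkQ
        (h p (d.restrict (d_mem p.succ) x)) -
      f p • ((fil 1 p.castSucc).submoduleOf (fil 1 p.succ)).mkQ x ∈
      (prevIdeal f p • ⊤ :
        Submodule S (fil 1 p.succ ⧸ (fil 1 p.castSucc).submoduleOf (fil 1 p.succ)))

namespace HigherMatrixFactorization

variable {S : Type u} [CommRing S] {c : ℕ} {f : Fin c → S}
    {A : Fin 2 → Type u} [∀ s, AddCommGroup (A s)] [∀ s, Module S (A s)]
    [∀ s, Module.Free S (A s)] [∀ s, Module.Finite S (A s)]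

/-- Over a local ring: the images of `d` and of `h` lie in the maximal ideal times the target. -/
def IsMinimal [IsLocalRing S] (H : HigherMatrixFactorization f A) : Prop :=
  (∀ x, H.d x ∈ (IsLocalRing.maximalIdeal S • ⊤ : Submodule S (A 0))) ∧
    ∀ p x, (H.h p x : A 1) ∈ (IsLocalRing.maximalIdeal S • ⊤ : Submodule S (A 1))

/-- The module `M = Coker (R ⊗ d)` over `R = S / (f_1, …, f_c)`; it is also an `S`-module. -/
abbrev coker (H : HigherMatrixFactorization f A) : Type u :=
  ((S ⧸ Ideal.span (Set.range f)) ⊗[S] A 0) ⧸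
    LinearMap.range (H.d.baseChange (S ⧸ Ideal.span (Set.range f)))

/-- A choice of splittings `A_s(p) = A_s(p-1) ⊕ B_s(p)`. -/
def IsSplitting (H : HigherMatrixFactorization f A)
    (B : ∀ s, Fin c → Submodule S (A s)) : Prop :=
  ∀ s (p : Fin c), H.fil s p.castSucc ⊔ B s p = H.fil s p.succ ∧
    Disjoint (H.fil s p.castSucc) (B s p)

end HigherMatrixFactorization

/-! ### The graded vector spaces in the decompositions -/

section Graded

variable {S : Type u} [CommRing S] [IsLocalRing S]

/-- The residue field of `S` as a module over `S / I`. -/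
noncomputable def residueFieldQuot {I : Ideal S} (hI : I ≤ IsLocalRing.maximalIdeal S) :
    ModuleCat.{u} (S ⧸ I) :=
  letI : Module (S ⧸ I) (IsLocalRing.ResidueField S) :=
    Module.compHom _ (Ideal.Quotient.lift I (IsLocalRing.residue S) fun _ ha =>
      Ideal.Quotient.eq_zero_iff_mem.2 (hI ha))
  ModuleCat.of (S ⧸ I) (IsLocalRing.ResidueField S)

variable {c : ℕ} {A : Fin 2 → Type u} [∀ s, AddCommGroup (A s)] [∀ s, Module S (A s)]

/-- `Hom_S(B(p), k)`, where `B(p) = B_0(p) ⊕ B_1(p)`. -/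
abbrev HomB (B : ∀ s, Fin c → Submodule S (A s)) (p : Fin c) : Type u :=
  (DirectSum (Fin 2) fun s => B s p) →ₗ[S] IsLocalRing.ResidueField S

/-- The degree `s` part `Hom_S(B_s(p), k)` of `Hom_S(B(p), k)`: the maps that vanish on the other
summand. -/
def HomB.degree (B : ∀ s, Fin c → Submodule S (A s)) (p : Fin c) (s : Fin 2) :
    Submodule (IsLocalRing.ResidueField S) (HomB B p) where
  carrier := {φ | ∀ s', s' ≠ s → φ ∘ₗ DirectSum.lof S (Fin 2) (fun s => B s p) s' = 0}
  zero_mem' := fun _ _ => rfl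
  add_mem' := fun hφ hψ s' hs => by rw [LinearMap.add_comp, hφ s' hs, hψ s' hs, add_zero]
  smul_mem' := fun a φ hφ s' hs => by rw [LinearMap.smul_comp, hφ s' hs, smul_zero]

/-- The summand `k⟨e_1, …, e_{p-1}⟩ ⊗ Hom_S(B(p), k)`, with an exterior algebra. -/
abbrev ExteriorSummand (B : ∀ s, Fin c → Submodule S (A s)) (p : Fin c) : Type u :=
  ExteriorAlgebra (IsLocalRing.ResidueField S)
      ({i : Fin c // i < p} → IsLocalRing.ResidueField S)
    ⊗[IsLocalRing.ResidueField S] HomB B p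

/-- `⨁_p k⟨e_1, …, e_{p-1}⟩ ⊗ Hom_S(B(p), k)`. -/
abbrev ExteriorSum (B : ∀ s, Fin c → Submodule S (A s)) : Type u :=
  DirectSum (Fin c) fun p => ExteriorSummand B p

/-- The degree `n` part, where the `e_i` have degree `1`: sums of `g ⊗ φ` with `g ∈ ⋀^a`, `φ` of
degree `s` and `a + s = n`. -/
noncomputable def ExteriorSum.degree (B : ∀ s, Fin c → Submodule S (A s)) (n : ℕ) :
    Submodule (IsLocalRing.ResidueField S) (ExteriorSum B) :=
  Submodule.span _ {y | ∃ (p : Fin c) (a : ℕ) (s : Fin 2), a + (s : ℕ) = n ∧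
    ∃ g ∈ ⋀[IsLocalRing.ResidueField S]^a ({i : Fin c // i < p} → IsLocalRing.ResidueField S),
    ∃ φ ∈ HomB.degree B p s,
      y = DirectSum.of (fun p => ExteriorSummand B p) p (g ⊗ₜ φ)}

/-- The summand `k[χ_p, …, χ_c] ⊗ Hom_S(B(p), k)`. -/
abbrev PolynomialSummand (B : ∀ s, Fin c → Submodule S (A s)) (p : Fin c) : Type u :=
  MvPolynomial {i : Fin c // p ≤ i} (IsLocalRing.ResidueField S)
    ⊗[IsLocalRing.ResidueField S] HomB B p

/-- `⨁_p k[χ_p, …, χ_c] ⊗ Hom_S(B(p), k)`. -/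
abbrev PolynomialSum (B : ∀ s, Fin c → Submodule S (A s)) : Type u :=
  DirectSum (Fin c) fun p => PolynomialSummand B p

/-- The degree `n` part, where the variables `χ_i` have degree `2`: sums of `g ⊗ φ` with `g` a
form of degree `a` in the usual sense, `φ` of degree `s` and `2 a + s = n`. -/
noncomputable def PolynomialSum.degree (B : ∀ s, Fin c → Submodule S (A s)) (n : ℕ) :
    Submodule (IsLocalRing.ResidueField S) (PolynomialSum B) :=
  Submodule.span _ {y | ∃ (p : Fin c) (a : ℕ) (s : Fin 2), 2 * a + (s : ℕ) = n ∧
    ∃ g : MvPolynomial {i : Fin c // p ≤ i} (IsLocalRing.ResidueField S), g.IsHomogeneous a ∧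
    ∃ φ ∈ HomB.degree B p s,
      y = DirectSum.of (fun p => PolynomialSummand B p) p (g ⊗ₜ φ)}

end Graded

/-! ### Free modules modulo an ideal -/

section ModuloIdeal

variable {S : Type*} [CommRing S] {N : Type*} [AddCommGroup N] [Module S N]
  {N' : Type*} [AddCommGroup N'] [Module S N']

/-! Both parts go through the elements f_p one at a time. Let I_p = (f_1, …, f_p) and let M(p) be
the cokernel of d_p modulo I_p, so that M(0) = 0 and M(c) = M.

Over the complete intersection, a minimal resolution of M(p) over S/I_p is built together with a
lifting to S (`MinimalResolution.nonempty_succ`). Let G be the lifting for M(p-1), and let U = G ⊕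
B(p), with B(p) in degrees 0 and 1 attached by d. Modulo I_{p-1}, U is still exact in positive
degrees: d_p x ≡ 0 implies f_p π_p x ≡ π_p h_p d_p x ≡ 0, and f_p is regular modulo I_{p-1}. The
congruence d_p h_p ≡ f_p makes h_p the start of a system of homotopies for f_p. The Shamash
construction then gives a resolution over S/I_p with terms U_n ⊕ U_{n-2} ⊕ ⋯, whose operator t_p is
the projection that drops the first summand.

The delicate point is minimality, because the higher homotopies s are arbitrary liftings
(`residueField_apply_eq_zero`). Write the square of the differential of U as ∑ f_j τ_j. Every form
U_{n+2} → k is a sum of forms ψ_j τ_j. Applying the differential to the homotopy identity and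
comparing the coefficients of the f_j expresses τ_j s, modulo the maximal ideal, through maps
already known to vanish there. The comparison is legitimate because the syzygies of a regular
sequence have coefficients in the ideal that it generates. The same device shows that the CI
operators commute on forms, and that they do not depend on the choices.

By minimality, Ext_R(M, k) is the graded dual of the resolution. On the dual of the Shamash
construction χ_p is injective, and its cokernel is the dual of U, that is, the previous dual plus
Hom(B(p), k). Induction on p gives a basis of monomials times forms on the layers B(q), where only
variables χ_i with i ≥ q occur (`IsLayered.succ`).

Over S a count of dimensions suffices, as only a graded isomorphism is claimed. The sequence 0 →
B_1(p)/I_{p-1} → M(p-1) ⊕ B_0(p)/I_{p-1} → M(p) → 0 is exact, and its first map induces 0 on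
Ext_S(-, k), since its image lies in the maximal ideal times the target and the modules B_s(p) are
free. The long exact sequence therefore splits, and Koszul homology contributes the binomial
coefficients. -/

theorem LinearMap.apply_mem_smul_top (I : Ideal S) (g : N →ₗ[S] N') {x : N}
    (hx : x ∈ (I • ⊤ : Submodule S N)) : g x ∈ (I • ⊤ : Submodule S N') := by
  have h := Submodule.mem_map_of_mem (f := g) hx
  rw [Submodule.map_smul''] at h
  exact Submodule.smul_mono le_rfl le_top h

theorem Module.Basis.mem_smul_top_iff {ι : Type*} (b : Module.Basis ι S N) (I : Ideal S) (x : N) :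
    x ∈ (I • ⊤ : Submodule S N) ↔ ∀ i, b.repr x i ∈ I := by
  constructor
  · intro hx i
    have h := LinearMap.apply_mem_smul_top I (b.coord i) hx
    simpa using h
  · intro hx
    rw [← b.linearCombination_repr x, Finsupp.linearCombination_apply, Finsupp.sum]
    exact sum_mem fun i _ => Submodule.smul_mem_smul (hx i) Submodule.mem_top

theorem exists_sum_smul_of_mem_span_image_smul_top {c : ℕ} (f : Fin c → S) (s : Set (Fin c))
    {x : N} (hx : x ∈ (Ideal.span (f '' s) • ⊤ : Submodule S N)) :
    ∃ y : Fin c → N, (∀ j ∉ s, y j = 0) ∧ x = ∑ j, f j • y j := by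
  classical
  induction hx using Submodule.smul_induction_on' with
  | smul a ha n _ =>
    induction ha using Submodule.span_induction with
    | mem a ha =>
      obtain ⟨i, hi, rfl⟩ := ha
      refine ⟨Pi.single i n, fun j hj => Pi.single_eq_of_ne (fun h => hj (by rwa [h])) _, ?_⟩
      rw [Finset.sum_eq_single i]
      · simp
      · intro j _ hj
        simp [Pi.single_eq_of_ne hj]
      · simp
    | zero => exact ⟨0, fun _ _ => rfl, by simp⟩
    | add a b _ _ ha hb =>
      obtain ⟨y, hy, hya⟩ := ha
      obtain ⟨z, hz, hzb⟩ := hb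
      exact ⟨y + z, fun j hj => by simp [hy j hj, hz j hj],
        by simp [add_smul, hya, hzb, Finset.sum_add_distrib]⟩
    | smul r a _ ha =>
      obtain ⟨y, hy, hya⟩ := ha
      refine ⟨r • y, fun j hj => by simp [hy j hj], ?_⟩
      rw [smul_eq_mul, mul_smul, hya, Finset.smul_sum]
      exact Finset.sum_congr rfl fun j _ => smul_comm _ _ _
  | add a _ b _ ha hb =>
    obtain ⟨y, hy, hya⟩ := ha
    obtain ⟨z, hz, hzb⟩ := hb
    exact ⟨y + z, fun j hj => by simp [hy j hj, hz j hj],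
      by simp [hya, hzb, Finset.sum_add_distrib]⟩

/-- A congruence modulo some of the f_j becomes an equation whose coefficients are linear maps, so
that coefficients can later be compared. They are chosen on a basis of the source. -/
theorem LinearMap.exists_sum_smul_of_forall_mem [Module.Free S N] {c : ℕ} (f : Fin c → S)
    (s : Set (Fin c)) (g : N →ₗ[S] N')
    (hg : ∀ x, g x ∈ (Ideal.span (f '' s) • ⊤ : Submodule S N')) :
    ∃ t : Fin c → N →ₗ[S] N', (∀ j ∉ s, t j = 0) ∧ ∀ x, g x = ∑ j, f j • t j x := by
  let b := Module.Free.chooseBasis S N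
  choose y hy hgy using fun i => exists_sum_smul_of_mem_span_image_smul_top f s (hg (b i))
  refine ⟨fun j => b.constr S fun i => y i j, fun j hj => b.ext fun i => ?_, fun x => ?_⟩
  · simp [hy i j hj]
  · have : g = ∑ j, f j • b.constr S fun i => y i j := b.ext fun i => by simp [hgy]
    simpa using LinearMap.congr_fun this x

/-- Projectivity of the reduction of a free module, phrased with congruences over S so that the
lifting is a map over S. -/
theorem LinearMap.exists_lift_modulo [Module.Free S N] {N'' : Type*} [AddCommGroup N'']
    [Module S N''] (I : Ideal S) (d : N' →ₗ[S] N'') (g : N →ₗ[S] N'')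
    (hg : ∀ x, ∃ y, d y - g x ∈ (I • ⊤ : Submodule S N'')) :
    ∃ s : N →ₗ[S] N', ∀ x, d (s x) - g x ∈ (I • ⊤ : Submodule S N'') := by
  let b := Module.Free.chooseBasis S N
  choose y hy using fun i => hg (b i)
  refine ⟨b.constr S y, fun x => ?_⟩
  have : (I • ⊤ : Submodule S N'').mkQ ∘ₗ (d ∘ₗ b.constr S y - g) = 0 :=
    b.ext fun i => by
      refine (Submodule.Quotient.mk_eq_zero _).2 ?_
      simpa using hy i
  exact (Submodule.Quotient.mk_eq_zero _).1 (LinearMap.congr_fun this x)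

theorem mem_smul_top_of_smul_mem [Module.Free S N] (I : Ideal S) (a : S)
    (ha : ∀ x, a * x ∈ I → x ∈ I) {x : N} (hx : a • x ∈ (I • ⊤ : Submodule S N)) :
    x ∈ (I • ⊤ : Submodule S N) := by
  let b := Module.Free.chooseBasis S N
  rw [b.mem_smul_top_iff] at hx ⊢
  intro i
  exact ha _ (by simpa using hx i)

/-- In coordinates, this is the fact that the syzygies of a regular sequence have coefficients in
the ideal generated by it. -/
theorem mem_smul_top_of_sum_smul_eq_zero [Module.Free S N] {c : ℕ} (f : Fin c → S)
    (hf : RingTheory.Sequence.IsWeaklyRegular S (List.ofFn f)) (x : Fin c → N)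
    (hx : ∑ j, f j • x j = 0) (j : Fin c) :
    x j ∈ (Ideal.span (Set.range f) • ⊤ : Submodule S N) := by
  let b := Module.Free.chooseBasis S N
  rw [b.mem_smul_top_iff]
  intro i
  refine mem_span_of_sum_mul_eq_zero f (mem_span_of_mul_mem_span_of_isWeaklyRegular f hf)
    (fun j => b.repr (x j) i) ?_ j
  simpa [map_sum, Finsupp.finsetSum_apply] using congrArg (fun v => b.repr v i) hx

theorem exists_sub_smul_mem_of_mem_sup_span_singleton_smul (I : Ideal S) (a : S) {x : N}
    (hx : x ∈ ((I ⊔ Ideal.span {a}) • ⊤ : Submodule S N)) :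
    ∃ w, x - a • w ∈ (I • ⊤ : Submodule S N) := by
  rw [Submodule.sup_smul, Submodule.mem_sup] at hx
  obtain ⟨y, hy, z, hz, rfl⟩ := hx
  rw [Submodule.ideal_span_singleton_smul] at hz
  obtain ⟨w, -, rfl⟩ := hz
  exact ⟨w, by simpa using hy⟩

theorem smul_mem_sup_span_singleton_smul (I : Ideal S) (a : S) (x : N) :
    a • x ∈ ((I ⊔ Ideal.span {a}) • ⊤ : Submodule S N) :=
  Submodule.smul_mem_smul (Ideal.mem_sup_right (Ideal.mem_span_singleton_self a))
    Submodule.mem_top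

end ModuloIdeal

/-! ### Forms with values in the residue field -/

section ResidueField

variable {S : Type*} [CommRing S] [IsLocalRing S] {N : Type*} [AddCommGroup N] [Module S N]

theorem LinearMap.residueField_apply_eq_zero {I : Ideal S}
    (hI : I ≤ IsLocalRing.maximalIdeal S) (φ : N →ₗ[S] IsLocalRing.ResidueField S) {x : N}
    (hx : x ∈ (I • ⊤ : Submodule S N)) : φ x = 0 := by
  induction hx using Submodule.smul_induction_on' with
  | smul a ha n _ =>
    rw [map_smul, Algebra.smul_def, IsLocalRing.ResidueField.algebraMap_eq,
      (IsLocalRing.residue_eq_zero_iff a).2 (hI ha), zero_mul]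
  | add x _ y _ hx hy => rw [map_add, hx, hy, add_zero]

/-- The comparison of coefficients used throughout: in an identity ∑ f_j u_j = ∑ f_j v_j, a form
cannot distinguish u_j from v_j, since their difference lies in (f_1, …, f_c) times a free module.
-/
theorem LinearMap.residueField_eq_of_sum_smul_sub_eq_zero [Module.Free S N] {c : ℕ} (f : Fin c → S)
    (hf : RingTheory.Sequence.IsRegular S (List.ofFn f))
    (φ : N →ₗ[S] IsLocalRing.ResidueField S) (x : Fin c → N) (hx : ∑ j, f j • x j = 0)
    (j : Fin c) : φ (x j) = 0 :=
  φ.residueField_apply_eq_zero (span_range_le_maximalIdeal f hf)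
    (mem_smul_top_of_sum_smul_eq_zero f hf.toIsWeaklyRegular x hx j)

end ResidueField

/-! ### The Shamash construction

Let `(U, dU)` be a graded module with a differential whose square vanishes modulo an ideal `I`. The
construction for an element `a` that acts as zero on the homology has the terms
`U_n ⊕ U_{n-2} ⊕ U_{n-4} ⊕ ⋯`. -/

namespace Shamash

/-- The terms `U_n ⊕ U_{n-2} ⊕ U_{n-4} ⊕ ⋯` of the Shamash construction. -/
def Total (U : ℕ → Type u) : ℕ → Type u
  | 0 => U 0
  | 1 => U 1
  | n + 2 => U (n + 2) × Total U n

section Terms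

variable {U : ℕ → Type u} [∀ n, AddCommGroup (U n)]

instance : ∀ n, AddCommGroup (Total U n)
  | 0 => inferInstanceAs (AddCommGroup (U 0))
  | 1 => inferInstanceAs (AddCommGroup (U 1))
  | n + 2 =>
    letI := instAddCommGroupTotal n
    inferInstanceAs (AddCommGroup (U (n + 2) × Total U n))

variable (S : Type*) [CommRing S] [∀ n, Module S (U n)]

instance instModuleTotal : ∀ n, Module S (Total U n)
  | 0 => inferInstanceAs (Module S (U 0))
  | 1 => inferInstanceAs (Module S (U 1))
  | n + 2 =>
    letI := instModuleTotal n
    inferInstanceAs (Module S (U (n + 2) × Total U n))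

instance free_total [∀ n, Module.Free S (U n)] : ∀ n, Module.Free S (Total U n)
  | 0 => inferInstanceAs (Module.Free S (U 0))
  | 1 => inferInstanceAs (Module.Free S (U 1))
  | n + 2 =>
    letI := free_total n
    inferInstanceAs (Module.Free S (U (n + 2) × Total U n))

instance finite_total [∀ n, Module.Finite S (U n)] : ∀ n, Module.Finite S (Total U n)
  | 0 => inferInstanceAs (Module.Finite S (U 0))
  | 1 => inferInstanceAs (Module.Finite S (U 1))
  | n + 2 =>
    letI := finite_total n
    inferInstanceAs (Module.Finite S (U (n + 2) × Total U n))

variable (U)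

/-- The inclusion of the first summand. -/
def inc : ∀ n, U n →ₗ[S] Total U n
  | 0 => LinearMap.id
  | 1 => LinearMap.id
  | n + 2 => LinearMap.inl S (U (n + 2)) (Total U n)

/-- The projection to the first summand. -/
def pr : ∀ n, Total U n →ₗ[S] U n
  | 0 => LinearMap.id
  | 1 => LinearMap.id
  | n + 2 => LinearMap.fst S (U (n + 2)) (Total U n)

/-- The projection that omits the first summand. -/
def t (n : ℕ) : Total U (n + 2) →ₗ[S] Total U n := LinearMap.snd S (U (n + 2)) (Total U n)

/-- The inclusion of the other summands. -/
def ins (n : ℕ) : Total U n →ₗ[S] Total U (n + 2) := LinearMap.inr S (U (n + 2)) (Total U n)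

variable {U}

@[simp] theorem pr_inc : ∀ n (u : U n), pr U S n (inc U S n u) = u
  | 0, _ => rfl
  | 1, _ => rfl
  | _ + 2, _ => rfl

@[simp] theorem t_inc (n : ℕ) (u : U (n + 2)) : t U S n (inc U S (n + 2) u) = 0 := rfl

@[simp] theorem pr_ins (n : ℕ) (x : Total U n) : pr U S (n + 2) (ins U S n x) = 0 := rfl

@[simp] theorem t_ins (n : ℕ) (x : Total U n) : t U S n (ins U S n x) = x := rfl

theorem inc_pr_add_ins_t (n : ℕ) (x : Total U (n + 2)) :
    inc U S (n + 2) (pr U S (n + 2) x) + ins U S n (t U S n x) = x :=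
  Prod.ext (add_zero x.1) (zero_add x.2)

@[simp] theorem inc_pr_zero (x : Total U 0) : inc U S 0 (pr U S 0 x) = x := rfl

@[simp] theorem inc_pr_one (x : Total U 1) : inc U S 1 (pr U S 1 x) = x := rfl

theorem t_surjective (n : ℕ) : Function.Surjective (t U S n) := fun x => ⟨ins U S n x, rfl⟩

theorem total_mem_smul_top_iff (I : Ideal S) (n : ℕ) (x : Total U (n + 2)) :
    x ∈ (I • ⊤ : Submodule S (Total U (n + 2))) ↔
      pr U S (n + 2) x ∈ (I • ⊤ : Submodule S (U (n + 2))) ∧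
      t U S n x ∈ (I • ⊤ : Submodule S (Total U n)) := by
  constructor
  · exact fun h => ⟨LinearMap.apply_mem_smul_top I _ h, LinearMap.apply_mem_smul_top I _ h⟩
  · rintro ⟨h1, h2⟩
    rw [← inc_pr_add_ins_t S n x]
    exact add_mem (LinearMap.apply_mem_smul_top I _ h1) (LinearMap.apply_mem_smul_top I _ h2)

end Terms

section Differential

variable {S : Type*} [CommRing S] {U : ℕ → Type u} [∀ n, AddCommGroup (U n)]
  [∀ n, Module S (U n)] (dU : ∀ n, U (n + 1) →ₗ[S] U n) (h : U 0 →ₗ[S] U 1) (a : S)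
  (L : ∀ n, (Total U (n + 1) →ₗ[S] U (n + 1)) → (Total U (n + 1) →ₗ[S] U (n + 2)))

/-- The homotopies and differentials up to some degree. -/
abbrev State (S : Type*) [CommRing S] (U : ℕ → Type u) [∀ n, AddCommGroup (U n)]
    [∀ n, Module S (U n)] (n : ℕ) : Type _ :=
  (Total U n →ₗ[S] U (n + 1)) × (Total U (n + 1) →ₗ[S] Total U n) ×
    (Total U (n + 2) →ₗ[S] Total U (n + 1))

/-- The recursive choice of homotopies and differentials, where `L` is a choice of liftings. -/
def state : ∀ n, State S U n
  | 0 => (h ∘ₗ pr U S 0, inc U S 0 ∘ₗ dU 0 ∘ₗ pr U S 1,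
      inc U S 1 ∘ₗ (dU 1 ∘ₗ pr U S 2 + h ∘ₗ pr U S 0 ∘ₗ t U S 0))
  | n + 1 =>
    -- The homotopy identity demands that dU s_{n+1} be a pr - s_n del_n. The triple carries two
    -- consecutive differentials because del_{n+2} acts on the tail as del_n, while its first
    -- component uses s_{n+1}.
    let σ := L n (a • pr U S (n + 1) - (state n).1 ∘ₗ (state n).2.1)
    (σ, (state n).2.2, inc U S (n + 2) ∘ₗ (dU (n + 2) ∘ₗ pr U S (n + 3) + σ ∘ₗ t U S (n + 1)) +
      ins U S n ∘ₗ (state n).2.1 ∘ₗ t U S (n + 1))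

variable (I : Ideal S)

/-- A system of homotopies `s` for `a` on `(U, dU)` with the resulting differential `del` on
`Total U`. -/
structure IsHomotopySystem (s : ∀ n, Total U n →ₗ[S] U (n + 1))
    (del : ∀ n, Total U (n + 1) →ₗ[S] Total U n) : Prop where
  s_zero : ∀ x, s 0 x = h (pr U S 0 x)
  pr_del_zero : ∀ x, pr U S 0 (del 0 x) = dU 0 (pr U S 1 x)
  pr_del : ∀ n x, pr U S (n + 1) (del (n + 1) x) = dU (n + 1) (pr U S (n + 2) x) + s n (t U S n x)
  t_del : ∀ n x, t U S n (del (n + 2) x) = del n (t U S (n + 1) x)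
  homotopy_zero : ∀ x, dU 0 (s 0 x) - a • pr U S 0 x ∈ (I • ⊤ : Submodule S (U 0))
  homotopy : ∀ n x, dU (n + 1) (s (n + 1) x) + s n (del n x) - a • pr U S (n + 1) x ∈
    (I • ⊤ : Submodule S (U (n + 1)))
  del_del : ∀ n x, del n (del (n + 1) x) - a • t U S n x ∈ (I • ⊤ : Submodule S (Total U n))

/-- The map a pr - s_n del_n takes values in cycles modulo I: dU s_n del_n ≡ a pr del_n - s_{n-1}
del_{n-1} del_n ≡ a (dU pr + s_{n-1} t) - a s_{n-1} t = a dU pr. Exactness in positive degrees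
therefore yields s_{n+1}, and `h` provides the start. The homotopy identity and the formula for the
square of `del` depend on each other and are proved in one induction. -/
theorem exists_isHomotopySystem [∀ n, Module.Free S (U n)]
    (hdd : ∀ n x, dU n (dU (n + 1) x) ∈ (I • ⊤ : Submodule S (U n)))
    (hex : ∀ n x, dU n x ∈ (I • ⊤ : Submodule S (U n)) →
      ∃ y, dU (n + 1) y - x ∈ (I • ⊤ : Submodule S (U (n + 1))))
    (hh : ∀ x, dU 0 (h x) - a • x ∈ (I • ⊤ : Submodule S (U 0))) :
    ∃ s del, IsHomotopySystem dU h a I s del := by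
  classical
  -- A lifting is assigned to every g, with the default 0 if g does not take values in cycles. The
  -- recursion can then be run before its arguments are known to be liftable.
  have hL : ∀ n (g : Total U (n + 1) →ₗ[S] U (n + 1)), ∃ s : Total U (n + 1) →ₗ[S] U (n + 2),
      (∀ x, dU n (g x) ∈ (I • ⊤ : Submodule S (U n))) →
      ∀ x, dU (n + 1) (s x) - g x ∈ (I • ⊤ : Submodule S (U (n + 1))) := by
    intro n g
    by_cases hg : ∀ x, dU n (g x) ∈ (I • ⊤ : Submodule S (U n))
    · obtain ⟨s, hs⟩ := LinearMap.exists_lift_modulo I (dU (n + 1)) g fun x => hex n _ (hg x)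
      exact ⟨s, fun _ => hs⟩
    · exact ⟨0, fun h => absurd h hg⟩
  choose L hL using hL
  let st := state dU h a L
  let s := fun n => (st n).1
  let del := fun n => (st n).2.1
  have pr_del_zero : ∀ x, pr U S 0 (del 0 x) = dU 0 (pr U S 1 x) := fun _ => rfl
  have pr_del : ∀ n x, pr U S (n + 1) (del (n + 1) x) =
      dU (n + 1) (pr U S (n + 2) x) + s n (t U S n x) := by
    intro n x
    cases n with
    | zero => rfl
    | succ n =>
      change pr U S (n + 2) (inc U S (n + 2) _ + ins U S n _) = _
      rw [map_add, pr_inc, pr_ins, add_zero]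
      rfl
  have t_del : ∀ n x, t U S n (del (n + 2) x) = del n (t U S (n + 1) x) := by
    intro n x
    change t U S n (inc U S (n + 2) _ + ins U S n _) = _
    rw [map_add, t_inc, t_ins, zero_add]
    rfl
  -- This is s_{n-1} del_{n-1}, with value 0 for n = 0, so that the homotopy identity has the same
  -- form in all degrees.
  obtain ⟨prev, hprev0, hprev⟩ : ∃ prev : ∀ n, Total U n →ₗ[S] U n,
      (∀ x, prev 0 x = 0) ∧ ∀ m x, prev (m + 1) x = s m (del m x) :=
    ⟨fun n => match n with
      | 0 => 0
      | m + 1 => s m ∘ₗ del m, fun _ => rfl, fun _ _ => rfl⟩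
  have s_zero : ∀ x, s 0 x = h (pr U S 0 x) := fun _ => rfl
  have key : ∀ n, (∀ x, dU n (s n x) + prev n x - a • pr U S n x ∈
          (I • ⊤ : Submodule S (U n))) ∧
      ∀ x, del n (del (n + 1) x) - a • t U S n x ∈ (I • ⊤ : Submodule S (Total U n)) := by
    intro n
    induction n using Nat.strong_induction_on with
    | _ n ih =>
      have h1 : ∀ x, dU n (s n x) + prev n x - a • pr U S n x ∈
          (I • ⊤ : Submodule S (U n)) := by
        cases n with
        | zero =>
          intro x
          rw [hprev0, add_zero, s_zero]
          exact hh (pr U S 0 x)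
        | succ n =>
          have hg : ∀ x, dU n ((a • pr U S (n + 1) - s n ∘ₗ del n) x) ∈
              (I • ⊤ : Submodule S (U n)) := by
            intro x
            obtain ⟨ih1, ih2⟩ := ih n (Nat.lt_succ_self n)
            have e1 := ih1 (del n x)
            cases n with
            | zero =>
              have e3 := neg_mem e1
              simp only [LinearMap.sub_apply, LinearMap.smul_apply, LinearMap.comp_apply, map_sub,
                map_smul, hprev0, add_zero, pr_del_zero] at e3 ⊢
              rwa [neg_sub] at e3
            | succ n =>
              obtain ⟨-, ih3⟩ := ih n (by omega)
              have e3 := LinearMap.apply_mem_smul_top I (s n) (ih3 x)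
              have e4 := sub_mem e3 e1
              simp only [LinearMap.sub_apply, LinearMap.smul_apply, LinearMap.comp_apply, map_sub,
                map_smul, pr_del, hprev] at e4 ⊢
              convert e4 using 1
              module
          intro x
          rw [hprev]
          have e := hL n _ hg x
          simp only [LinearMap.sub_apply, LinearMap.smul_apply, LinearMap.comp_apply] at e ⊢
          convert e using 1
          change dU (n + 1) (s (n + 1) x) + _ - _ = dU (n + 1) (s (n + 1) x) - _
          module
      refine ⟨h1, fun x => ?_⟩
      rcases n with _ | _ | n
      · have e := add_mem (hdd 0 (pr U S 2 x)) (h1 (t U S 0 x))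
        have e2 := LinearMap.apply_mem_smul_top I (inc U S 0) e
        convert e2 using 1
        refine (inc_pr_zero S _).symm.trans (congrArg _ ?_)
        rw [map_sub, map_smul, pr_del_zero, pr_del 0, hprev0]
        simp only [map_add]
        module
      · have e := add_mem (hdd 1 (pr U S 3 x)) (h1 (t U S 1 x))
        have e2 := LinearMap.apply_mem_smul_top I (inc U S 1) e
        convert e2 using 1
        refine (inc_pr_one S _).symm.trans (congrArg _ ?_)
        rw [map_sub, map_smul, pr_del 0, pr_del 1, t_del 0, hprev]
        simp only [map_add]
        module
      · rw [total_mem_smul_top_iff]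
        constructor
        · have e := add_mem (hdd (n + 2) (pr U S (n + 4) x)) (h1 (t U S (n + 2) x))
          convert e using 1
          rw [map_sub, map_smul, pr_del (n + 1), pr_del (n + 2), t_del (n + 1), hprev]
          simp only [map_add]
          module
        · have e := (ih n (by omega)).2 (t U S (n + 2) x)
          convert e using 1
          rw [map_sub, map_smul, t_del n, t_del (n + 1)]
  exact ⟨s, del, s_zero, pr_del_zero, pr_del, t_del,
    fun x => by simpa [hprev0] using (key 0).1 x,
    fun n x => by simpa [hprev] using (key (n + 1)).1 x, fun n => (key n).2⟩

end Differential

end Shamash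

/-- A graded module with a differential `del` whose square is `∑ f_j t_j`, where `del` and all the
forms in positive degree that are not generated under the `t_j` vanish modulo the maximal ideal. -/
structure IsMinimalLifting {S : Type*} [CommRing S] [IsLocalRing S] {c : ℕ} (f : Fin c → S)
    {G : ℕ → Type*} [∀ n, AddCommGroup (G n)] [∀ n, Module S (G n)]
    (del : ∀ n, G (n + 1) →ₗ[S] G n) (T : Fin c → ∀ n, G (n + 2) →ₗ[S] G n) : Prop where
  del_del : ∀ n x, del n (del (n + 1) x) = ∑ j, f j • T j n x
  minimal : ∀ n (φ : G n →ₗ[S] IsLocalRing.ResidueField S) x, φ (del n x) = 0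
  generated : ∀ n (φ : G (n + 2) →ₗ[S] IsLocalRing.ResidueField S),
    ∃ ψ : Fin c → G n →ₗ[S] IsLocalRing.ResidueField S, ∀ x, φ x = ∑ j, ψ j (T j n x)

theorem LinearMap.map_sum_smul {S N N' ι : Type*} [Fintype ι] [CommRing S] [AddCommGroup N]
    [Module S N] [AddCommGroup N'] [Module S N'] (g : N →ₗ[S] N') (f : ι → S) (x : ι → N) :
    g (∑ j, f j • x j) = ∑ j, f j • g (x j) := by
  simp only [map_sum, map_smul]

namespace IsMinimalLifting

variable {S : Type*} [CommRing S] [IsLocalRing S] {c : ℕ} {f : Fin c → S}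
    {G : ℕ → Type*} [∀ n, AddCommGroup (G n)] [∀ n, Module S (G n)] [∀ n, Module.Free S (G n)]
    {del : ∀ n, G (n + 1) →ₗ[S] G n} {T : Fin c → ∀ n, G (n + 2) →ₗ[S] G n}

/-- Let c_i = del T_i - T_i del. Associativity of del³ gives ∑ f_i c_i = 0, hence c_i = ∑ f_l θ_l.
Then del² T_i - T_i del² = del c_i + c_i del becomes an identity between combinations of the f_l,
whose coefficients are the commutators of T_l and T_i on one side and maps through `del`, invisible
to forms or factoring through minimality, on the other. -/
theorem apply_comm (hf : RingTheory.Sequence.IsRegular S (List.ofFn f))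
    (hG : IsMinimalLifting f del T) (i j : Fin c) (n : ℕ)
    (φ : G n →ₗ[S] IsLocalRing.ResidueField S) (x : G (n + 4)) :
    φ (T i n (T j (n + 2) x)) = φ (T j n (T i (n + 2) x)) := by
  have h1 : ∀ m, ∃ θ : Fin c → G (m + 3) →ₗ[S] G m, ∀ y,
      del m (T i (m + 1) y) - T i m (del (m + 2) y) = ∑ l, f l • θ l y := by
    intro m
    obtain ⟨θ, -, h⟩ := LinearMap.exists_sum_smul_of_forall_mem f Set.univ
      (del m ∘ₗ T i (m + 1) - T i m ∘ₗ del (m + 2)) fun y => by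
        rw [Set.image_univ]
        refine mem_smul_top_of_sum_smul_eq_zero f hf.toIsWeaklyRegular
          (fun l => (del m ∘ₗ T l (m + 1) - T l m ∘ₗ del (m + 2)) y) ?_ i
        simp only [LinearMap.sub_apply, LinearMap.comp_apply, smul_sub, Finset.sum_sub_distrib]
        rw [← hG.del_del m, hG.del_del (m + 1), map_sum, sub_eq_zero]
        simp only [map_smul]
    exact ⟨θ, h⟩
  obtain ⟨θ, hθ⟩ := h1 n
  obtain ⟨θ', hθ'⟩ := h1 (n + 1)
  have h2 : ∑ l, f l • (T l n (T i (n + 2) x) - T i n (T l (n + 2) x) -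
      θ l (del (n + 3) x) - del n (θ' l x)) = 0 := by
    simp only [smul_sub, Finset.sum_sub_distrib]
    rw [← hG.del_del n, ← hθ, ← (T i n).map_sum_smul, ← hG.del_del (n + 2),
      ← (del n).map_sum_smul, ← hθ', map_sub]
    abel
  have h3 := φ.residueField_eq_of_sum_smul_sub_eq_zero f hf _ h2 j
  have h4 : φ (θ j (del (n + 3) x)) = 0 := hG.minimal _ (φ ∘ₗ θ j) x
  rw [map_sub, map_sub, map_sub, hG.minimal, h4, sub_zero, sub_zero, sub_eq_zero] at h3
  exact h3.symm

end IsMinimalLifting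

/-! ### Exactness and minimality of the Shamash construction -/

namespace Shamash

variable {S : Type*} [CommRing S] {U : ℕ → Type u} [∀ n, AddCommGroup (U n)]
  [∀ n, Module S (U n)] {dU : ∀ n, U (n + 1) →ₗ[S] U n} {h : U 0 →ₗ[S] U 1} {a : S} {I : Ideal S}
  {s : ∀ n, Total U n →ₗ[S] U (n + 1)} {del : ∀ n, Total U (n + 1) →ₗ[S] Total U n}

namespace IsHomotopySystem

theorem pr_del_add (H : IsHomotopySystem dU h a I s del) (n : ℕ) (v : U (n + 2))
    (w : Total U n) : pr U S (n + 1) (del (n + 1) (inc U S (n + 2) v + ins U S n w)) =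
      dU (n + 1) v + s n w := by
  rw [H.pr_del, map_add, map_add (t U S n), pr_inc, pr_ins, t_inc, t_ins, zero_add, add_zero]

theorem t_del_add (H : IsHomotopySystem dU h a I s del) (n : ℕ) (v : U (n + 3))
    (w : Total U (n + 1)) : t U S n (del (n + 2) (inc U S (n + 3) v + ins U S (n + 1) w)) =
      del n w := by
  have h1 : t U S (n + 1) (inc U S (n + 3) v) = 0 := rfl
  have h2 : t U S (n + 1) (ins U S (n + 1) w) = w := rfl
  rw [H.t_del, map_add, h1, h2, zero_add]

/-- Write del x ≡ a w modulo I. Applying `del` once more gives a (t x - del w) ≡ 0, so t x ≡ del w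
because a is regular modulo I. This makes w the tail of the preimage. Its first component is a
lifting v of pr x - s w, which the homotopy identity shows to be a cycle. Thus x is a boundary
modulo I itself, not only modulo I and a. -/
theorem exact [∀ n, Module.Free S (U n)] (H : IsHomotopySystem dU h a I s del)
    (ha : ∀ x, a * x ∈ I → x ∈ I)
    (hex : ∀ n x, dU n x ∈ (I • ⊤ : Submodule S (U n)) →
      ∃ y, dU (n + 1) y - x ∈ (I • ⊤ : Submodule S (U (n + 1)))) (n : ℕ) (x : Total U (n + 1))
    (hx : del n x ∈ ((I ⊔ Ideal.span {a}) • ⊤ : Submodule S (Total U n))) :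
    ∃ y, del (n + 1) y - x ∈ (I • ⊤ : Submodule S (Total U (n + 1))) := by
  obtain ⟨w, hw⟩ := exists_sub_smul_mem_of_mem_sup_span_singleton_smul I a hx
  cases n with
  | zero =>
    have h1 := LinearMap.apply_mem_smul_top I (pr U S 0) hw
    rw [map_sub, map_smul, H.pr_del_zero] at h1
    obtain ⟨v, hv⟩ := hex 0 (pr U S 1 x - s 0 w) (by
      have h2 := sub_mem h1 (H.homotopy_zero w)
      convert h2 using 1
      rw [map_sub]
      module)
    refine ⟨inc U S 2 v + ins U S 0 w, ?_⟩
    have h3 := LinearMap.apply_mem_smul_top I (inc U S 1) hv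
    convert h3 using 1
    refine (inc_pr_one S _).symm.trans (congrArg _ ?_)
    rw [map_sub]
    refine (congrArg (· - pr U S 1 x) (H.pr_del_add 0 v w)).trans ?_
    module
  | succ m =>
    have h1 : t U S m x - del m w ∈ (I • ⊤ : Submodule S (Total U m)) := by
      refine mem_smul_top_of_smul_mem I a ha ?_
      have h2 := sub_mem (LinearMap.apply_mem_smul_top I (del m) hw) (H.del_del m x)
      rw [map_sub, map_smul] at h2
      convert h2 using 1
      module
    have h2 : dU (m + 1) (pr U S (m + 2) x - s (m + 1) w) ∈ (I • ⊤ : Submodule S (U (m + 1))) := by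
      have h3 := sub_mem (sub_mem (LinearMap.apply_mem_smul_top I (pr U S (m + 1)) hw)
        (LinearMap.apply_mem_smul_top I (s m) h1)) (H.homotopy m w)
      convert h3 using 1
      simp only [map_sub, map_smul, H.pr_del]
      module
    obtain ⟨v, hv⟩ := hex _ _ h2
    refine ⟨inc U S (m + 3) v + ins U S (m + 1) w, ?_⟩
    rw [total_mem_smul_top_iff]
    constructor
    · convert hv using 1
      rw [map_sub]
      refine (congrArg (· - pr U S (m + 2) x) (H.pr_del_add (m + 1) v w)).trans ?_
      module
    · have h3 := neg_mem h1
      convert h3 using 1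
      rw [map_sub]
      refine (congrArg (· - t U S m x) (H.t_del_add m v w)).trans ?_
      module

theorem del_inc (H : IsHomotopySystem dU h a I s del) (n : ℕ) (u : U (n + 1)) :
    del n (inc U S (n + 1) u) = inc U S n (dU n u) := by
  rcases n with _ | _ | n
  · rw [← inc_pr_zero S (del 0 _), H.pr_del_zero, pr_inc]
  · rw [← inc_pr_one S (del 1 _), H.pr_del 0, pr_inc, t_inc, map_zero, add_zero]
  · rw [← inc_pr_add_ins_t S n (del (n + 2) _), H.pr_del, H.t_del, pr_inc]
    have h1 : t U S (n + 1) (inc U S (n + 3) u) = 0 := rfl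
    rw [h1, map_zero, map_zero, map_zero, add_zero, add_zero]

section Minimal

variable [IsLocalRing S]

/-- The components of `del n` are `dU` and homotopies of index less than n. The bound makes the
statement usable inside the induction that establishes minimality of the homotopies. -/
theorem minimal_of_forall_lt (H : IsHomotopySystem dU h a I s del)
    (hdU : ∀ n (φ : U n →ₗ[S] IsLocalRing.ResidueField S) x, φ (dU n x) = 0) :
    ∀ n, (∀ m < n, ∀ (φ : U (m + 1) →ₗ[S] IsLocalRing.ResidueField S) x, φ (s m x) = 0) →
    ∀ (φ : Total U n →ₗ[S] IsLocalRing.ResidueField S) x, φ (del n x) = 0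
  | 0, _, φ, x => by
    rw [← inc_pr_zero S (del 0 x), H.pr_del_zero]
    exact hdU 0 (φ ∘ₗ inc U S 0) _
  | 1, hs, φ, x => by
    rw [← inc_pr_one S (del 1 x), H.pr_del 0, map_add, map_add]
    exact (congrArg₂ (· + ·) (hdU 1 (φ ∘ₗ inc U S 1) _)
      (hs 0 one_pos (φ ∘ₗ inc U S 1) _)).trans (add_zero 0)
  | n + 2, hs, φ, x => by
    rw [← inc_pr_add_ins_t S n (del (n + 2) x), H.pr_del, H.t_del, map_add, map_add, map_add]
    have h1 := minimal_of_forall_lt H hdU n (fun m hm => hs m (by omega)) (φ ∘ₗ ins U S n)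
      (t U S (n + 1) x)
    have h2 := hdU (n + 2) (φ ∘ₗ inc U S (n + 2)) (pr U S (n + 3) x)
    have h3 := hs (n + 1) (by omega) (φ ∘ₗ inc U S (n + 2)) (t U S (n + 1) x)
    simp only [LinearMap.comp_apply] at h1 h2 h3
    rw [h1, h2, h3, add_zero, add_zero]

variable {c : ℕ} {f : Fin c → S} {σ : Set (Fin c)} {τ : Fin c → ∀ n, U (n + 2) →ₗ[S] U n}
  [∀ n, Module.Free S (U n)]

/-- A form on U_{n+2} is a sum of ψ_j τ_j, so it suffices to control τ_j s. These maps are the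
coefficients of the square of `dU` applied to s, which the homotopy identities also express through
`dU`, `del` in lower degree and earlier homotopies. All of these vanish under forms by minimality of
U and by induction. -/
theorem residueField_apply_eq_zero (hf : RingTheory.Sequence.IsRegular S (List.ofFn f))
    (H : IsHomotopySystem dU h a (Ideal.span (f '' σ)) s del) (hU : IsMinimalLifting f dU τ)
    (hh : ∀ (φ : U 1 →ₗ[S] IsLocalRing.ResidueField S) x, φ (h x) = 0) (n : ℕ)
    (φ : U (n + 1) →ₗ[S] IsLocalRing.ResidueField S) (x : Total U n) : φ (s n x) = 0 := by
  induction n using Nat.strong_induction_on with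
  | _ n ih =>
    have hdel : ∀ m ≤ n, ∀ (φ : Total U m →ₗ[S] IsLocalRing.ResidueField S) x,
        φ (del m x) = 0 := fun m hm =>
      H.minimal_of_forall_lt hU.minimal m fun l hl φ x => ih l (by omega) φ x
    rcases n with _ | _ | n
    · rw [H.s_zero]
      exact hh φ _
    · obtain ⟨α, -, hα⟩ := LinearMap.exists_sum_smul_of_forall_mem f σ
        (dU 0 ∘ₗ s 0 - a • pr U S 0) fun x => H.homotopy_zero x
      obtain ⟨β, -, hβ⟩ := LinearMap.exists_sum_smul_of_forall_mem f σ
        (dU 1 ∘ₗ s 1 + s 0 ∘ₗ del 0 - a • pr U S 1) fun x => H.homotopy 0 x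
      simp only [LinearMap.sub_apply, LinearMap.add_apply, LinearMap.comp_apply,
        LinearMap.smul_apply] at hα hβ
      have key : ∑ j, f j • (τ j 0 (s 1 x) - dU 0 (β j x) + α j (del 0 x)) = 0 := by
        simp only [smul_sub, smul_add, Finset.sum_sub_distrib, Finset.sum_add_distrib]
        rw [← hα, ← (dU 0).map_sum_smul, ← hβ, ← hU.del_del, H.pr_del_zero]
        simp only [map_sub, map_add, map_smul]
        module
      obtain ⟨ψ, hψ⟩ := hU.generated 0 φ
      rw [hψ]
      refine Finset.sum_eq_zero fun j _ => ?_
      have h1 := (ψ j).residueField_eq_of_sum_smul_sub_eq_zero f hf _ key j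
      have h2 : ψ j (α j (del 0 x)) = 0 := hdel 0 (by omega) (ψ j ∘ₗ α j) x
      rwa [map_add, map_sub, hU.minimal, h2, sub_zero, add_zero] at h1
    · obtain ⟨α, -, hα⟩ := LinearMap.exists_sum_smul_of_forall_mem f σ
        (dU (n + 1) ∘ₗ s (n + 1) + s n ∘ₗ del n - a • pr U S (n + 1)) fun x => H.homotopy n x
      obtain ⟨β, -, hβ⟩ := LinearMap.exists_sum_smul_of_forall_mem f σ
        (dU (n + 2) ∘ₗ s (n + 2) + s (n + 1) ∘ₗ del (n + 1) - a • pr U S (n + 2))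
          fun x => H.homotopy (n + 1) x
      obtain ⟨θ, -, hθ⟩ := LinearMap.exists_sum_smul_of_forall_mem f σ
        (del n ∘ₗ del (n + 1) - a • t U S n) fun x => H.del_del n x
      simp only [LinearMap.sub_apply, LinearMap.add_apply, LinearMap.comp_apply,
        LinearMap.smul_apply] at hα hβ hθ
      -- Apply `dU` to the homotopy identity for s_{n+2}, then eliminate dU s_{n+1} by the identity
      -- for s_{n+1} and the square of `del` by θ. The multiples of a cancel.
      have key : ∑ j, f j • (τ j (n + 1) (s (n + 2) x) - dU (n + 1) (β j x) +
          α j (del (n + 1) x) - s n (θ j x)) = 0 := by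
        simp only [smul_sub, smul_add, Finset.sum_sub_distrib, Finset.sum_add_distrib]
        rw [← hα, ← (dU (n + 1)).map_sum_smul, ← (s n).map_sum_smul, ← hβ, ← hθ, ← hU.del_del,
          H.pr_del n]
        simp only [map_sub, map_add, map_smul]
        module
      obtain ⟨ψ, hψ⟩ := hU.generated _ φ
      rw [hψ]
      refine Finset.sum_eq_zero fun j _ => ?_
      have h1 := (ψ j).residueField_eq_of_sum_smul_sub_eq_zero f hf _ key j
      have h2 : ψ j (α j (del (n + 1) x)) = 0 := hdel (n + 1) (by omega) (ψ j ∘ₗ α j) x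
      have h3 : ψ j (s n (θ j x)) = 0 := ih n (by omega) _ _
      rwa [map_sub, map_add, map_sub, hU.minimal, h2, h3, sub_zero, add_zero, sub_zero] at h1

/-- The operator for f_p is `t` itself; the others come from dividing del² - f_p t by the f_j with j
in σ. They extend the τ_j only as seen by forms, since the coefficients of the f_j are determined
only modulo the ideal. -/
theorem exists_isMinimalLifting (hf : RingTheory.Sequence.IsRegular S (List.ofFn f)) {p : Fin c}
    (hp : p ∉ σ)
    (H : IsHomotopySystem dU h (f p) (Ideal.span (f '' σ)) s del) (hU : IsMinimalLifting f dU τ)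
    (hh : ∀ (φ : U 1 →ₗ[S] IsLocalRing.ResidueField S) x, φ (h x) = 0) :
    ∃ T : Fin c → ∀ n, Total U (n + 2) →ₗ[S] Total U n, IsMinimalLifting f del T ∧
      T p = t U S ∧ (∀ j ∉ insert p σ, T j = 0) ∧
      ∀ j n (φ : Total U n →ₗ[S] IsLocalRing.ResidueField S) u,
        φ (T j n (inc U S (n + 2) u)) = φ (inc U S n (τ j n u)) := by
  have h1 : ∀ n, ∃ θ : Fin c → Total U (n + 2) →ₗ[S] Total U n,
      (∀ j ∉ σ, θ j = 0) ∧ ∀ x, del n (del (n + 1) x) - f p • t U S n x = ∑ j, f j • θ j x := by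
    intro n
    exact LinearMap.exists_sum_smul_of_forall_mem f σ
        (del n ∘ₗ del (n + 1) - f p • t U S n) fun x => H.del_del n x
  choose θ hθ0 hθ using h1
  have hdd : ∀ n x, del n (del (n + 1) x) =
      ∑ j, f j • Function.update (fun j n => θ n j) p (t U S) j n x := by
    intro n x
    rw [← Finset.add_sum_erase _ _ (Finset.mem_univ p), Function.update_self,
      ← sub_eq_iff_eq_add', hθ, ← Finset.add_sum_erase _ _ (Finset.mem_univ p), hθ0 n p hp]
    simp only [LinearMap.zero_apply, smul_zero, zero_add]
    refine Finset.sum_congr rfl fun j hj => ?_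
    rw [Function.update_of_ne (Finset.ne_of_mem_erase hj)]
  have hinc : ∀ j n (φ : Total U n →ₗ[S] IsLocalRing.ResidueField S) u,
        φ (Function.update (fun j n => θ n j) p (t U S) j n (inc U S (n + 2) u)) =
          φ (inc U S n (τ j n u)) := by
    intro j n φ u
    rw [← sub_eq_zero, ← map_sub]
    refine φ.residueField_eq_of_sum_smul_sub_eq_zero f hf (fun j => 
      Function.update (fun j n => θ n j) p (t U S) j n (inc U S (n + 2) u) -
        inc U S n (τ j n u)) ?_ j
    simp only [smul_sub, Finset.sum_sub_distrib]
    rw [← hdd, H.del_inc, H.del_inc, hU.del_del, map_sum]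
    simp only [map_smul, sub_self]
  refine ⟨Function.update (fun j n => θ n j) p (t U S), ⟨hdd, fun n =>
    H.minimal_of_forall_lt hU.minimal n fun m _ => H.residueField_apply_eq_zero hf hU hh m, ?_⟩,
    Function.update_self _ _ _, ?_, hinc⟩
  · intro n φ
    obtain ⟨ψ, hψ⟩ := hU.generated n (φ ∘ₗ inc U S (n + 2))
    let ψ' : Fin c → Total U n →ₗ[S] IsLocalRing.ResidueField S := fun j => ψ j ∘ₗ pr U S n
    -- Subtracting the forms generated from U leaves a form that vanishes on the first summand,
    -- hence factors through `t`, the operator with index p.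
    let χ : Total U (n + 2) →ₗ[S] IsLocalRing.ResidueField S :=
      φ - ∑ j, ψ' j ∘ₗ Function.update (fun j n => θ n j) p (t U S) j n
    have hχ : ∀ x, χ x = χ (ins U S n (t U S n x)) := by
      intro x
      have h2 : χ (inc U S (n + 2) (pr U S (n + 2) x)) = 0 := by
        have h3 := hψ (pr U S (n + 2) x)
        rw [LinearMap.comp_apply] at h3
        simp only [χ, LinearMap.sub_apply, h3, LinearMap.sum_apply, LinearMap.comp_apply, hinc]
        simp only [ψ', LinearMap.comp_apply, pr_inc, sub_self]
      conv_lhs => rw [← inc_pr_add_ins_t S n x, map_add, h2, zero_add]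
    refine ⟨ψ' + Pi.single p (χ ∘ₗ ins U S n), fun x => ?_⟩
    have h4 : φ x = χ x + ∑ j, ψ' j (Function.update (fun j n => θ n j) p (t U S) j n x) := by
      simp [χ]
    rw [h4, hχ]
    simp only [Pi.add_apply, LinearMap.add_apply, Finset.sum_add_distrib]
    rw [add_comm, Finset.sum_eq_single p (f := fun j => (Pi.single p (χ ∘ₗ ins U S n) :
      Fin c → Total U n →ₗ[S] IsLocalRing.ResidueField S) j _)]
    · simp
    · intro j _ hj
      rw [Pi.single_eq_of_ne hj, LinearMap.zero_apply]
    · simp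
  · intro j hj
    rw [Set.mem_insert_iff, not_or] at hj
    rw [Function.update_of_ne hj.1]
    funext n
    exact hθ0 n j hj.2

end Minimal

end IsHomotopySystem

end Shamash

/-! ### Commuting operators and polynomials -/

section PolynomialAction

variable {K E E' : Type*} [Field K] [AddCommMonoid E] [Module K E] [AddCommMonoid E']
  [Module K E']
  {ι : Type*}

open scoped IsMulCommutative in
-- Evaluation of polynomials needs a commutative target, here the subalgebra generated by the
-- operators.
theorem exists_algHom_end_of_commute (χ : ι → Module.End K E)
    (h : ∀ i j, χ i * χ j = χ j * χ i) :
    ∃ ρ : MvPolynomial ι K →ₐ[K] Module.End K E, ∀ i, ρ (MvPolynomial.X i) = χ i := by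
  have := Algebra.isMulCommutative_adjoin K (s := Set.range χ) (by
    rintro _ ⟨i, rfl⟩ _ ⟨j, rfl⟩
    exact h i j)
  refine ⟨(Algebra.adjoin K (Set.range χ)).val.comp (MvPolynomial.aeval fun i =>
    (⟨χ i, Algebra.subset_adjoin ⟨i, rfl⟩⟩ : Algebra.adjoin K (Set.range χ))), fun i => ?_⟩
  simp

/-- The action of polynomials through commuting operators. -/
noncomputable def polynomialAction (χ : ι → Module.End K E) (h : ∀ i j, χ i * χ j = χ j * χ i) :
    MvPolynomial ι K →ₐ[K] Module.End K E :=
  (exists_algHom_end_of_commute χ h).choose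

@[simp] theorem polynomialAction_X (χ : ι → Module.End K E) (h : ∀ i j, χ i * χ j = χ j * χ i)
    (i : ι) : polynomialAction χ h (MvPolynomial.X i) = χ i :=
  (exists_algHom_end_of_commute χ h).choose_spec i

theorem map_polynomialAction {χ : ι → Module.End K E} {h : ∀ i j, χ i * χ j = χ j * χ i}
    {χ' : ι → Module.End K E'} {h' : ∀ i j, χ' i * χ' j = χ' j * χ' i} (r : E →ₗ[K] E')
    (hr : ∀ i x, r (χ i x) = χ' i (r x)) (g : MvPolynomial ι K) (x : E) :
    r (polynomialAction χ h g x) = polynomialAction χ' h' g (r x) := by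
  induction g using MvPolynomial.induction_on generalizing x with
  | C a =>
    rw [← MvPolynomial.algebraMap_eq, AlgHom.commutes, AlgHom.commutes]
    simp [Module.algebraMap_end_apply]
  | add p q hp hq => simp [hp, hq]
  | mul_X p i hp => simp [hp, hr]

end PolynomialAction

/-! ### Linear independence through injective operators and triangular families -/

section LinearIndependence

variable {K E E' E'' : Type*} [Field K] [AddCommGroup E] [Module K E] [AddCommGroup E']
  [Module K E'] [AddCommGroup E''] [Module K E''] {ι : Type*}

/-- In a relation, `r` kills all terms with a positive exponent, so the coefficients with exponent 0
vanish. What remains is χ applied to a relation with smaller exponents, and χ can be cancelled. -/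
theorem LinearIndependent.pow_apply_of_injective {χ : Module.End K E} (hχ : Function.Injective χ)
    (r : E →ₗ[K] E') (hr : ∀ x, r (χ x) = 0) {y : ι → E} (hy : LinearIndependent K fun i => r (y i)) :
    LinearIndependent K fun x : ℕ × ι => (χ ^ x.1) (y x.2) := by
  classical
  have key : ∀ (t : Finset ι) (N : ℕ) (g : ℕ → ι → K),
      ∑ a ∈ Finset.range N, (χ ^ a) (∑ i ∈ t, g a i • y i) = 0 →
      ∀ a < N, ∀ i ∈ t, g a i = 0 := by
    intro t N
    induction N with
    | zero => intro g _ a ha; omega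
    | succ N ih =>
      intro g hg
      rw [Finset.sum_range_succ'] at hg
      have h1 : ∑ a ∈ Finset.range N, (χ ^ (a + 1)) (∑ i ∈ t, g (a + 1) i • y i) =
          χ (∑ a ∈ Finset.range N, (χ ^ a) (∑ i ∈ t, g (a + 1) i • y i)) := by
        rw [map_sum]
        exact Finset.sum_congr rfl fun a _ => by rw [pow_succ']; rfl
      rw [h1, pow_zero, Module.End.one_apply] at hg
      have h2 := congrArg r hg
      rw [map_add, hr, zero_add, map_zero, map_sum] at h2
      simp only [map_smul] at h2
      have h3 := linearIndependent_iff'.1 hy t (g 0) h2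
      rw [Finset.sum_eq_zero (s := t) fun i hi => by rw [h3 i hi, zero_smul], add_zero,
        ← map_zero χ] at hg
      intro a ha
      cases a with
      | zero => exact h3
      | succ a => exact ih (fun a => g (a + 1)) (hχ hg) a (by omega)
  rw [linearIndependent_iff']
  intro s g hg x hx
  -- The finite support of the relation is enlarged to a box, with coefficients 0 outside the
  -- support.
  let g' : ℕ → ι → K := fun a i => if (a, i) ∈ s then g (a, i) else 0
  have h1 : s ⊆ Finset.range (s.sup Prod.fst + 1) ×ˢ s.image Prod.snd := by
    intro z hz
    rw [Finset.mem_product, Finset.mem_range]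
    exact ⟨Nat.lt_succ_of_le (Finset.le_sup (f := Prod.fst) hz), Finset.mem_image_of_mem _ hz⟩
  have h2 := key (s.image Prod.snd) (s.sup Prod.fst + 1) g' (by
    rw [← hg]
    have h3 : ∑ a ∈ Finset.range (s.sup Prod.fst + 1),
        (χ ^ a) (∑ i ∈ s.image Prod.snd, g' a i • y i) =
        ∑ z ∈ Finset.range (s.sup Prod.fst + 1) ×ˢ s.image Prod.snd,
          g' z.1 z.2 • (χ ^ z.1) (y z.2) := by
      rw [Finset.sum_product]
      simp only [map_sum, map_smul]
    rw [h3]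
    refine (Finset.sum_subset h1 fun z _ hz => ?_).symm.trans (Finset.sum_congr rfl fun z hz => ?_)
    · simp only [g', if_neg hz, zero_smul]
    · simp only [g', if_pos hz]) x.1 (Finset.mem_range.1 (Finset.mem_product.1 (h1 hx)).1) x.2
      (Finset.mem_product.1 (h1 hx)).2
  simpa only [g', if_pos hx] using h2

/-- The family is triangular: the part indexed by t lies in the kernel of the first projection,
under which the part indexed by s remains independent. -/
theorem LinearIndepOn.union_of_map_eq_zero (r : E →ₗ[K] E') (r' : E →ₗ[K] E'') {v : ι → E}
    {s t : Set ι} (hs : LinearIndepOn K (fun i => r (v i)) s)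
    (ht : LinearIndepOn K (fun i => r' (v i)) t) (h0 : ∀ i ∈ t, r (v i) = 0) :
    LinearIndepOn K (fun i => r.prod r' (v i)) (t ∪ s) := by
  refine LinearIndepOn.union_of_quotient (LinearIndependent.of_comp (LinearMap.snd K E' E'') ht) ?_
  have h1 : Submodule.span K ((fun i => r.prod r' (v i)) '' t) ≤
      LinearMap.ker (LinearMap.fst K E' E'') := by
    rw [Submodule.span_le]
    rintro _ ⟨i, hi, rfl⟩
    exact h0 i hi
  exact LinearIndependent.of_comp ((Submodule.span K _).liftQ (LinearMap.fst K E' E'') h1) hs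

end LinearIndependence

/-! ### The graded dual of a graded module -/

section GradedDual

variable {S : Type*} [CommRing S] [IsLocalRing S] {G G' : ℕ → Type*} [∀ n, AddCommGroup (G n)]
  [∀ n, Module S (G n)] [∀ n, AddCommGroup (G' n)] [∀ n, Module S (G' n)]

/-- The graded dual `⨁_n Hom(G_n, k)`. -/
def GradedDual (S : Type*) [CommRing S] [IsLocalRing S] (G : ℕ → Type*)
    [∀ n, AddCommGroup (G n)] [∀ n, Module S (G n)] : Type _ :=
  Π₀ n, G n →ₗ[S] IsLocalRing.ResidueField S

namespace GradedDual

noncomputable instance : AddCommGroup (GradedDual S G) :=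
  inferInstanceAs (AddCommGroup (Π₀ n, G n →ₗ[S] IsLocalRing.ResidueField S))

noncomputable instance : Module (IsLocalRing.ResidueField S) (GradedDual S G) :=
  inferInstanceAs (Module (IsLocalRing.ResidueField S)
    (Π₀ n, G n →ₗ[S] IsLocalRing.ResidueField S))

/-- The inclusion of `Hom(G_n, k)`. -/
noncomputable def of (n : ℕ) :
    (G n →ₗ[S] IsLocalRing.ResidueField S) →ₗ[IsLocalRing.ResidueField S] GradedDual S G :=
  DFinsupp.lsingle (M := fun n => G n →ₗ[S] IsLocalRing.ResidueField S) n

/-- The component in `Hom(G_n, k)`. -/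
noncomputable def coeff (n : ℕ) :
    GradedDual S G →ₗ[IsLocalRing.ResidueField S] (G n →ₗ[S] IsLocalRing.ResidueField S) :=
  DFinsupp.lapply (M := fun n => G n →ₗ[S] IsLocalRing.ResidueField S) n

/-- The map on the graded dual with given components. -/
noncomputable def lift {E : Type*} [AddCommMonoid E] [Module (IsLocalRing.ResidueField S) E]
    (F : ∀ n, (G n →ₗ[S] IsLocalRing.ResidueField S) →ₗ[IsLocalRing.ResidueField S] E) :
    GradedDual S G →ₗ[IsLocalRing.ResidueField S] E :=
  DFinsupp.lsum (M := fun n => G n →ₗ[S] IsLocalRing.ResidueField S) ℕ F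

@[simp] theorem lift_of {E : Type*} [AddCommMonoid E] [Module (IsLocalRing.ResidueField S) E]
    (F : ∀ n, (G n →ₗ[S] IsLocalRing.ResidueField S) →ₗ[IsLocalRing.ResidueField S] E) (n : ℕ)
    (φ : G n →ₗ[S] IsLocalRing.ResidueField S) : lift F (of n φ) = F n φ :=
  DFinsupp.lsum_single _ _ _ _

@[simp] theorem coeff_of_self (n : ℕ) (φ : G n →ₗ[S] IsLocalRing.ResidueField S) :
    coeff n (of n φ) = φ :=
  DFinsupp.single_eq_same

theorem coeff_of_ne {m n : ℕ} (h : n ≠ m) (φ : G m →ₗ[S] IsLocalRing.ResidueField S) :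
    coeff n (of m φ) = 0 :=
  DFinsupp.single_eq_of_ne h

theorem of_injective (n : ℕ) : Function.Injective (of (S := S) (G := G) n) :=
  Function.LeftInverse.injective (coeff_of_self n)

theorem ext_coeff {x y : GradedDual S G} (h : ∀ n, coeff n x = coeff n y) : x = y :=
  DFinsupp.ext h

theorem linearMap_ext {E : Type*} [AddCommMonoid E] [Module (IsLocalRing.ResidueField S) E]
    {a b : GradedDual S G →ₗ[IsLocalRing.ResidueField S] E}
    (h : ∀ n φ, a (of n φ) = b (of n φ)) : a = b :=
  DFinsupp.lhom_ext h

theorem linearIndependent_of {ι : ℕ → Type*} (v : ∀ n, ι n → G n →ₗ[S] IsLocalRing.ResidueField S)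
    (hv : ∀ n, LinearIndependent (IsLocalRing.ResidueField S) (v n)) :
    LinearIndependent (IsLocalRing.ResidueField S)
      fun x : Σ n, ι n => of (S := S) (G := G) x.1 (v x.1 x.2) :=
  DFinsupp.linearIndependent_single v hv

end GradedDual

/-- Composition with a linear map, as a map that is linear over the residue field. -/
noncomputable def residueFieldPrecomp {N N' : Type*} [AddCommGroup N] [Module S N] [AddCommGroup N']
    [Module S N'] (g : N →ₗ[S] N') : (N' →ₗ[S] IsLocalRing.ResidueField S)
      →ₗ[IsLocalRing.ResidueField S] (N →ₗ[S] IsLocalRing.ResidueField S) where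
  toFun φ := φ ∘ₗ g
  map_add' _ _ := rfl
  map_smul' _ _ := rfl

namespace GradedDual

/-- The operator of degree `k` on the graded dual given by maps of degree `-k`. -/
noncomputable def pull (k : ℕ) (T : ∀ n, G (n + k) →ₗ[S] G' n) :
    GradedDual S G' →ₗ[IsLocalRing.ResidueField S] GradedDual S G :=
  lift fun n => of (n + k) ∘ₗ residueFieldPrecomp (T n)

@[simp] theorem pull_of (k : ℕ) (T : ∀ n, G (n + k) →ₗ[S] G' n) (n : ℕ)
    (φ : G' n →ₗ[S] IsLocalRing.ResidueField S) :
    pull k T (of n φ) = of (n + k) (φ ∘ₗ T n) :=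
  lift_of _ _ _

theorem coeff_pull (k : ℕ) (T : ∀ n, G (n + k) →ₗ[S] G' n) (x : GradedDual S G') (n : ℕ) :
    coeff (n + k) (pull k T x) = coeff n x ∘ₗ T n := by
  have h : coeff (n + k) ∘ₗ pull k T = residueFieldPrecomp (T n) ∘ₗ coeff n :=
    linearMap_ext fun m φ => by
      rw [LinearMap.comp_apply, pull_of, LinearMap.comp_apply]
      by_cases hm : m = n
      · subst hm
        rw [coeff_of_self, coeff_of_self]
        rfl
      · rw [coeff_of_ne (by omega), coeff_of_ne (Ne.symm hm), map_zero]
  exact LinearMap.congr_fun h x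

theorem pull_injective (k : ℕ) {T : ∀ n, G (n + k) →ₗ[S] G' n}
    (hT : ∀ n, Function.Surjective (T n)) : Function.Injective (pull k T) := by
  refine fun x y hxy => ext_coeff fun n => LinearMap.ext fun z => ?_
  obtain ⟨w, rfl⟩ := hT n z
  have h := coeff_pull k T x n
  rw [hxy, coeff_pull] at h
  exact (LinearMap.congr_fun h w).symm

end GradedDual

end GradedDual

/-! ### Decompositions of graded duals into free modules over polynomial rings -/

namespace GradedDual

variable {S : Type*} [CommRing S] [IsLocalRing S] {c : ℕ} {G G' : ℕ → Type*}
  [∀ n, AddCommGroup (G n)] [∀ n, Module S (G n)] [∀ n, AddCommGroup (G' n)]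
  [∀ n, Module S (G' n)] {C : ℕ → Fin c → Type*} [∀ n q, AddCommGroup (C n q)]
  [∀ n q, Module S (C n q)] {ι : Fin c → ℕ → Type*}
  (β : ∀ q n, Module.Basis (ι q n) (IsLocalRing.ResidueField S)
    (C n q →ₗ[S] IsLocalRing.ResidueField S))

/-- The operators on the graded dual given by maps of degree `-2` commute. -/
abbrev PullCommute (T : Fin c → ∀ n, G (n + 2) →ₗ[S] G n) : Prop :=
  ∀ i j, (pull 2 (T i) : Module.End (IsLocalRing.ResidueField S) (GradedDual S G)) *
    pull 2 (T j) = pull 2 (T j) * pull 2 (T i)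

/-- The action of polynomials on the graded dual. -/
noncomputable abbrev act {T : Fin c → ∀ n, G (n + 2) →ₗ[S] G n} (hT : PullCommute T) :
    MvPolynomial (Fin c) (IsLocalRing.ResidueField S) →ₐ[IsLocalRing.ResidueField S]
      Module.End (IsLocalRing.ResidueField S) (GradedDual S G) :=
  polynomialAction (fun j => pull 2 (T j)) hT

/-- The target degree is given by an equation, not computed in the type, which avoids transport
between the modules G_m. -/
theorem act_monomial_of {T : Fin c → ∀ n, G (n + 2) →ₗ[S] G n} (hT : PullCommute T)
    (α : Fin c →₀ ℕ) (n : ℕ) (φ : G n →ₗ[S] IsLocalRing.ResidueField S) :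
    ∃ m ψ, m = 2 * α.degree + n ∧ act hT (MvPolynomial.monomial α 1) (of n φ) = of m ψ := by
  induction α using Finsupp.induction_linear generalizing n φ with
  | zero => exact ⟨n, φ, by simp, by simp⟩
  | add α α' h h' =>
    obtain ⟨m, ψ, rfl, e⟩ := h' n φ
    obtain ⟨m', ψ', rfl, e'⟩ := h _ ψ
    refine ⟨_, ψ', by rw [map_add]; ring, ?_⟩
    rw [← e', ← e, ← one_mul (1 : IsLocalRing.ResidueField S), ← MvPolynomial.monomial_mul,
      map_mul]
    simp
  | single i b =>
    induction b generalizing n φ with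
    | zero => exact ⟨n, φ, by simp, by simp⟩
    | succ b ih =>
      obtain ⟨m, ψ, rfl, e⟩ := ih n φ
      refine ⟨2 * (Finsupp.single i b).degree + n + 2, ψ ∘ₗ T i _, ?_, ?_⟩
      · rw [Finsupp.degree_single, Finsupp.degree_single]
        ring
      · rw [← pull_of 2 (T i), ← e, ← MvPolynomial.X_pow_eq_monomial,
          ← MvPolynomial.X_pow_eq_monomial, pow_succ', map_mul, polynomialAction_X]
        rfl

/-- Restriction of forms along maps of degree `0`. -/
noncomputable def restrict (i : ∀ n, G n →ₗ[S] G' n) :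
    GradedDual S G' →ₗ[IsLocalRing.ResidueField S] GradedDual S G :=
  lift fun n => of n ∘ₗ residueFieldPrecomp (i n)

theorem restrict_of (i : ∀ n, G n →ₗ[S] G' n) (n : ℕ)
    (φ : G' n →ₗ[S] IsLocalRing.ResidueField S) : restrict i (of n φ) = of n (φ ∘ₗ i n) :=
  lift_of _ _ _

/-- Indices for the monomials times basis elements of the layers. -/
abbrev LayerIndex (ι : Fin c → ℕ → Type*) : Type _ := (Fin c →₀ ℕ) × (Σ q : Fin c, Σ n : ℕ, ι q n)

/-- The elements of the graded dual that come from the layers. -/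
noncomputable def layerForm (pr : ∀ n, G n →ₗ[S] ∀ q, C n q) (ω : Σ q : Fin c, Σ n : ℕ, ι q n) :
    GradedDual S G :=
  of ω.2.1 (β ω.1 ω.2.1 ω.2.2 ∘ₗ LinearMap.proj ω.1 ∘ₗ pr ω.2.1)

/-- Monomials applied to the elements that come from the layers. -/
noncomputable def layerFamily {T : Fin c → ∀ n, G (n + 2) →ₗ[S] G n} (hT : PullCommute T)
    (pr : ∀ n, G n →ₗ[S] ∀ q, C n q) (θ : LayerIndex ι) : GradedDual S G :=
  act hT (MvPolynomial.monomial θ.1 1) (layerForm β pr θ.2)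

/-- The degree of an index. -/
noncomputable def LayerIndex.degree (θ : LayerIndex ι) : ℕ := 2 * θ.1.degree + θ.2.2.1

/-- The indices in the layers `q < p` with monomials in the variables `i` such that `q ≤ i < p`. -/
def layerIndices (ι : Fin c → ℕ → Type*) (p : Fin (c + 1)) : Set (LayerIndex ι) :=
  {θ | θ.2.1.castSucc < p ∧ ∀ i ∈ θ.1.support, θ.2.1 ≤ i ∧ i.castSucc < p}

/-- The graded dual is the direct sum over `q < p` of the free modules over the polynomial ring in
the variables `i` such that `q ≤ i < p` on the forms that come from the layer `q`. -/
structure IsLayered (T : Fin c → ∀ n, G (n + 2) →ₗ[S] G n) (pr : ∀ n, G n →ₗ[S] ∀ q, C n q)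
    (p : Fin (c + 1)) : Prop where
  comm : PullCommute T
  linearIndepOn : LinearIndepOn (IsLocalRing.ResidueField S) (layerFamily β comm pr)
    (layerIndices ι p)
  mem_span : ∀ n φ, of n φ ∈ Submodule.span (IsLocalRing.ResidueField S)
    (layerFamily β comm pr '' {θ | θ ∈ layerIndices ι p ∧ θ.degree = n})

theorem layerFamily_mem_range {T : Fin c → ∀ n, G (n + 2) →ₗ[S] G n} (hT : PullCommute T)
    (pr : ∀ n, G n →ₗ[S] ∀ q, C n q) (θ : LayerIndex ι) :
    layerFamily β hT pr θ ∈ LinearMap.range (of (S := S) (G := G) θ.degree) := by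
  obtain ⟨m, ψ, hm, h⟩ := act_monomial_of hT θ.1 θ.2.2.1
    (β θ.2.1 θ.2.2.1 θ.2.2.2 ∘ₗ LinearMap.proj θ.2.1 ∘ₗ pr θ.2.2.1)
  obtain rfl : m = θ.degree := hm
  exact ⟨ψ, h.symm⟩

section Step

variable {T : Fin c → ∀ n, G (n + 2) →ₗ[S] G n} {T' : Fin c → ∀ n, G' (n + 2) →ₗ[S] G' n}
  {pr : ∀ n, G n →ₗ[S] ∀ q, C n q} {pr' : ∀ n, G' n →ₗ[S] ∀ q, C n q} {p : Fin c}
  {i : ∀ n, G n →ₗ[S] G' n} {j : ∀ n, C n p →ₗ[S] G' n}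

/-- Restriction intertwines the two actions on forms, although `T'` and `T` need to agree along `i`
only after composition with forms. -/
theorem restrict_layerFamily (hT : PullCommute T) (hT' : PullCommute T')
    (hTi : ∀ l n (φ : G' n →ₗ[S] IsLocalRing.ResidueField S) x,
      φ (T' l n (i (n + 2) x)) = φ (i n (T l n x)))
    (hpri : ∀ n x, pr' n (i n x) = pr n x) (θ : LayerIndex ι) :
    restrict i (layerFamily β hT' pr' θ) = layerFamily β hT pr θ := by
  have h1 : ∀ l (x : GradedDual S G'), restrict i (pull 2 (T' l) x) = pull 2 (T l) (restrict i x) := by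
    intro l x
    refine LinearMap.congr_fun (linearMap_ext (a := restrict i ∘ₗ pull 2 (T' l))
      (b := pull 2 (T l) ∘ₗ restrict i) fun n φ => ?_) x
    rw [LinearMap.comp_apply, LinearMap.comp_apply, pull_of, restrict_of, restrict_of, pull_of]
    exact congrArg _ (LinearMap.ext fun x => hTi l n φ x)
  refine (map_polynomialAction (h' := hT) _ h1 _ _).trans ?_
  unfold layerFamily layerForm
  rw [restrict_of]
  refine congrArg _ (congrArg _ (LinearMap.ext fun x => ?_))
  exact congrArg (fun z => β _ _ _ (z _)) (hpri _ x)

theorem restrict_pull_eq_zero {k : ℕ} {G'' : ℕ → Type*} [∀ n, AddCommGroup (G'' n)]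
    [∀ n, Module S (G'' n)] {T : ∀ n, G' (n + k) →ₗ[S] G'' n} {i : ∀ n, G n →ₗ[S] G' n}
    (h : ∀ n x, T n (i (n + k) x) = 0) (x : GradedDual S G'') : restrict i (pull k T x) = 0 := by
  have h1 : restrict i ∘ₗ pull k T = 0 := linearMap_ext fun n φ => by
    have h2 : (φ ∘ₗ T n) ∘ₗ i (n + k) = 0 := LinearMap.ext fun x =>
      (congrArg φ (h n x)).trans (map_zero φ)
    rw [LinearMap.comp_apply, pull_of, restrict_of, h2, map_zero, LinearMap.zero_apply]
  exact LinearMap.congr_fun h1 x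

theorem layerFamily_zero {T : Fin c → ∀ n, G (n + 2) →ₗ[S] G n} (hT : PullCommute T)
    (ω : Σ q : Fin c, Σ n : ℕ, ι q n) : layerFamily β hT pr (0, ω) = layerForm β pr ω := by
  simp [layerFamily]

theorem layerFamily_succ {T : Fin c → ∀ n, G (n + 2) →ₗ[S] G n} (hT : PullCommute T) (l : Fin c)
    (α : Fin c →₀ ℕ) (ω : Σ q : Fin c, Σ n : ℕ, ι q n) (b : ℕ) :
    layerFamily β hT pr (Finsupp.single l b + α, ω) =
      ((pull 2 (T l) : Module.End (IsLocalRing.ResidueField S) (GradedDual S G)) ^ b)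
        (layerFamily β hT pr (α, ω)) := by
  unfold layerFamily
  rw [← one_mul (1 : IsLocalRing.ResidueField S), ← MvPolynomial.monomial_mul, one_mul, map_mul,
    ← MvPolynomial.X_pow_eq_monomial, map_pow, polynomialAction_X]
  rfl

/-- Removing χ_p from the monomial leaves an index of the previous stage, unless the layer is p.
There χ_p is the only variable allowed, so nothing is left of the monomial. -/
theorem mem_layerIndices_of_succ {θ : LayerIndex ι} (h : θ ∈ layerIndices ι p.succ) :
    (θ.1.erase p, θ.2) ∈ {θ : LayerIndex ι | θ.2.1 = p ∧ θ.1 = 0} ∪ layerIndices ι p.castSucc := by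
  have h1 : ∀ l ∈ (θ.1.erase p).support, θ.2.1 ≤ l ∧ l < p := by
    intro l hl
    rw [Finsupp.support_erase, Finset.mem_erase] at hl
    exact ⟨(h.2 l hl.2).1, lt_of_le_of_ne (Fin.castSucc_lt_succ_iff.1 (h.2 l hl.2).2) hl.1⟩
  rcases (Fin.castSucc_lt_succ_iff.1 h.1).eq_or_lt with h2 | h2
  · refine Or.inl ⟨h2, ?_⟩
    rw [← Finsupp.support_eq_empty, Finset.eq_empty_iff_forall_notMem]
    intro l hl
    exact absurd (h1 l hl).2 (not_lt.2 (h2 ▸ (h1 l hl).1))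
  · exact Or.inr ⟨h2, h1⟩

theorem linearIndependent_comp_congr {K E κ : Type*} [Semiring K] [AddCommMonoid E] [Module K E]
    {v w : κ → E} (h : ∀ x, v x = w x) : LinearIndependent K v ↔ LinearIndependent K w := by
  rw [funext h]

theorem restrict_layerFamily_zero (hT' : PullCommute T')
    (hprj : ∀ n x, pr' n (j n x) = Pi.single p x) (n : ℕ) (b : ι p n) :
    restrict (G := fun n => C n p) j (layerFamily β hT' pr' (0, ⟨p, n, b⟩)) =
      of (S := S) (G := fun n => C n p) n (β p n b) := by
  rw [layerFamily_zero, layerForm, restrict_of]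
  refine congrArg _ (LinearMap.ext fun x => ?_)
  rw [LinearMap.comp_apply, LinearMap.comp_apply, LinearMap.comp_apply, hprj, LinearMap.proj_apply,
    Pi.single_eq_same]

theorem layerFamily_eq_zero {T : Fin c → ∀ n, G (n + 2) →ₗ[S] G n} (hT : PullCommute T)
    (hpr : ∀ n x q, p ≤ q → pr n x q = 0) (n : ℕ) (b : ι p n) :
    layerFamily β hT pr (0, ⟨p, n, b⟩) = 0 := by
  rw [layerFamily_zero, layerForm, ← map_zero (of (S := S) (G := G) n)]
  refine congrArg _ (LinearMap.ext fun x => ?_)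
  rw [LinearMap.comp_apply, LinearMap.comp_apply, LinearMap.proj_apply, hpr n x p le_rfl, map_zero,
    LinearMap.zero_apply]

theorem linearIndepOn_of_map_eq_single {E : Type*} [AddCommGroup E]
    [Module (IsLocalRing.ResidueField S) E] (v : LayerIndex ι → E)
    (r : E →ₗ[IsLocalRing.ResidueField S] GradedDual S fun n => C n p)
    (h : ∀ n b, r (v (0, ⟨p, n, b⟩)) = of n (β p n b)) :
    LinearIndepOn (IsLocalRing.ResidueField S) (fun θ => r (v θ))
      {θ : LayerIndex ι | θ.2.1 = p ∧ θ.1 = 0} := by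
  have h1 := linearIndependent_of (S := S) (G := fun n => C n p) (fun n => β p n)
    fun n => (β p n).linearIndependent
  have h2 : {θ : LayerIndex ι | θ.2.1 = p ∧ θ.1 = 0} =
      Set.range fun x : Σ n, ι p n => ((0, ⟨p, x⟩) : LayerIndex ι) := by
    ext ⟨α, q, x⟩
    constructor
    · rintro ⟨hq, hα⟩
      dsimp only at hq hα
      subst hq hα
      exact ⟨x, rfl⟩
    · rintro ⟨x, h⟩
      rw [← h]
      exact ⟨rfl, rfl⟩
  have h3 : Function.Injective fun x : Σ n, ι p n => ((0, ⟨p, x⟩) : LayerIndex ι) :=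
    fun x y h => by simpa using h
  rw [h2, linearIndepOn_range_iff h3]
  refine (linearIndependent_comp_congr ?_).2 h1
  rintro ⟨n, b⟩
  exact h n b

theorem linearIndepOn_prod_of_map_eq {E E' : Type*} [AddCommGroup E]
    [Module (IsLocalRing.ResidueField S) E] [AddCommGroup E'] [Module (IsLocalRing.ResidueField S) E']
    (v : LayerIndex ι → E) (w : LayerIndex ι → E')
    (r : E →ₗ[IsLocalRing.ResidueField S] GradedDual S fun n => C n p)
    (h : ∀ n b, r (v (0, ⟨p, n, b⟩)) = of n (β p n b))
    (r' : E →ₗ[IsLocalRing.ResidueField S] E') (hw : ∀ θ, r' (v θ) = w θ)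
    (hw' : LinearIndepOn (IsLocalRing.ResidueField S) w (layerIndices ι p.castSucc))
    (h0 : ∀ n b, w (0, ⟨p, n, b⟩) = 0) :
    LinearIndepOn (IsLocalRing.ResidueField S) (fun θ => r'.prod r (v θ))
      ({θ : LayerIndex ι | θ.2.1 = p ∧ θ.1 = 0} ∪ layerIndices ι p.castSucc) := by
  refine LinearIndepOn.union_of_map_eq_zero r' r ?_
    (linearIndepOn_of_map_eq_single β v r h) ?_
  · rw [funext hw]
    exact hw'
  · rintro ⟨α, q, n, b⟩ ⟨hq, hα⟩
    dsimp only at hq hα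
    subst hq hα
    exact (hw _).trans (h0 n b)

/-- An index of the new stage is determined by its exponent of χ_p and by its remainder without χ_p,
so the family is part of the family of all powers of χ_p applied to the remainders. -/
theorem linearIndepOn_layerIndices_succ {E E' : Type*} [AddCommGroup E]
    [Module (IsLocalRing.ResidueField S) E] [AddCommGroup E'] [Module (IsLocalRing.ResidueField S) E']
    (v : LayerIndex ι → E) (r : E →ₗ[IsLocalRing.ResidueField S] E')
    (χ : Module.End (IsLocalRing.ResidueField S) E) (hχ : Function.Injective χ)
    (hr : ∀ x, r (χ x) = 0)
    (hv : ∀ b α ω, v (Finsupp.single p b + α, ω) = (χ ^ b) (v (α, ω)))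
    (h : LinearIndepOn (IsLocalRing.ResidueField S) (fun θ => r (v θ))
      ({θ : LayerIndex ι | θ.2.1 = p ∧ θ.1 = 0} ∪ layerIndices ι p.castSucc)) :
    LinearIndepOn (IsLocalRing.ResidueField S) v (layerIndices ι p.succ) := by
  have h2 := LinearIndependent.pow_apply_of_injective hχ r hr
    (y := fun θ : ({θ : LayerIndex ι | θ.2.1 = p ∧ θ.1 = 0} ∪
      layerIndices ι p.castSucc : Set (LayerIndex ι)) => v θ.1) h
  let g : layerIndices ι p.succ → ℕ × ({θ : LayerIndex ι | θ.2.1 = p ∧ θ.1 = 0} ∪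
      layerIndices ι p.castSucc : Set (LayerIndex ι)) :=
    fun θ => (θ.1.1 p, ⟨(θ.1.1.erase p, θ.1.2), mem_layerIndices_of_succ θ.2⟩)
  have hg : Function.Injective g := by
    rintro ⟨⟨α, ω⟩, h⟩ ⟨⟨α', ω'⟩, h'⟩ e
    simp only [g, Prod.mk.injEq, Subtype.mk.injEq] at e
    have e' : α = α' := by
      rw [← Finsupp.single_add_erase p α, ← Finsupp.single_add_erase p α', e.1, e.2.1]
    exact Subtype.ext (Prod.ext e' e.2.2)
  refine (linearIndependent_comp_congr ?_).2 (h2.comp g hg)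
  rintro ⟨⟨α, ω⟩, h⟩
  refine Eq.trans ?_ (hv (α p) (α.erase p) ω)
  rw [Finsupp.single_add_erase]

/-- The operator χ_p is injective because T'_p is surjective, and the restrictions to the previous
stage and to the new layer kill its image. Modulo this image, the elements without χ_p give the
previous family together with a basis of the dual of the new layer. -/
theorem linearIndepOn_layerFamily_succ (hT : IsLayered β T pr p.castSucc) (hT' : PullCommute T')
    (hTi : ∀ l n (φ : G' n →ₗ[S] IsLocalRing.ResidueField S) x,
      φ (T' l n (i (n + 2) x)) = φ (i n (T l n x)))
    (hpri : ∀ n x, pr' n (i n x) = pr n x)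
    (hpr : ∀ n x q, p ≤ q → pr n x q = 0)
    (hprj : ∀ n x, pr' n (j n x) = Pi.single p x)
    (hsurj : ∀ n, Function.Surjective (T' p n))
    (hpi : ∀ n x, T' p n (i (n + 2) x) = 0) (hpj : ∀ n x, T' p n (j (n + 2) x) = 0) :
    LinearIndepOn (IsLocalRing.ResidueField S) (layerFamily β hT' pr') (layerIndices ι p.succ) := by
  have h1 : ∀ x, (restrict i).prod (restrict (G := fun n => C n p) j) (pull 2 (T' p) x) = 0 :=
    fun x => Prod.ext (restrict_pull_eq_zero hpi x) (restrict_pull_eq_zero hpj x)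
  refine linearIndepOn_layerIndices_succ _ _ _ (pull_injective 2 hsurj) h1
    (fun b α ω => layerFamily_succ β hT' p α ω b) ?_
  exact linearIndepOn_prod_of_map_eq β _ (layerFamily β hT.comm pr) _
    (restrict_layerFamily_zero β hT' hprj) _ (restrict_layerFamily β hT.comm hT' hTi hpri)
    hT.linearIndepOn (layerFamily_eq_zero β hT.comm hpr)

/-- By induction on the degree. Subtracting ψ makes a form vanish on the previous stage, and
subtracting η makes it vanish on the new layer without disturbing the former. The remainder factors
through T'_p, so it is χ_p applied to a form of degree n - 2. -/
theorem mem_span_layerFamily_succ (hT : IsLayered β T pr p.castSucc) (hT' : PullCommute T')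
    (hTi : ∀ l n (φ : G' n →ₗ[S] IsLocalRing.ResidueField S) x,
      φ (T' l n (i (n + 2) x)) = φ (i n (T l n x)))
    (hpri : ∀ n x, pr' n (i n x) = pr n x)
    (hprj : ∀ n x, pr' n (j n x) = Pi.single p x)
    (hlt : ∀ n < 2, ∀ φ : G' n →ₗ[S] IsLocalRing.ResidueField S, φ ∘ₗ i n = 0 → φ ∘ₗ j n = 0 →
      φ = 0)
    (hge : ∀ n, ∀ φ : G' (n + 2) →ₗ[S] IsLocalRing.ResidueField S, φ ∘ₗ i (n + 2) = 0 →
      φ ∘ₗ j (n + 2) = 0 → ∃ ψ, φ = ψ ∘ₗ T' p n)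
    (hpr : ∀ n x q, p ≤ q → pr n x q = 0)
    (n : ℕ) (φ : G' n →ₗ[S] IsLocalRing.ResidueField S) :
    of n φ ∈ Submodule.span (IsLocalRing.ResidueField S)
      (layerFamily β hT' pr' '' {θ | θ ∈ layerIndices ι p.succ ∧ θ.degree = n}) := by
  induction n using Nat.strong_induction_on with
  | _ n ih =>
    set V := Submodule.span (IsLocalRing.ResidueField S)
      (layerFamily β hT' pr' '' {θ | θ ∈ layerIndices ι p.succ ∧ θ.degree = n}) with hV
    have hVof : V ≤ LinearMap.range (of (S := S) (G := G') n) := by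
      rw [Submodule.span_le]
      rintro _ ⟨θ, ⟨-, rfl⟩, rfl⟩
      exact layerFamily_mem_range β hT' pr' θ
    have h1 : ∃ ψ, of n ψ ∈ V ∧ φ ∘ₗ i n = ψ ∘ₗ i n := by
      have h2 : (layerFamily β hT.comm pr '' {θ | θ ∈ layerIndices ι p.castSucc ∧ θ.degree = n}) ⊆
          Submodule.map (restrict i) V := by
        rintro _ ⟨θ, ⟨hθ, hd⟩, rfl⟩
        refine ⟨layerFamily β hT' pr' θ, Submodule.subset_span ⟨θ, ⟨⟨?_, fun l hl => ⟨?_, ?_⟩⟩, hd⟩,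
          rfl⟩, restrict_layerFamily β hT.comm hT' hTi hpri θ⟩
        · exact hθ.1.trans Fin.castSucc_lt_succ
        · exact (hθ.2 l hl).1
        · exact (hθ.2 l hl).2.trans Fin.castSucc_lt_succ
      obtain ⟨x, hx, e⟩ := Submodule.span_le.2 h2 (hT.mem_span n (φ ∘ₗ i n))
      obtain ⟨ψ, rfl⟩ := hVof hx
      refine ⟨ψ, hx, ?_⟩
      rw [restrict_of] at e
      exact (of_injective n e).symm
    obtain ⟨ψ, hψ, hi⟩ := h1
    -- The restriction of φ - ψ to the new layer, extended by the projection to that layer; this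
    -- projection is 0 on the previous stage.
    let η := ((φ - ψ) ∘ₗ j n) ∘ₗ LinearMap.proj p ∘ₗ pr' n
    have hη : of n η ∈ V := by
      have h2 : Submodule.span _ (Set.range (β p n)) ≤
          V.comap (of n ∘ₗ residueFieldPrecomp (LinearMap.proj p ∘ₗ pr' n)) := by
        rw [Submodule.span_le]
        rintro _ ⟨b, rfl⟩
        refine Submodule.subset_span ⟨(0, ⟨p, n, b⟩), ⟨⟨Fin.castSucc_lt_succ, by simp⟩, ?_⟩,
          layerFamily_zero β hT' _⟩
        simp [LayerIndex.degree]
      exact h2 ((β p n).mem_span ((φ - ψ) ∘ₗ j n))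
    have hj : (φ - ψ - η) ∘ₗ j n = 0 := LinearMap.ext fun x => by
      change φ (j n x) - ψ (j n x) - (φ (j n (pr' n (j n x) p)) - ψ (j n (pr' n (j n x) p))) = 0
      rw [hprj, Pi.single_eq_same, sub_self]
    have hi' : (φ - ψ - η) ∘ₗ i n = 0 := LinearMap.ext fun x => by
      have h2 := LinearMap.congr_fun hi x
      simp only [LinearMap.comp_apply] at h2
      change φ (i n x) - ψ (i n x) - (φ (j n (pr' n (i n x) p)) - ψ (j n (pr' n (i n x) p))) = 0
      rw [hpri, hpr n x p le_rfl, h2]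
      simp
    have h3 : of n (φ - ψ - η) ∈ V := by
      -- In degrees 0 and 1 there is no image of χ_p, and the remainder vanishes.
      match n, φ, ψ, η, hi', hj, ih, V, hV with
      | 0, φ, ψ, η, hi', hj, _, V, _ =>
        rw [hlt 0 (by omega) _ hi' hj, map_zero]
        exact zero_mem _
      | 1, φ, ψ, η, hi', hj, _, V, _ =>
        rw [hlt 1 (by omega) _ hi' hj, map_zero]
        exact zero_mem _
      | m + 2, φ, ψ, η, hi', hj, ih, V, hV =>
        obtain ⟨ζ, hζ⟩ := hge m _ hi' hj
        rw [hζ, ← pull_of 2 (T' p)]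
        have h4 : Submodule.span (IsLocalRing.ResidueField S)
            (layerFamily β hT' pr' '' {θ | θ ∈ layerIndices ι p.succ ∧ θ.degree = m}) ≤
            V.comap (pull 2 (T' p)) := by
          rw [Submodule.span_le]
          rintro _ ⟨⟨α, ω⟩, ⟨hθ, hd⟩, rfl⟩
          rw [hV]
          refine Submodule.subset_span ⟨(Finsupp.single p 1 + α, ω), ⟨⟨hθ.1, fun l hl => ?_⟩, ?_⟩,
            ?_⟩
          · rcases Finset.mem_union.1 (Finsupp.support_add hl) with h | h
            · obtain rfl := Finset.mem_singleton.1 (Finsupp.support_single_subset h)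
              exact ⟨Fin.castSucc_lt_succ_iff.1 hθ.1, Fin.castSucc_lt_succ⟩
            · exact hθ.2 l h
          · simp only [LayerIndex.degree, map_add, Finsupp.degree_single] at hd ⊢
            omega
          · rw [layerFamily_succ, pow_one]
        exact h4 (ih m (by omega) ζ)
    have h4 := add_mem (add_mem h3 hη) hψ
    rwa [← map_add, ← map_add, sub_add_cancel, sub_add_cancel] at h4

theorem IsLayered.succ (hT : IsLayered β T pr p.castSucc) (hT' : PullCommute T')
    (hTi : ∀ l n (φ : G' n →ₗ[S] IsLocalRing.ResidueField S) x,
      φ (T' l n (i (n + 2) x)) = φ (i n (T l n x)))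
    (hpri : ∀ n x, pr' n (i n x) = pr n x)
    (hpr : ∀ n x q, p ≤ q → pr n x q = 0)
    (hprj : ∀ n x, pr' n (j n x) = Pi.single p x)
    (hsurj : ∀ n, Function.Surjective (T' p n))
    (hpi : ∀ n x, T' p n (i (n + 2) x) = 0) (hpj : ∀ n x, T' p n (j (n + 2) x) = 0)
    (hlt : ∀ n < 2, ∀ φ : G' n →ₗ[S] IsLocalRing.ResidueField S, φ ∘ₗ i n = 0 → φ ∘ₗ j n = 0 →
      φ = 0)
    (hge : ∀ n, ∀ φ : G' (n + 2) →ₗ[S] IsLocalRing.ResidueField S, φ ∘ₗ i (n + 2) = 0 →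
      φ ∘ₗ j (n + 2) = 0 → ∃ ψ, φ = ψ ∘ₗ T' p n) : IsLayered β T' pr' p.succ :=
  ⟨hT', linearIndepOn_layerFamily_succ β hT hT' hTi hpri hpr hprj hsurj hpi hpj,
    mem_span_layerFamily_succ β hT hT' hTi hpri hprj hlt hge hpr⟩

end Step

end GradedDual

/-! ### Splittings of the filtrations -/

namespace HigherMatrixFactorization

section Splitting

variable {S : Type u} [CommRing S] {c : ℕ} {f : Fin c → S}
    {A : Fin 2 → Type u} [∀ s, AddCommGroup (A s)] [∀ s, Module S (A s)]
    [∀ s, Module.Free S (A s)] [∀ s, Module.Finite S (A s)]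
    {H : HigherMatrixFactorization f A} {B : ∀ s, Fin c → Submodule S (A s)}

theorem IsSplitting.fil_le (hB : H.IsSplitting B) (s : Fin 2) (p : Fin c) :
    H.fil s p.castSucc ≤ H.fil s p.succ :=
  (hB s p).1 ▸ le_sup_left

theorem IsSplitting.le_fil (hB : H.IsSplitting B) (s : Fin 2) (p : Fin c) :
    B s p ≤ H.fil s p.succ :=
  (hB s p).1 ▸ le_sup_right

/-- The isomorphism `A_s(p-1) ⊕ B_s(p) ≃ A_s(p)`. -/
noncomputable def IsSplitting.equiv (hB : H.IsSplitting B) (s : Fin 2) (p : Fin c) :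
    (H.fil s p.castSucc × B s p) ≃ₗ[S] H.fil s p.succ :=
  LinearEquiv.ofBijective
    ((Submodule.inclusion (hB.fil_le s p)).coprod (Submodule.inclusion (hB.le_fil s p))) (by
    constructor
    · rw [← LinearMap.ker_eq_bot, LinearMap.ker_eq_bot']
      rintro ⟨x, y⟩ h
      have h1 : (x : A s) + y = 0 := congrArg Subtype.val h
      have h2 : (x : A s) ∈ B s p := by
        rw [eq_neg_of_add_eq_zero_left h1]
        exact neg_mem y.2
      have h3 : (x : A s) = 0 := Submodule.disjoint_def.1 (hB s p).2 _ x.2 h2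
      rw [h3, zero_add] at h1
      exact Prod.ext (Subtype.ext h3) (Subtype.ext h1)
    · rintro ⟨z, hz⟩
      rw [← (hB s p).1] at hz
      obtain ⟨x, hx, y, hy, e⟩ := Submodule.mem_sup.1 hz
      exact ⟨(⟨x, hx⟩, ⟨y, hy⟩), Subtype.ext e⟩)

theorem IsSplitting.coe_equiv (hB : H.IsSplitting B) (s : Fin 2) (p : Fin c)
    (x : H.fil s p.castSucc × B s p) : (hB.equiv s p x : A s) = x.1 + x.2 := rfl

/-- A direct summand of a free module is projective. It is finitely generated since S is Noetherian,
hence free since S is local. -/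
theorem IsSplitting.free [IsNoetherianRing S] [IsLocalRing S] (hB : H.IsSplitting B) (s : Fin 2)
    (p : Fin c) : Module.Free S (B s p) := by
  have h1 := H.fil_free s p.succ
  have h2 : Module.Projective S (B s p) := Module.Projective.of_split
    (Submodule.inclusion (hB.le_fil s p)) (LinearMap.snd S _ _ ∘ₗ (hB.equiv s p).symm.toLinearMap)
    (LinearMap.ext fun x => by
      have h3 : Submodule.inclusion (hB.le_fil s p) x = hB.equiv s p (0, x) :=
        Subtype.ext (zero_add _).symm
      simp [h3])
  exact Module.free_of_flat_of_isLocalRing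

theorem IsSplitting.mkQ_equiv_eq (hB : H.IsSplitting B) (p : Fin c) (z : H.fil 1 p.succ) :
    ((hB.equiv 1 p).symm z).2 = ((H.fil 1 p.castSucc).submoduleOf (H.fil 1 p.succ)).liftQ
      (LinearMap.snd S _ _ ∘ₗ (hB.equiv 1 p).symm.toLinearMap) (fun x hx => by
        have h3 : x = hB.equiv 1 p (⟨x, hx⟩, 0) := Subtype.ext (add_zero _).symm
        rw [h3]
        simp) (((H.fil 1 p.castSucc).submoduleOf (H.fil 1 p.succ)).mkQ z) := rfl

/-- The congruence `π_p h_p d_p ≡ f_p π_p`, in terms of a splitting. -/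
theorem IsSplitting.h_d (hB : H.IsSplitting B) (p : Fin c) (x : H.fil 1 p.succ) :
    ((hB.equiv 1 p).symm (H.h p (H.d.restrict (H.d_mem p.succ) x))).2 -
      f p • ((hB.equiv 1 p).symm x).2 ∈ (prevIdeal f p • ⊤ : Submodule S (B 1 p)) := by
  rw [hB.mkQ_equiv_eq, hB.mkQ_equiv_eq, ← map_smul, ← map_sub]
  exact LinearMap.apply_mem_smul_top _ _ (H.h_d p x)

theorem prevIdeal_regular (hf : RingTheory.Sequence.IsRegular S (List.ofFn f)) (p : Fin c) (x : S)
    (hx : f p * x ∈ prevIdeal f p) : x ∈ prevIdeal f p :=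
  mem_span_of_mul_mem_span_of_isWeaklyRegular f hf.toIsWeaklyRegular p x hx

/-- If `d x ≡ 0`, then `π_p x ≡ 0`. -/
theorem IsSplitting.snd_mem_of_d_mem [IsNoetherianRing S] [IsLocalRing S] (hB : H.IsSplitting B)
    (hf : RingTheory.Sequence.IsRegular S (List.ofFn f)) (p : Fin c) (x : H.fil 1 p.succ)
    (hx : H.d.restrict (H.d_mem p.succ) x ∈ (prevIdeal f p • ⊤ : Submodule S (H.fil 0 p.succ))) :
    ((hB.equiv 1 p).symm x).2 ∈ (prevIdeal f p • ⊤ : Submodule S (B 1 p)) := by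
  have := hB.free 1 p
  -- From d x ≡ 0 it follows that π_p h_p d_p x ≡ 0. This is congruent to f_p π_p x, and f_p can be
  -- cancelled.
  refine mem_smul_top_of_smul_mem _ (f p) (prevIdeal_regular hf p) ?_
  have h1 := LinearMap.apply_mem_smul_top (prevIdeal f p)
    (LinearMap.snd S _ _ ∘ₗ (hB.equiv 1 p).symm.toLinearMap ∘ₗ H.h p) hx
  simpa using sub_mem h1 (hB.h_d p x)

/-- A form on A_s(p-1) is extended by 0 on B_s(p), and so on up to A_s. Minimality is stated in A_s;
this makes it available for forms on A_s(p). -/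
theorem IsSplitting.exists_extend (hB : H.IsSplitting B) {E : Type*} [AddCommGroup E] [Module S E]
    (s : Fin 2) (p : Fin (c + 1)) (φ : H.fil s p →ₗ[S] E) : ∃ Φ : A s →ₗ[S] E, ∀ x : H.fil s p, Φ x = φ x := by
  induction p using Fin.reverseInduction with
  | last => exact ⟨φ ∘ₗ LinearMap.codRestrict _ LinearMap.id fun x => by
      rw [H.fil_last]
      exact Submodule.mem_top, fun x => rfl⟩
  | cast p ih =>
    obtain ⟨Φ, h⟩ := ih (φ ∘ₗ LinearMap.fst S _ _ ∘ₗ (hB.equiv s p).symm.toLinearMap)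
    refine ⟨Φ, fun x => ?_⟩
    have h3 : ⟨x, hB.fil_le s p x.2⟩ = hB.equiv s p (x, 0) := Subtype.ext (add_zero _).symm
    refine (h ⟨x, hB.fil_le s p x.2⟩).trans ?_
    rw [h3]
    simp

theorem IsMinimal.d_apply_eq_zero [IsLocalRing S] (hH : H.IsMinimal) (hB : H.IsSplitting B)
    (p : Fin (c + 1)) (φ : H.fil 0 p →ₗ[S] IsLocalRing.ResidueField S) (x : H.fil 1 p) :
    φ (H.d.restrict (H.d_mem p) x) = 0 := by
  obtain ⟨Φ, h⟩ := hB.exists_extend 0 p φ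
  rw [← h]
  exact Φ.residueField_apply_eq_zero le_rfl (hH.1 x)

theorem IsMinimal.h_apply_eq_zero [IsLocalRing S] (hH : H.IsMinimal) (hB : H.IsSplitting B)
    (p : Fin c) (φ : H.fil 1 p.succ →ₗ[S] IsLocalRing.ResidueField S) (x : H.fil 0 p.succ) :
    φ (H.h p x) = 0 := by
  obtain ⟨Φ, h⟩ := hB.exists_extend 1 p.succ φ
  rw [← h]
  exact Φ.residueField_apply_eq_zero le_rfl (hH.2 p x)

end Splitting

end HigherMatrixFactorization

/-! ### Adding a two-term complex to a complex -/

section Cone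

variable {S : Type*} [CommRing S] {G C : ℕ → Type*} [∀ n, AddCommGroup (G n)]
  [∀ n, Module S (G n)] [∀ n, AddCommGroup (C n)] [∀ n, Module S (C n)]

/-- The differential on `G ⊕ C`, for a module `C` in degrees `0` and `1`, given by
`e : C_1 → G_0 ⊕ C_0`. -/
def coneDel (del : ∀ n, G (n + 1) →ₗ[S] G n) (e : C 1 →ₗ[S] G 0 × C 0) :
    ∀ n, G (n + 1) × C (n + 1) →ₗ[S] G n × C n
  | 0 => (LinearMap.inl S (G 0) (C 0) ∘ₗ del 0).coprod e
  | n + 1 => LinearMap.inl S (G (n + 1)) (C (n + 1)) ∘ₗ del (n + 1) ∘ₗ LinearMap.fst S _ _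

/-- The operators on `G ⊕ C` that extend the operators on `G` by zero. -/
def coneOp {c : ℕ} (T : Fin c → ∀ n, G (n + 2) →ₗ[S] G n) (j : Fin c) (n : ℕ) :
    G (n + 2) × C (n + 2) →ₗ[S] G n × C n :=
  LinearMap.inl S (G n) (C n) ∘ₗ T j n ∘ₗ LinearMap.fst S _ _

variable {del : ∀ n, G (n + 1) →ₗ[S] G n} {e : C 1 →ₗ[S] G 0 × C 0}

theorem coneDel_coneDel (n : ℕ) (x : G (n + 2) × C (n + 2)) :
    coneDel del e n (coneDel del e (n + 1) x) = (del n (del (n + 1) x.1), 0) := by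
  cases n with
  | zero =>
    change (del 0 (del 1 x.1), (0 : C 0)) + e 0 = _
    rw [map_zero, add_zero]
  | succ n => rfl

theorem prod_mem_smul_top_iff {M N : Type*} [AddCommGroup M] [Module S M] [AddCommGroup N]
    [Module S N] (I : Ideal S) (x : M × N) : x ∈ (I • ⊤ : Submodule S (M × N)) ↔
      x.1 ∈ (I • ⊤ : Submodule S M) ∧ x.2 ∈ (I • ⊤ : Submodule S N) := by
  constructor
  · exact fun h => ⟨LinearMap.apply_mem_smul_top I (LinearMap.fst S M N) h,
      LinearMap.apply_mem_smul_top I (LinearMap.snd S M N) h⟩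
  · rintro ⟨h1, h2⟩
    have h3 := add_mem (LinearMap.apply_mem_smul_top I (LinearMap.inl S M N) h1)
      (LinearMap.apply_mem_smul_top I (LinearMap.inr S M N) h2)
    simpa using h3

/-- The hypothesis on C_1 says that a cycle of degree 1 modulo I has a trivial component there, and
C vanishes in higher degrees. So cycles, and their preimages, come from G. -/
theorem coneDel_exact (I : Ideal S) (hC : ∀ n, Subsingleton (C (n + 2)))
    (hG : ∀ n x, del n x ∈ (I • ⊤ : Submodule S (G n)) →
      ∃ y, del (n + 1) y - x ∈ (I • ⊤ : Submodule S (G (n + 1))))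
    (he : ∀ x, coneDel del e 0 x ∈ (I • ⊤ : Submodule S (G 0 × C 0)) →
      x.2 ∈ (I • ⊤ : Submodule S (C 1))) (n : ℕ) (x : G (n + 1) × C (n + 1))
    (hx : coneDel del e n x ∈ (I • ⊤ : Submodule S (G n × C n))) :
    ∃ y, coneDel del e (n + 1) y - x ∈ (I • ⊤ : Submodule S (G (n + 1) × C (n + 1))) := by
  have key : del n x.1 ∈ (I • ⊤ : Submodule S (G n)) ∧ x.2 ∈ (I • ⊤ : Submodule S (C (n + 1))) := by
    cases n with
    | zero =>
      refine ⟨?_, he x hx⟩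
      have h1 := sub_mem hx (LinearMap.apply_mem_smul_top I e (he x hx))
      have h2 := ((prod_mem_smul_top_iff I _).1 h1).1
      have h3 : coneDel del e 0 x - e x.2 = (del 0 x.1, 0) := add_sub_cancel_right _ _
      rwa [h3] at h2
    | succ n =>
      refine ⟨((prod_mem_smul_top_iff I _).1 hx).1, ?_⟩
      rw [(hC n).elim x.2 0]
      exact zero_mem _
  obtain ⟨y, hy⟩ := hG n x.1 key.1
  refine ⟨(y, 0), ?_⟩
  rw [prod_mem_smul_top_iff]
  refine ⟨hy, ?_⟩
  have h1 : (coneDel del e (n + 1) (y, 0) - x).2 = - x.2 := zero_sub _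
  rw [h1]
  exact neg_mem key.2

/-- No differential has a component in C_1, and C vanishes from degree 2 on. Hence neither the
square of the differential nor the generation of forms is affected by C. -/
theorem coneDel_isMinimalLifting [IsLocalRing S] {c : ℕ} {f : Fin c → S}
    {T : Fin c → ∀ n, G (n + 2) →ₗ[S] G n} (hG : IsMinimalLifting f del T)
    (hC : ∀ n, Subsingleton (C (n + 2)))
    (he : ∀ (φ : G 0 × C 0 →ₗ[S] IsLocalRing.ResidueField S) x, φ (e x) = 0) :
    IsMinimalLifting f (G := fun n => G n × C n) (coneDel del e) (coneOp T) where
  del_del n x := by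
    rw [coneDel_coneDel, hG.del_del]
    exact (LinearMap.inl S (G n) (C n)).map_sum_smul f fun j => T j n x.1
  minimal n φ x := by
    have h1 := hG.minimal n (φ ∘ₗ LinearMap.inl S (G n) (C n)) x.1
    cases n with
    | zero =>
      change φ (LinearMap.inl S (G 0) (C 0) (del 0 x.1) + e x.2) = 0
      rw [map_add, he, add_zero]
      exact h1
    | succ n => exact h1
  generated n φ := by
    obtain ⟨ψ, hψ⟩ := hG.generated n (φ ∘ₗ LinearMap.inl S _ _)
    refine ⟨fun j => ψ j ∘ₗ LinearMap.fst S _ _, fun x => ?_⟩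
    refine Eq.trans ?_ (hψ x.1)
    exact congrArg φ (Prod.ext rfl ((hC n).elim _ _))

end Cone

/-! ### The minimal resolution of the module of a higher matrix factorization -/

/-- The ideal `(f_1, …, f_p)`. -/
def stageIdeal {S : Type u} [CommRing S] {c : ℕ} (f : Fin c → S) (p : Fin (c + 1)) : Ideal S :=
  Ideal.span (f '' {q | q.castSucc < p})

theorem stageIdeal_castSucc {S : Type u} [CommRing S] {c : ℕ} (f : Fin c → S) (p : Fin c) :
    stageIdeal f p.castSucc = prevIdeal f p := by
  simp [stageIdeal, prevIdeal]

theorem insert_eq_setOf_castSucc_lt_succ {c : ℕ} (p : Fin c) :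
    insert p {q | q < p} = {q : Fin c | q.castSucc < p.succ} := by
  ext q
  simp [Fin.castSucc_lt_succ_iff, le_iff_eq_or_lt]

theorem stageIdeal_succ {S : Type u} [CommRing S] {c : ℕ} (f : Fin c → S) (p : Fin c) :
    stageIdeal f p.succ = prevIdeal f p ⊔ Ideal.span {f p} := by
  rw [stageIdeal, prevIdeal, ← insert_eq_setOf_castSucc_lt_succ, Set.image_insert_eq,
    Ideal.span_insert, sup_comm]

theorem stageIdeal_last {S : Type u} [CommRing S] {c : ℕ} (f : Fin c → S) :
    stageIdeal f (Fin.last c) = Ideal.span (Set.range f) := by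
  rw [stageIdeal, ← Set.image_univ]
  congr
  ext q
  simp [Fin.castSucc_lt_last]

section Layer

variable {S : Type u} [CommRing S] {c : ℕ} {A : Fin 2 → Type u} [∀ s, AddCommGroup (A s)]
  [∀ s, Module S (A s)] (B : ∀ s, Fin c → Submodule S (A s))

/-- The module `B(q)`, by degrees. -/
def layer : ℕ → Fin c → Type u
  | 0, q => B 0 q
  | 1, q => B 1 q
  | _ + 2, _ => PUnit

instance : ∀ n q, AddCommGroup (layer B n q)
  | 0, q => inferInstanceAs (AddCommGroup (B 0 q))
  | 1, q => inferInstanceAs (AddCommGroup (B 1 q))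
  | _ + 2, _ => inferInstanceAs (AddCommGroup PUnit.{u + 1})

instance : ∀ n q, Module S (layer B n q)
  | 0, q => inferInstanceAs (Module S (B 0 q))
  | 1, q => inferInstanceAs (Module S (B 1 q))
  | _ + 2, _ => inferInstanceAs (Module S PUnit.{u + 1})

instance (n : ℕ) (q : Fin c) : Subsingleton (layer B (n + 2) q) :=
  inferInstanceAs (Subsingleton PUnit.{u + 1})

instance finite_layer [IsNoetherianRing S] [∀ s, Module.Finite S (A s)] :
    ∀ n q, Module.Finite S (layer B n q)
  | 0, q => inferInstanceAs (Module.Finite S (B 0 q))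
  | 1, q => inferInstanceAs (Module.Finite S (B 1 q))
  | _ + 2, _ => inferInstanceAs (Module.Finite S PUnit.{u + 1})

theorem free_layer (hB : ∀ s q, Module.Free S (B s q)) : ∀ n q, Module.Free S (layer B n q)
  | 0, q => hB 0 q
  | 1, q => hB 1 q
  | _ + 2, _ => inferInstanceAs (Module.Free S PUnit.{u + 1})

end Layer

namespace Shamash

variable {S : Type*} [CommRing S] {U : ℕ → Type u} [∀ n, AddCommGroup (U n)]
  [∀ n, Module S (U n)] {E : Type*} [AddCommGroup E] [Module S E]

theorem eq_zero_of_comp_inc {n : ℕ} (hn : n < 2) {φ : Total U n →ₗ[S] E}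
    (h : φ ∘ₗ inc U S n = 0) : φ = 0 :=
  match n with
  | 0 => h
  | 1 => h

theorem exists_eq_comp_t {n : ℕ} {φ : Total U (n + 2) →ₗ[S] E}
    (h : φ ∘ₗ inc U S (n + 2) = 0) : ∃ ψ, φ = ψ ∘ₗ t U S n := by
  refine ⟨φ ∘ₗ ins U S n, LinearMap.ext fun x => ?_⟩
  conv_lhs => rw [← inc_pr_add_ins_t S n x, map_add]
  exact (congrArg (· + _) (LinearMap.congr_fun h _)).trans (zero_add _)

end Shamash

namespace HigherMatrixFactorization

variable {S : Type u} [CommRing S] [IsLocalRing S] {c : ℕ} {f : Fin c → S}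
    {A : Fin 2 → Type u} [∀ s, AddCommGroup (A s)] [∀ s, Module S (A s)]
    [∀ s, Module.Free S (A s)] [∀ s, Module.Finite S (A s)]
    (H : HigherMatrixFactorization f A) (B : ∀ s, Fin c → Submodule S (A s))
    {ι : Fin c → ℕ → Type*}
    (β : ∀ q n, Module.Basis (ι q n) (IsLocalRing.ResidueField S)
      (layer B n q →ₗ[S] IsLocalRing.ResidueField S))

/-- A lifting to `S` of a minimal free resolution over `S / (f_1, …, f_p)` of the cokernel of
`d_p`, with layered graded dual. -/
structure MinimalResolution (p : Fin (c + 1)) where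
  G : ℕ → Type u
  [addCommGroup : ∀ n, AddCommGroup (G n)]
  [module : ∀ n, Module S (G n)]
  [free : ∀ n, Module.Free S (G n)]
  [finite : ∀ n, Module.Finite S (G n)]
  del : ∀ n, G (n + 1) →ₗ[S] G n
  T : Fin c → ∀ n, G (n + 2) →ₗ[S] G n
  T_eq_zero : ∀ j : Fin c, p ≤ j.castSucc → T j = 0
  isMinimalLifting : IsMinimalLifting f del T
  exact : ∀ n x, del n x ∈ (stageIdeal f p • ⊤ : Submodule S (G n)) →
    ∃ y, del (n + 1) y - x ∈ (stageIdeal f p • ⊤ : Submodule S (G (n + 1)))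
  e₀ : G 0 ≃ₗ[S] H.fil 0 p
  e₁ : G 1 ≃ₗ[S] H.fil 1 p
  e_del : ∀ x, e₀ (del 0 x) = H.d.restrict (H.d_mem p) (e₁ x)
  pr : ∀ n, G n →ₗ[S] ∀ q, layer B n q
  pr_eq_zero : ∀ n x (q : Fin c), p ≤ q.castSucc → pr n x q = 0
  isLayered : GradedDual.IsLayered β T pr p

attribute [instance] MinimalResolution.addCommGroup MinimalResolution.module MinimalResolution.free
  MinimalResolution.finite

theorem nonempty_minimalResolution_zero : Nonempty (H.MinimalResolution B β 0) := by
  have hs : ∀ s, Subsingleton (H.fil s 0) := fun s => by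
    rw [H.fil_zero]
    infer_instance
  have hs' : Subsingleton (GradedDual S fun _ => PUnit.{u + 1}) :=
    ⟨fun x y => GradedDual.ext_coeff fun n => LinearMap.ext fun z => by
      rw [Subsingleton.elim z 0, map_zero, map_zero]⟩
  exact ⟨{
    G := fun _ => PUnit
    del := fun _ => 0
    T := fun _ _ => 0
    T_eq_zero := fun _ _ => rfl
    isMinimalLifting := ⟨fun _ _ => rfl, fun n φ x => map_zero φ, fun n φ => ⟨0, fun x => by
      rw [Subsingleton.elim x 0, map_zero]
      simp⟩⟩
    exact := fun n x _ => ⟨0, by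
      rw [Subsingleton.elim (_ - x) 0]
      exact zero_mem _⟩
    e₀ := 0
    e₁ := 0
    e_del := fun x => Subsingleton.elim _ _
    pr := fun _ => 0
    pr_eq_zero := fun _ _ _ _ => rfl
    isLayered := ⟨fun i j => LinearMap.ext fun x => Subsingleton.elim _ _, by
      have h : GradedDual.layerIndices ι (0 : Fin (c + 1)) = ∅ :=
        Set.eq_empty_of_forall_notMem fun θ h => absurd h.1 (Fin.not_lt_zero _)
      rw [h]
      exact linearIndepOn_empty _ _, fun n φ => by
      convert Submodule.zero_mem _⟩ }⟩

variable [IsNoetherianRing S] {H B β}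

/-- Each congruence of the factorization enters once: π_p h_p d_p ≡ f_p π_p yields exactness after
B(p) is added, and d_p h_p ≡ f_p yields the first homotopy of the Shamash construction. Minimality
of d and h makes the attaching map and this homotopy invisible to forms. -/
theorem MinimalResolution.nonempty_succ (hf : RingTheory.Sequence.IsRegular S (List.ofFn f))
    (hH : H.IsMinimal) (hB : H.IsSplitting B) {p : Fin c}
    (P : H.MinimalResolution B β p.castSucc) : Nonempty (H.MinimalResolution B β p.succ) := by
  have hfree := free_layer B fun s q => hB.free s q
  have hC : ∀ n, Subsingleton (layer B (n + 2) p) := fun n => inferInstance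
  let e₀ : (P.G 0 × layer B 0 p) ≃ₗ[S] H.fil 0 p.succ :=
    (P.e₀.prodCongr (LinearEquiv.refl S (B 0 p))).trans (hB.equiv 0 p)
  let e₁ : (P.G 1 × layer B 1 p) ≃ₗ[S] H.fil 1 p.succ :=
    (P.e₁.prodCongr (LinearEquiv.refl S (B 1 p))).trans (hB.equiv 1 p)
  let U : ℕ → Type u := fun n => P.G n × layer B n p
  -- The restriction of d to B_1(p), which may have a component in A_0(p-1) as well as in B_0(p).
  let e : layer B 1 p →ₗ[S] P.G 0 × layer B 0 p := e₀.symm.toLinearMap ∘ₗ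
    H.d.restrict (H.d_mem p.succ) ∘ₗ e₁.toLinearMap ∘ₗ LinearMap.inr S (P.G 1) (layer B 1 p)
  let dU : ∀ n, U (n + 1) →ₗ[S] U n := coneDel (C := fun n => layer B n p) P.del e
  have hdU : ∀ x, e₀ (dU 0 x) = H.d.restrict (H.d_mem p.succ) (e₁ x) := by
    rintro ⟨x, b⟩
    have h1 : e₀ (LinearMap.inl S (P.G 0) (layer B 0 p) (P.del 0 x)) =
        H.d.restrict (H.d_mem p.succ) (e₁ (LinearMap.inl S (P.G 1) (layer B 1 p) x)) := by
      refine Subtype.ext ?_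
      have h2 := congrArg (Subtype.val : _ → A 0) (P.e_del x)
      have h3 : (e₀ (LinearMap.inl S (P.G 0) (layer B 0 p) (P.del 0 x)) : A 0) =
        P.e₀ (P.del 0 x) := add_zero _
      have h4 : (e₁ (LinearMap.inl S (P.G 1) (layer B 1 p) x) : A 1) = P.e₁ x := add_zero _
      rw [h3, h2]
      exact congrArg H.d h4.symm
    have h2 : e₀ (e b) = H.d.restrict (H.d_mem p.succ) (e₁ (LinearMap.inr S (P.G 1) _ b)) :=
      e₀.apply_symm_apply _
    change e₀ (LinearMap.inl S (P.G 0) (layer B 0 p) (P.del 0 x) + e b) = _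
    rw [map_add, h1, h2, ← map_add, ← map_add]
    congr 2
    exact Prod.ext (add_zero _) (zero_add _)
  let h : U 0 →ₗ[S] U 1 := e₁.symm.toLinearMap ∘ₗ H.h p ∘ₗ e₀.toLinearMap
  let τ : Fin c → ∀ n, U (n + 2) →ₗ[S] U n := coneOp (C := fun n => layer B n p) P.T
  have hU : IsMinimalLifting f dU τ := coneDel_isMinimalLifting P.isMinimalLifting hC
    fun φ x => hH.d_apply_eq_zero hB p.succ (φ ∘ₗ e₀.symm.toLinearMap) _
  have hex : ∀ n x, dU n x ∈ (prevIdeal f p • ⊤ : Submodule S (U n)) →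
      ∃ y, dU (n + 1) y - x ∈ (prevIdeal f p • ⊤ : Submodule S (U (n + 1))) := by
    refine coneDel_exact (C := fun n => layer B n p) (prevIdeal f p) hC (stageIdeal_castSucc f p ▸ P.exact) fun x hx => ?_
    have h1 := hB.snd_mem_of_d_mem hf p (e₁ x) (by
      rw [← hdU]
      exact LinearMap.apply_mem_smul_top _ e₀.toLinearMap hx)
    have h2 : ((hB.equiv 1 p).symm (e₁ x)).2 = x.2 :=
      congrArg Prod.snd ((hB.equiv 1 p).symm_apply_apply _)
    rwa [h2] at h1
  have hdd : ∀ n x, dU n (dU (n + 1) x) ∈ (prevIdeal f p • ⊤ : Submodule S (U n)) := by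
    intro n x
    rw [hU.del_del]
    refine sum_mem fun j _ => ?_
    -- The operators of the previous stage vanish for j ≥ p, so only f_1, …, f_{p-1} occur in the
    -- square of the differential.
    by_cases hj : j < p
    · exact Submodule.smul_mem_smul (Ideal.subset_span ⟨j, hj, rfl⟩) Submodule.mem_top
    · have h1 : τ j n x = 0 := by
        change (LinearMap.inl S (P.G n) (layer B n p)) (P.T j n x.1) = 0
        rw [P.T_eq_zero j (by simpa using hj), Pi.zero_apply, LinearMap.zero_apply, map_zero]
      rw [h1, smul_zero]
      exact zero_mem _
  obtain ⟨s, del, hs⟩ := Shamash.exists_isHomotopySystem dU h (f p) (prevIdeal f p) hdd hex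
    (fun x => by
      have h1 := LinearMap.apply_mem_smul_top _ e₀.symm.toLinearMap (H.d_h p (e₀ x))
      have h2 : dU 0 (h x) = e₀.symm (H.d.restrict (H.d_mem p.succ) (H.h p (e₀ x))) := by
        rw [LinearEquiv.eq_symm_apply, hdU]
        exact congrArg _ (e₁.apply_symm_apply _)
      rw [h2]
      simpa using h1)
  obtain ⟨T', hT', hTp, hT0, hTi⟩ := hs.exists_isMinimalLifting hf (lt_irrefl p) hU
    fun φ x => hH.h_apply_eq_zero hB p (φ ∘ₗ e₁.symm.toLinearMap) _
  let pr' : ∀ n, Shamash.Total U n →ₗ[S] ∀ q, layer B n q := fun n =>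
    (P.pr n ∘ₗ LinearMap.fst S (P.G n) (layer B n p) +
      LinearMap.single S (layer B n) p ∘ₗ LinearMap.snd S (P.G n) (layer B n p)) ∘ₗ
        Shamash.pr U S n
  exact ⟨{
    G := Shamash.Total U
    del := del
    T := T'
    T_eq_zero := fun j hj => hT0 j (by
      rw [insert_eq_setOf_castSucc_lt_succ]
      exact not_lt.2 hj)
    isMinimalLifting := hT'
    exact := fun n x hx => by
      rw [stageIdeal_succ] at hx ⊢
      obtain ⟨y, hy⟩ := hs.exact (prevIdeal_regular hf p) hex n x hx
      exact ⟨y, Submodule.smul_mono_left le_sup_left hy⟩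
    e₀ := e₀
    e₁ := e₁
    e_del := fun x => (congrArg e₀ (hs.pr_del_zero x)).trans (hdU x)
    pr := pr'
    pr_eq_zero := fun n x q hq => by
      have h1 : p.castSucc < q.castSucc := lt_of_lt_of_le Fin.castSucc_lt_succ hq
      have h2 := P.pr_eq_zero n (Shamash.pr U S n x).1 q h1.le
      change P.pr n (Shamash.pr U S n x).1 q + Pi.single p (Shamash.pr U S n x).2 q = 0
      rw [h2, Pi.single_eq_of_ne (by rintro rfl; exact lt_irrefl _ h1), add_zero]
    isLayered := by
      refine GradedDual.IsLayered.succ β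
        (i := fun n => Shamash.inc U S n ∘ₗ LinearMap.inl S (P.G n) (layer B n p))
        (j := fun n => Shamash.inc U S n ∘ₗ LinearMap.inr S (P.G n) (layer B n p))
        P.isLayered ?_ ?_ ?_ ?_ ?_ ?_ ?_ ?_ ?_ ?_
      · intro i j
        refine GradedDual.linearMap_ext fun n φ => ?_
        rw [Module.End.mul_apply, Module.End.mul_apply, GradedDual.pull_of, GradedDual.pull_of,
          GradedDual.pull_of, GradedDual.pull_of]
        exact congrArg _ (LinearMap.ext fun x => hT'.apply_comm hf j i n φ x)
      · exact fun l n φ x => hTi l n φ _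
      · intro n x
        change P.pr n (Shamash.pr U S n (Shamash.inc U S n _)).1 +
          Pi.single p (Shamash.pr U S n (Shamash.inc U S n _)).2 = _
        rw [Shamash.pr_inc]
        change P.pr n x + Pi.single p 0 = P.pr n x
        rw [Pi.single_zero, add_zero]
      · exact fun n x q hq => P.pr_eq_zero n x q hq
      · intro n x
        change P.pr n (Shamash.pr U S n (Shamash.inc U S n _)).1 +
          Pi.single p (Shamash.pr U S n (Shamash.inc U S n _)).2 = _
        rw [Shamash.pr_inc]
        change P.pr n 0 + Pi.single p x = Pi.single p x
        rw [map_zero, zero_add]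
      · rw [hTp]
        exact Shamash.t_surjective S
      · rw [hTp]
        exact fun n x => rfl
      · rw [hTp]
        exact fun n x => rfl
      · intro n hn φ hi hj
        refine Shamash.eq_zero_of_comp_inc hn (LinearMap.prod_ext hi hj)
      · intro n φ hi hj
        rw [hTp]
        exact Shamash.exists_eq_comp_t (LinearMap.prod_ext hi hj) }⟩

end HigherMatrixFactorization

/-! ### Base change to a quotient ring -/

section BaseChange

variable {S : Type*} [CommRing S] {I : Ideal S} {N N' : Type*} [AddCommGroup N] [Module S N]
  [AddCommGroup N'] [Module S N'] [Module (S ⧸ I) N'] [IsScalarTower S (S ⧸ I) N'] {g : N →ₗ[S] N'}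

theorem IsBaseChange.surjective_quotient (h : IsBaseChange (S ⧸ I) g) : Function.Surjective g :=
    fun y => by
  induction y using h.inductionOn with
  | zero => exact ⟨0, map_zero _⟩
  | tmul x => exact ⟨x, rfl⟩
  | smul r y hy =>
    obtain ⟨x, rfl⟩ := hy
    obtain ⟨s, rfl⟩ := Ideal.Quotient.mk_surjective r
    exact ⟨s • x, by rw [map_smul, ← algebraMap_smul (S ⧸ I)]; rfl⟩
  | add y z hy hz =>
    obtain ⟨x, rfl⟩ := hy
    obtain ⟨x', rfl⟩ := hz
    exact ⟨x + x', map_add _ _ _⟩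

theorem IsBaseChange.eq_zero_iff_quotient (h : IsBaseChange (S ⧸ I) g) (x : N) :
    g x = 0 ↔ x ∈ (I • ⊤ : Submodule S N) := by
  rw [← map_eq_zero_iff _ h.equiv.symm.injective, IsBaseChange.equiv_symm_apply,
    ← map_eq_zero_iff _ (TensorProduct.quotTensorEquivQuotSMul N I).injective,
    ← map_one (Ideal.Quotient.mk _), TensorProduct.quotTensorEquivQuotSMul_mk_tmul, one_smul,
    Submodule.Quotient.mk_eq_zero]

end BaseChange

/-! ### Independence of the CI operators -/

namespace CIResolution

variable {S : Type u} [CommRing S] {c : ℕ} {f : Fin c → S}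
    {M : ModuleCat.{u} (S ⧸ Ideal.span (Set.range f))} (D D' : CIResolution f M)

theorem red_surjective (n : ℕ) : Function.Surjective (D.red n) :=
  (D.isBaseChange n).surjective_quotient

theorem red_eq_zero_iff (n : ℕ) (x : D.lift n) :
    D.red n x = 0 ↔ x ∈ (Ideal.span (Set.range f) • ⊤ : Submodule S (D.lift n)) :=
  (D.isBaseChange n).eq_zero_iff_quotient x

theorem exists_lift_comp (n : ℕ) (F : D.res.complex.X n ⟶ D'.res.complex.X n) :
    ∃ α : D.lift n →ₗ[S] D'.lift n, ∀ x, D'.red n (α x) = F.hom (D.red n x) := by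
  let b := Module.Free.chooseBasis S (D.lift n)
  choose y hy using fun i => D'.red_surjective n (F.hom (D.red n (b i)))
  refine ⟨b.constr S y, fun x => ?_⟩
  have h1 : D'.red n ∘ₗ b.constr S y = F.hom.restrictScalars S ∘ₗ D.red n :=
    b.ext fun i => by simp [hy]
  exact LinearMap.congr_fun h1 x

/-- Lift F to maps α over S. Since F is a chain map, α del - del' α = ∑ f_j τ_j. Inserting this into
α del² - del'² α and comparing coefficients of f_j, modulo the ideal, shows that the reduction of
τ_j is a homotopy between t_j followed by F and F followed by t'_j. -/
theorem exists_op_homotopy (hf : RingTheory.Sequence.IsWeaklyRegular S (List.ofFn f))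
    (F : D.res.complex ⟶ D'.res.complex) (j : Fin c) (n : ℕ) :
    ∃ (σ : D.res.complex.X (n + 1) ⟶ D'.res.complex.X n)
      (σ' : D.res.complex.X (n + 2) ⟶ D'.res.complex.X (n + 1)),
      D.op j n ≫ F.f n - F.f (n + 2) ≫ D'.op j n =
        σ' ≫ D'.res.complex.d (n + 1) n + D.res.complex.d (n + 2) (n + 1) ≫ σ := by
  choose α hα using fun n => D.exists_lift_comp D' n (F.f n)
  have h1 : ∀ m, ∃ τ : Fin c → D.lift (m + 1) →ₗ[S] D'.lift m, ∀ x,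
      α m (D.del m x) - D'.del m (α (m + 1) x) = ∑ j, f j • τ j x := by
    intro m
    obtain ⟨τ, -, h⟩ := LinearMap.exists_sum_smul_of_forall_mem f Set.univ
      (α m ∘ₗ D.del m - D'.del m ∘ₗ α (m + 1)) fun x => by
        rw [Set.image_univ, ← D'.red_eq_zero_iff, LinearMap.sub_apply, map_sub, sub_eq_zero,
          LinearMap.comp_apply, LinearMap.comp_apply, hα, D'.red_del, hα, D.red_del]
        exact (ConcreteCategory.congr_hom (F.comm (m + 1) m) _).symm
    exact ⟨τ, h⟩
  choose τ hτ using h1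
  let τ' := fun m => (D.isBaseChange (m + 1)).lift (D'.red m ∘ₗ τ m j)
  refine ⟨ModuleCat.ofHom (τ' n), ModuleCat.ofHom (τ' (n + 1)), ?_⟩
  ext1
  refine (D.isBaseChange (n + 2)).algHom_ext _ _ fun x => ?_
  have h2 : ∑ j, f j • (α n (D.t j n x) - D'.t j n (α (n + 2) x) - D'.del n (τ (n + 1) j x) -
      τ n j (D.del (n + 1) x)) = 0 := by
    simp only [smul_sub, Finset.sum_sub_distrib]
    rw [← (α n).map_sum_smul, ← D.del_del, ← D'.del_del, ← (D'.del n).map_sum_smul, ← hτ, ← hτ,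
      map_sub]
    abel
  have h3 := mem_smul_top_of_sum_smul_eq_zero f hf _ h2 j
  rw [← D'.red_eq_zero_iff, map_sub, map_sub, map_sub, hα, ← D.op_red, ← D'.op_red, hα, D'.red_del]
    at h3
  have h4 : ∀ m (y : D.lift (m + 1)), τ' m (D.red (m + 1) y) = D'.red m (τ m j y) := fun m y =>
    (D.isBaseChange (m + 1)).lift_eq _ _
  rw [← h4, ← h4, D.red_del, sub_sub, sub_eq_zero] at h3
  exact h3

/-- Both operators are computed on the first resolution, through a chain map over the identity of M.
On a cocycle φ the homotopy of `exists_op_homotopy` loses its term ending in the differential, and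
the other term is a coboundary. -/
theorem extOp_eq (hf : RingTheory.Sequence.IsWeaklyRegular S (List.ofFn f))
    (Y : ModuleCat.{u} (S ⧸ Ideal.span (Set.range f))) (j : Fin c) (n : ℕ) :
    D.extOp Y hf j n = D'.extOp Y hf j n := by
  ext ξ
  obtain ⟨φ, hφ, rfl⟩ := D'.res.extMk_surjective ξ (n + 1) rfl
  let F : ProjectiveResolution.Hom D.res D'.res (𝟙 M) :=
    { hom := ProjectiveResolution.lift (𝟙 M) D.res D'.res
      hom_f_zero_comp_π_f_zero := ProjectiveResolution.lift_commutes_zero _ _ _ }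
  have key : ∀ m k (hk : m + 1 = k) (ψ : D'.res.complex.X m ⟶ Y)
      (hψ : D'.res.complex.d k m ≫ ψ = 0),
      D'.res.extMk ψ k hk hψ = D.res.extMk (F.hom.f m ≫ ψ) k hk
        (by rw [← F.hom.comm_assoc, hψ, Limits.comp_zero]) := by
    intro m k hk ψ hψ
    rw [← ProjectiveResolution.mk₀_comp_extMk, Abelian.Ext.mk₀_id_comp]
  refine ((congrArg _ (key n _ rfl φ hφ)).trans (D.extOp_extMk Y hf j n _ _)).trans
    (Eq.trans ?_ ((D'.extOp_extMk Y hf j n φ hφ).trans (key _ (n + 3) rfl _ _)).symm)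
  obtain ⟨σ, σ', h⟩ := D.exists_op_homotopy D' hf F.hom j n
  refine sub_eq_zero.1 ((D.res.sub_extMk _ _ (n + 3) rfl _ _).trans
    ((D.res.extMk_eq_zero_iff _ _ _ _ (n + 1) rfl).2 ⟨σ ≫ φ, ?_⟩))
  rw [← Category.assoc, ← Category.assoc, ← Category.assoc, ← Preadditive.sub_comp, h,
    Preadditive.add_comp, Category.assoc, Category.assoc σ', hφ, Limits.comp_zero, zero_add]

/-- The CI operators do not depend on the resolution and the liftings. -/
theorem ciOperator_eq (hf : RingTheory.Sequence.IsWeaklyRegular S (List.ofFn f))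
    (Y : ModuleCat.{u} (S ⧸ Ideal.span (Set.range f))) (j : Fin c) :
    D.ciOperator Y hf j = D'.ciOperator Y hf j := by
  unfold ciOperator
  simp only [D.extOp_eq D' hf Y]

end CIResolution

/-! ### Projective resolutions from exact sequences -/

/-- The projective resolution given by an exact sequence of projective modules. -/
noncomputable def projectiveResolutionOfExact {R : Type u} [CommRing R] (X : ℕ → ModuleCat.{u} R)
    (hX : ∀ n, Projective (X n)) (d : ∀ n, X (n + 1) ⟶ X n) (hd : ∀ n, d (n + 1) ≫ d n = 0)
    (hex : ∀ n x, (d n).hom x = 0 → ∃ y, (d (n + 1)).hom y = x) (M : ModuleCat.{u} R)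
    (π : X 0 ⟶ M) (hπ : Function.Surjective π.hom) (hdπ : d 0 ≫ π = 0)
    (hπd : ∀ x, π.hom x = 0 → ∃ y, (d 0).hom y = x) : ProjectiveResolution M where
  complex := ChainComplex.of X d hd
  projective := hX
  π := (ChainComplex.toSingle₀Equiv _ _).symm ⟨π, by
    exact (congrArg (· ≫ π) (ChainComplex.of_d X d 0)).trans hdπ⟩
  quasiIso := ⟨fun n => by
    cases n
    · rw [ChainComplex.quasiIsoAt₀_iff, ShortComplex.quasiIso_iff_of_zeros']
      · have h1 : (ShortComplex.mk (d 0) π hdπ).Exact := by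
          rw [ShortComplex.moduleCat_exact_iff]
          exact hπd
        refine (ShortComplex.exact_and_epi_g_iff_of_iso ?_).2
          ⟨h1, (ModuleCat.epi_iff_surjective _).2 hπ⟩
        exact ShortComplex.isoMk (Iso.refl _) (Iso.refl _) (Iso.refl _)
          ((Category.id_comp _).trans ((ChainComplex.of_d X d 0).symm.trans
            (Category.comp_id _).symm))
          ((Category.id_comp _).trans (Eq.trans (by simp; rfl) (Category.comp_id _).symm))
      · exact (ChainComplex.of X d hd).shape 0 0 (by simp)
      · rfl
      · rfl
    · rw [quasiIsoAt_iff_exactAt']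
      · rename_i n
        rw [HomologicalComplex.exactAt_iff' _ (n + 1 + 1) (n + 1) n (by simp) (by simp)]
        have h1 : (ShortComplex.mk (d (n + 1)) (d n) (hd n)).Exact := by
          rw [ShortComplex.moduleCat_exact_iff]
          exact hex n
        refine ShortComplex.exact_of_iso ?_ h1
        exact ShortComplex.isoMk (Iso.refl _) (Iso.refl _) (Iso.refl _)
          ((Category.id_comp _).trans ((ChainComplex.of_d X d (n + 1)).trans
            (Category.comp_id _).symm))
          ((Category.id_comp _).trans ((ChainComplex.of_d X d n).trans
            (Category.comp_id _).symm))
      · apply ChainComplex.exactAt_succ_single_obj⟩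

theorem projectiveResolutionOfExact_d {R : Type u} [CommRing R] (X : ℕ → ModuleCat.{u} R)
    (hX : ∀ n, Projective (X n)) (d : ∀ n, X (n + 1) ⟶ X n) (hd : ∀ n, d (n + 1) ≫ d n = 0)
    (hex : ∀ n x, (d n).hom x = 0 → ∃ y, (d (n + 1)).hom y = x) (M : ModuleCat.{u} R)
    (π : X 0 ⟶ M) (hπ : Function.Surjective π.hom) (hdπ : d 0 ≫ π = 0)
    (hπd : ∀ x, π.hom x = 0 → ∃ y, (d 0).hom y = x) (n : ℕ) :
    (projectiveResolutionOfExact X hX d hd hex M π hπ hdπ hπd).complex.d (n + 1) n = d n :=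
  ChainComplex.of_d X d n

namespace CIResolution

theorem exists_isBaseChange_of_basis {S : Type u} [CommRing S] {I : Ideal S} {N : Type u}
    [AddCommGroup N] [Module S N] {ι : Type*} (b : Module.Basis ι S N) (X : ModuleCat.{u} (S ⧸ I))
    (b' : Module.Basis ι (S ⧸ I) X) : ∃ red : N →ₗ[S] X, IsBaseChange (S ⧸ I) red :=
  ⟨Finsupp.linearCombination S b' ∘ₗ b.repr.toLinearMap,
    IsBaseChange.comp_equiv _ _ (IsBaseChange.of_basis S b')⟩

theorem exists_isBaseChange {S : Type u} [CommRing S] (I : Ideal S) (N : Type u) [AddCommGroup N]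
    [Module S N] [Module.Free S N] : ∃ (X : ModuleCat.{u} (S ⧸ I)) (red : N →ₗ[S] X),
      IsBaseChange (S ⧸ I) red ∧ Projective X := by
  obtain ⟨red, h⟩ := exists_isBaseChange_of_basis (Module.Free.chooseBasis S N)
    (ModuleCat.of (S ⧸ I) (Module.Free.ChooseBasisIndex S N →₀ S ⧸ I)) Finsupp.basisSingleOne
  exact ⟨_, red, h, inferInstanceAs (Projective (ModuleCat.of (S ⧸ I) (_ →₀ S ⧸ I)))⟩

variable {S : Type u} [CommRing S] {c : ℕ} {f : Fin c → S}
    {M : ModuleCat.{u} (S ⧸ Ideal.span (Set.range f))}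

/-- CI operator data with a given lifting. -/
theorem exists_of_exact (G : ℕ → Type u) [∀ n, AddCommGroup (G n)] [∀ n, Module S (G n)]
    [∀ n, Module.Free S (G n)] (del : ∀ n, G (n + 1) →ₗ[S] G n)
    (T : Fin c → ∀ n, G (n + 2) →ₗ[S] G n)
    (hdd : ∀ n x, del n (del (n + 1) x) = ∑ j, f j • T j n x)
    (hex : ∀ n x, del n x ∈ (Ideal.span (Set.range f) • ⊤ : Submodule S (G n)) →
      ∃ y, del (n + 1) y - x ∈ (Ideal.span (Set.range f) • ⊤ : Submodule S (G (n + 1))))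
    (π : G 0 →ₗ[S] M) (hπ : Function.Surjective π) (hdπ : ∀ x, π (del 0 x) = 0)
    (hπd : ∀ x, π x = 0 → ∃ y, del 0 y - x ∈ (Ideal.span (Set.range f) • ⊤ : Submodule S (G 0))) :
    ∃ (res : ProjectiveResolution M) (red : ∀ n, G n →ₗ[S] res.complex.X n),
      (∀ n, IsBaseChange (S ⧸ Ideal.span (Set.range f)) (red n)) ∧
      ∀ n x, red n (del n x) = (res.complex.d (n + 1) n).hom (red (n + 1) x) := by
  choose X red hred hX using fun n => exists_isBaseChange (Ideal.span (Set.range f)) (G n)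
  let d : ∀ n, X (n + 1) ⟶ X n := fun n => ModuleCat.ofHom ((hred (n + 1)).lift (red n ∘ₗ del n))
  have hd : ∀ n x, (d n).hom (red (n + 1) x) = red n (del n x) := fun n x =>
    (hred (n + 1)).lift_eq _ x
  let ϖ : X 0 ⟶ M := ModuleCat.ofHom ((hred 0).lift π)
  have hϖ : ∀ x, ϖ.hom (red 0 x) = π x := fun x => (hred 0).lift_eq _ x
  have hsub : ∀ n y x, y - x ∈ (Ideal.span (Set.range f) • ⊤ : Submodule S (G n)) →
      red n y = red n x := fun n y x h => by
    rwa [← sub_eq_zero, ← map_sub, (hred n).eq_zero_iff_quotient]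
  let P := projectiveResolutionOfExact X hX d (fun n => by
      ext1
      refine (hred (n + 2)).algHom_ext _ _ fun x => ?_
      change (d n).hom ((d (n + 1)).hom (red (n + 2) x)) = 0
      rw [hd, hd, (hred n).eq_zero_iff_quotient, hdd]
      exact sum_mem fun j _ => Submodule.smul_mem_smul (Ideal.subset_span ⟨j, rfl⟩)
        Submodule.mem_top)
    (fun n y hy => by
      obtain ⟨x, rfl⟩ := (hred (n + 1)).surjective_quotient y
      rw [hd, (hred n).eq_zero_iff_quotient] at hy
      obtain ⟨z, hz⟩ := hex n x hy
      exact ⟨red _ z, by rw [hd, hsub _ _ _ hz]⟩) M ϖ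
    (fun m => by
      obtain ⟨x, rfl⟩ := hπ m
      exact ⟨red 0 x, hϖ x⟩)
    (by
      ext1
      refine (hred 1).algHom_ext _ _ fun x => ?_
      change ϖ.hom ((d 0).hom (red 1 x)) = 0
      rw [hd, hϖ, hdπ])
    (fun y hy => by
      obtain ⟨x, rfl⟩ := (hred 0).surjective_quotient y
      rw [hϖ] at hy
      obtain ⟨z, hz⟩ := hπd x hy
      exact ⟨red _ z, by rw [hd, hsub _ _ _ hz]⟩)
  refine ⟨P, red, hred, fun n x => ?_⟩
  have h1 : P.complex.d (n + 1) n = d n := projectiveResolutionOfExact_d _ _ _ _ _ _ _ _ _ _ n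
  rw [h1]
  exact (hd n x).symm

end CIResolution

/-! ### Ext from a minimal resolution -/

/-- In degree 0 there are no coboundaries except 0, because the term of the resolution that would be
their source is 0. This case is separate from `extMk_eq_zero_iff`, which refers to a preceding
degree. -/
theorem CategoryTheory.ProjectiveResolution.eq_zero_of_extMk_zero_eq_zero {R : Type u} [CommRing R]
    {M Y : ModuleCat.{u} R} (P : ProjectiveResolution M) (φ : P.complex.X 0 ⟶ Y)
    (hφ : P.complex.d 1 0 ≫ φ = 0) (h : P.extMk φ 1 rfl hφ = 0) : φ = 0 := by
  rw [← P.extEquivCohomologyClass.apply_eq_iff_eq,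
    ProjectiveResolution.extEquivCohomologyClass_extMk,
    ProjectiveResolution.extEquivCohomologyClass_zero,
    CochainComplex.HomComplex.CohomologyClass.mk_eq_zero_iff,
    CochainComplex.HomComplex.Cocycle.toSingleMk_mem_coboundaries_iff _ _ _ _ _ 1
      (by simp)] at h
  obtain ⟨g, hg⟩ := h
  have hz : Limits.IsZero (P.cochainComplex.X 1) :=
    CochainComplex.isZero_of_isStrictlyLE _ 0 _ (by simp)
  rw [hz.eq_of_src g 0, Limits.comp_zero] at hg
  rw [← cancel_epi (P.cochainComplexXIso (-(0 : ℕ)) 0 rfl).hom, Limits.comp_zero]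
  exact hg.symm

namespace CIResolution

variable {S : Type u} [CommRing S] {c : ℕ} {f : Fin c → S}
    {M : ModuleCat.{u} (S ⧸ Ideal.span (Set.range f))} (D : CIResolution f M)
    (Y : ModuleCat.{u} (S ⧸ Ideal.span (Set.range f)))

/-- The cocycle on a minimal resolution given by a form on its lifting. -/
noncomputable def formCocycle (hY : ∀ n (φ : D.lift n →ₗ[S] Y) x, φ (D.del n x) = 0) (n : ℕ) :
    (D.lift n →ₗ[S] Y) →ₗ[S] D.cocycles Y n where
  toFun φ := ⟨ModuleCat.ofHom ((D.isBaseChange n).lift φ), by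
    rw [mem_cocycles]
    ext1
    refine (D.isBaseChange (n + 1)).algHom_ext _ _ fun x => ?_
    have h1 : (D.isBaseChange n).lift φ (D.red n (D.del n x)) = φ (D.del n x) :=
      (D.isBaseChange n).lift_eq φ _
    rw [hY, D.red_del] at h1
    exact h1⟩
  map_add' φ ψ := Subtype.ext (by
    ext1
    refine (D.isBaseChange n).algHom_ext _ _ fun x => ?_
    have h1 : ∀ φ : D.lift n →ₗ[S] Y, (D.isBaseChange n).lift φ (D.red n x) = φ x := fun φ =>
      (D.isBaseChange n).lift_eq φ x
    exact (h1 _).trans (congrArg₂ (· + ·) (h1 _) (h1 _)).symm)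
  map_smul' s φ := Subtype.ext (by
    ext1
    refine (D.isBaseChange n).algHom_ext _ _ fun x => ?_
    have h1 : ∀ φ : D.lift n →ₗ[S] Y, (D.isBaseChange n).lift φ (D.red n x) = φ x := fun φ =>
      (D.isBaseChange n).lift_eq φ x
    exact (h1 _).trans (congrArg (s • ·) (h1 _)).symm)

theorem formCocycle_apply (hY : ∀ n (φ : D.lift n →ₗ[S] Y) x, φ (D.del n x) = 0) (n : ℕ)
    (φ : D.lift n →ₗ[S] Y) (x : D.lift n) :
    (D.formCocycle Y hY n φ).1.hom (D.red n x) = φ x :=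
  (D.isBaseChange n).lift_eq φ x

/-- The forms on a minimal resolution are the elements of Ext. -/
noncomputable def formEquivExt (hY : ∀ n (φ : D.lift n →ₗ[S] Y) x, φ (D.del n x) = 0) (n : ℕ) :
    (D.lift n →ₗ[S] Y) ≃ₗ[S] Abelian.Ext.{u} M Y n :=
  LinearEquiv.ofBijective (D.toExt Y n ∘ₗ D.formCocycle Y hY n) (by
    constructor
    · rw [← LinearMap.ker_eq_bot, LinearMap.ker_eq_bot']
      intro φ h
      ext x
      rw [← D.formCocycle_apply Y hY n φ x]
      cases n with
      | zero =>
        have h1 := D.res.eq_zero_of_extMk_zero_eq_zero _ (D.formCocycle Y hY 0 φ).2 h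
        rw [h1]
        rfl
      | succ n =>
        obtain ⟨g, hg⟩ := (D.res.extMk_eq_zero_iff _ _ rfl
          (D.formCocycle Y hY (n + 1) φ).2 n rfl).1 h
        rw [← hg]
        -- A coboundary is a form composed with the differential, hence 0 by minimality.
        have h1 := hY n (g.hom.restrictScalars S ∘ₗ D.red n) x
        rw [LinearMap.comp_apply, D.red_del] at h1
        exact h1
    · intro ξ
      obtain ⟨⟨F, hF⟩, rfl⟩ := D.toExt_surjective Y n ξ
      refine ⟨F.hom.restrictScalars S ∘ₗ D.red n, congrArg (D.toExt Y n) (Subtype.ext ?_)⟩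
      ext1
      exact (D.isBaseChange n).algHom_ext _ _ fun x => D.formCocycle_apply Y hY n _ x)

theorem formEquivExt_apply (hY : ∀ n (φ : D.lift n →ₗ[S] Y) x, φ (D.del n x) = 0) (n : ℕ)
    (φ : D.lift n →ₗ[S] Y) : D.formEquivExt Y hY n φ = D.res.extMk (D.formCocycle Y hY n φ).1
      (n + 1) rfl (D.formCocycle Y hY n φ).2 :=
  LinearEquiv.ofBijective_apply _ _

theorem extOp_formEquivExt (hf : RingTheory.Sequence.IsWeaklyRegular S (List.ofFn f))
    (hY : ∀ n (φ : D.lift n →ₗ[S] Y) x, φ (D.del n x) = 0) (j : Fin c) (n : ℕ)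
    (φ : D.lift n →ₗ[S] Y) : D.extOp Y hf j n (D.formEquivExt Y hY n φ) =
      D.formEquivExt Y hY (n + 2) (φ ∘ₗ D.t j n) := by
  rw [formEquivExt_apply, formEquivExt_apply]
  refine (D.extOp_extMk Y hf j n _ (D.formCocycle Y hY n φ).2).trans ?_
  have h : D.op j n ≫ (D.formCocycle Y hY n φ).1 = (D.formCocycle Y hY (n + 2) (φ ∘ₗ D.t j n)).1 := by
    ext1
    refine (D.isBaseChange (n + 2)).algHom_ext _ _ fun x => ?_
    refine Eq.trans ?_ (D.formCocycle_apply Y hY (n + 2) _ x).symm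
    have h1 := D.formCocycle_apply Y hY n φ (D.t j n x)
    rw [← D.op_red] at h1
    exact h1
  congr 1

end CIResolution

/-! ### Ext with values in the residue field as a graded dual -/

section ResidueField

variable {S : Type u} [CommRing S] [IsLocalRing S]

/-- The residue field as a module over a quotient, seen as a module over the local ring. -/
noncomputable def residueFieldQuotEquiv {I : Ideal S} (hI : I ≤ IsLocalRing.maximalIdeal S) :
    IsLocalRing.ResidueField S ≃ₗ[S] residueFieldQuot hI where
  toFun x := x
  invFun x := x
  left_inv _ := rfl
  right_inv _ := rfl
  map_add' _ _ := rfl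
  map_smul' s x := (Algebra.smul_def s x).trans rfl

variable {G : ℕ → Type u} [∀ n, AddCommGroup (G n)] [∀ n, Module S (G n)]

noncomputable instance : Module S (GradedDual S G) :=
  inferInstanceAs (Module S (Π₀ n, G n →ₗ[S] IsLocalRing.ResidueField S))

instance : IsScalarTower S (IsLocalRing.ResidueField S) (GradedDual S G) :=
  IsScalarTower.of_algebraMap_smul fun s x => GradedDual.ext_coeff fun n => by
    rw [map_smul]
    exact algebraMap_smul _ s _

variable {c : ℕ} {f : Fin c → S} (hI : Ideal.span (Set.range f) ≤ IsLocalRing.maximalIdeal S)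
    {M : ModuleCat.{u} (S ⧸ Ideal.span (Set.range f))} (D : CIResolution f M)
    (hY : ∀ n (φ : D.lift n →ₗ[S] residueFieldQuot hI) x, φ (D.del n x) = 0)

/-- The graded module Ext, in terms of a minimal resolution. -/
noncomputable def CIResolution.totalExtEquiv :
    TotalExt M (residueFieldQuot hI) ≃ₗ[S] GradedDual S D.lift :=
  DFinsupp.mapRange.linearEquiv fun n => (D.formEquivExt _ hY n).symm ≪≫ₗ
    (LinearEquiv.refl S (D.lift n)).arrowCongr (residueFieldQuotEquiv hI).symm

theorem CIResolution.totalExtEquiv_of (n : ℕ) (ξ : Abelian.Ext.{u} M (residueFieldQuot hI) n) :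
    D.totalExtEquiv hI hY (TotalExt.of _ _ n ξ) = GradedDual.of n
      ((residueFieldQuotEquiv hI).symm.toLinearMap ∘ₗ (D.formEquivExt _ hY n).symm ξ) :=
  DFinsupp.mapRange_single (hf := fun _ => map_zero _)

theorem CIResolution.totalExtEquiv_ciOperator
    (hf : RingTheory.Sequence.IsWeaklyRegular S (List.ofFn f)) (j : Fin c)
    (x : TotalExt M (residueFieldQuot hI)) :
    D.totalExtEquiv hI hY (D.ciOperator _ hf j x) =
      GradedDual.pull 2 (D.t j) (D.totalExtEquiv hI hY x) := by
  induction x using DirectSum.induction_on with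
  | zero => simp
  | add x y hx hy => rw [map_add, map_add, hx, hy, map_add, map_add]
  | of n ξ =>
    obtain ⟨φ, rfl⟩ := (D.formEquivExt _ hY n).surjective ξ
    have h1 : D.ciOperator _ hf j (TotalExt.of _ _ n (D.formEquivExt _ hY n φ)) =
        TotalExt.of _ _ (n + 2) (D.formEquivExt _ hY (n + 2) (φ ∘ₗ D.t j n)) := by
      rw [← D.extOp_formEquivExt _ hf hY]
      exact DirectSum.toModule_lof S n _
    refine (congrArg _ h1).trans ?_
    refine (D.totalExtEquiv_of hI hY _ _).trans ?_
    rw [LinearEquiv.symm_apply_apply]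
    refine Eq.trans ?_ (congrArg _ (D.totalExtEquiv_of hI hY n _)).symm
    rw [LinearEquiv.symm_apply_apply, GradedDual.pull_of]
    rfl

end ResidueField

/-! ### The decomposition over polynomial rings -/

theorem DFinsupp.basis_apply {K : Type*} [Semiring K] {κ : Type*} [DecidableEq κ] {M : κ → Type*}
    [∀ i, AddCommMonoid (M i)] [∀ i, Module K (M i)] {η : κ → Type*}
    (b : ∀ i, Module.Basis (η i) K (M i)) (x : Σ i, η i) :
    DFinsupp.basis b x = DFinsupp.single x.1 (b x.1 x.2) := by
  apply (DFinsupp.basis b).repr.injective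
  rw [Module.Basis.repr_self]
  simp only [DFinsupp.basis, LinearEquiv.trans_apply, DFinsupp.mapRange.linearEquiv_apply,
    DFinsupp.mapRange_single, Module.Basis.repr_self]
  exact (Equiv.eq_symm_apply _).2 (sigmaFinsuppEquivDFinsupp_single x 1)

namespace GradedDual

variable {S : Type*} [CommRing S] [IsLocalRing S] {G : ℕ → Type*} [∀ n, AddCommGroup (G n)]
  [∀ n, Module S (G n)] {ι : ℕ → Type*}
  (b : ∀ n, Module.Basis (ι n) (IsLocalRing.ResidueField S)
    (G n →ₗ[S] IsLocalRing.ResidueField S))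

theorem mem_of_forall_of_mem (V : Submodule (IsLocalRing.ResidueField S) (GradedDual S G))
    (h : ∀ n φ, of n φ ∈ V) (x : GradedDual S G) : x ∈ V := by
  have h1 : V.mkQ = 0 := linearMap_ext fun n φ => (Submodule.Quotient.mk_eq_zero V).2 (h n φ)
  exact (Submodule.Quotient.mk_eq_zero V).1 (LinearMap.congr_fun h1 x)

/-- Bases of the components give a basis of the graded dual. -/
noncomputable def basis :
    Module.Basis (Σ n, ι n) (IsLocalRing.ResidueField S) (GradedDual S G) :=
  Module.Basis.mk (linearIndependent_of (fun n => b n) fun n => (b n).linearIndependent)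
    fun x _ => by
      refine mem_of_forall_of_mem _ (fun n φ => ?_) x
      have h : Submodule.span _ (Set.range (b n)) ≤ Submodule.comap (of n)
          (Submodule.span _ (Set.range fun x : Σ n, ι n => of x.1 (b x.1 x.2))) := by
        rw [Submodule.span_le]
        rintro _ ⟨i, rfl⟩
        exact Submodule.subset_span ⟨⟨n, i⟩, rfl⟩
      exact h ((b n).mem_span φ)

theorem basis_apply (x : Σ n, ι n) : basis b x = of x.1 (b x.1 x.2) :=
  Module.Basis.mk_apply _ _ x

end GradedDual

/-! ### The space Hom(B(p), k) by degrees -/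

section HomB

variable {S : Type u} [CommRing S] {c : ℕ} {A : Fin 2 → Type u}
  [∀ s, AddCommGroup (A s)] [∀ s, Module S (A s)] (B : ∀ s, Fin c → Submodule S (A s)) (p : Fin c)

/-- The inclusion of `B_0(p)`. -/
noncomputable def layerInclZero : layer B 0 p →ₗ[S] DirectSum (Fin 2) fun s => B s p :=
  DirectSum.lof S (Fin 2) (fun s => B s p) 0

/-- The inclusion of `B_1(p)`. -/
noncomputable def layerInclOne : layer B 1 p →ₗ[S] DirectSum (Fin 2) fun s => B s p :=
  DirectSum.lof S (Fin 2) (fun s => B s p) 1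

variable [IsLocalRing S]

namespace HomB

/-- `Hom(B(p), k)` by degrees. -/
noncomputable def toGradedDual :
    HomB B p →ₗ[IsLocalRing.ResidueField S] GradedDual S fun n => layer B n p :=
  GradedDual.of (G := fun n => layer B n p) 0 ∘ₗ residueFieldPrecomp (layerInclZero B p) +
    GradedDual.of (G := fun n => layer B n p) 1 ∘ₗ residueFieldPrecomp (layerInclOne B p)

theorem toGradedDual_apply (w : HomB B p) :
    toGradedDual B p w = GradedDual.of (G := fun n => layer B n p) 0 (w ∘ₗ layerInclZero B p) +
      GradedDual.of (G := fun n => layer B n p) 1 (w ∘ₗ layerInclOne B p) := rfl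

theorem toGradedDual_injective : Function.Injective (toGradedDual B p) := by
  rw [← LinearMap.ker_eq_bot, LinearMap.ker_eq_bot']
  intro w h
  rw [toGradedDual_apply] at h
  have h0 := congrArg (GradedDual.coeff 0) h
  have h1 := congrArg (GradedDual.coeff 1) h
  rw [map_add, GradedDual.coeff_of_self, GradedDual.coeff_of_ne (by omega), map_zero, add_zero] at h0
  rw [map_add, GradedDual.coeff_of_self, GradedDual.coeff_of_ne (by omega), map_zero, zero_add] at h1
  refine DirectSum.linearMap_ext S fun s => ?_
  fin_cases s
  · exact h0
  · exact h1

/-- Nonvanishing of φ excludes degrees from 2 on, where the layer is 0, so that n can be read as an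
element of `Fin 2`. -/
theorem exists_mem_degree (n : ℕ) (φ : layer B n p →ₗ[S] IsLocalRing.ResidueField S)
    (hφ : φ ≠ 0) : ∃ s : Fin 2, n = s ∧ ∃ w ∈ HomB.degree B p s,
      toGradedDual B p w = GradedDual.of (G := fun n => layer B n p) n φ := by
  match n, φ, hφ with
  | 0, φ, _ =>
    let F : ∀ s : Fin 2, B s p →ₗ[S] IsLocalRing.ResidueField S
      | 0 => φ
      | 1 => 0
    refine ⟨0, rfl, DirectSum.toModule S _ _ F, ?_, ?_⟩
    · intro s hs
      obtain rfl : s = 1 := by omega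
      exact LinearMap.ext fun x => DirectSum.toModule_lof S _ _
    · have h0 : DirectSum.toModule S _ _ F ∘ₗ layerInclZero B p = φ :=
        LinearMap.ext fun x => DirectSum.toModule_lof S _ _
      have h1 : DirectSum.toModule S _ _ F ∘ₗ layerInclOne B p = 0 :=
        LinearMap.ext fun x => DirectSum.toModule_lof S _ _
      rw [toGradedDual_apply, h0, h1, map_zero, add_zero]
  | 1, φ, _ =>
    let F : ∀ s : Fin 2, B s p →ₗ[S] IsLocalRing.ResidueField S
      | 0 => 0
      | 1 => φ
    refine ⟨1, rfl, DirectSum.toModule S _ _ F, ?_, ?_⟩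
    · intro s hs
      obtain rfl : s = 0 := by omega
      exact LinearMap.ext fun x => DirectSum.toModule_lof S _ _
    · have h0 : DirectSum.toModule S _ _ F ∘ₗ layerInclZero B p = 0 :=
        LinearMap.ext fun x => DirectSum.toModule_lof S _ _
      have h1 : DirectSum.toModule S _ _ F ∘ₗ layerInclOne B p = φ :=
        LinearMap.ext fun x => DirectSum.toModule_lof S _ _
      rw [toGradedDual_apply, h0, h1, map_zero, zero_add]
  | n + 2, φ, hφ =>
    exact absurd (LinearMap.ext fun x => by
      rw [Subsingleton.elim x 0, map_zero, map_zero]) hφ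

theorem toGradedDual_surjective : Function.Surjective (toGradedDual B p) := by
  refine fun x => GradedDual.mem_of_forall_of_mem (LinearMap.range (toGradedDual B p)) ?_ x
  intro n φ
  by_cases hφ : φ = 0
  · rw [hφ, map_zero]
    exact zero_mem _
  · obtain ⟨_, _, w, _, h⟩ := exists_mem_degree B p n φ hφ
    exact ⟨w, h⟩

/-- `Hom(B(p), k)` by degrees, as an isomorphism. -/
noncomputable def gradedDualEquiv :
    HomB B p ≃ₗ[IsLocalRing.ResidueField S] GradedDual S fun n => layer B n p :=
  LinearEquiv.ofBijective (toGradedDual B p)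
    ⟨toGradedDual_injective B p, toGradedDual_surjective B p⟩

theorem gradedDualEquiv_apply (w : HomB B p) : gradedDualEquiv B p w = toGradedDual B p w :=
  LinearEquiv.ofBijective_apply _ _

end HomB

end HomB

/-! ### Graded duals as sums over polynomial rings -/

section PolynomialSum

variable {S : Type u} [CommRing S] [IsLocalRing S] {c : ℕ} {A : Fin 2 → Type u}
  [∀ s, AddCommGroup (A s)] [∀ s, Module S (A s)] {B : ∀ s, Fin c → Submodule S (A s)}
  {ι : Fin c → ℕ → Type*}
  {β : ∀ q n, Module.Basis (ι q n) (IsLocalRing.ResidueField S)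
    (layer B n q →ₗ[S] IsLocalRing.ResidueField S)}
  {G : ℕ → Type*} [∀ n, AddCommGroup (G n)] [∀ n, Module S (G n)]
  {T : Fin c → ∀ n, G (n + 2) →ₗ[S] G n} {pr : ∀ n, G n →ₗ[S] ∀ q, layer B n q}

open GradedDual

/-- The action of polynomials on the forms that come from the layers. -/
noncomputable def polynomialSummandMap (hT : PullCommute T)
    (pr : ∀ n, G n →ₗ[S] ∀ q, layer B n q) (p : Fin c) :
    PolynomialSummand B p →ₗ[IsLocalRing.ResidueField S] GradedDual S G :=
  TensorProduct.lift (LinearMap.compl₂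
    ((act hT).toLinearMap ∘ₗ (MvPolynomial.rename Subtype.val).toLinearMap)
    (restrict (fun n => LinearMap.proj p ∘ₗ pr n) ∘ₗ HomB.toGradedDual B p))

theorem polynomialSummandMap_tmul (hT : PullCommute T) (p : Fin c)
    (g : MvPolynomial {i : Fin c // p ≤ i} (IsLocalRing.ResidueField S)) (w : HomB B p) :
    polynomialSummandMap hT pr p (g ⊗ₜ w) = act hT (MvPolynomial.rename Subtype.val g)
      (restrict (fun n => LinearMap.proj p ∘ₗ pr n) (HomB.toGradedDual B p w)) := rfl

theorem polynomialSummandMap_X_smul (hT : PullCommute T) (p : Fin c) (i : {i : Fin c // p ≤ i})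
    (y : PolynomialSummand B p) :
    polynomialSummandMap hT pr p ((MvPolynomial.X i :
      MvPolynomial {i : Fin c // p ≤ i} (IsLocalRing.ResidueField S)) • y) =
    pull 2 (T i) (polynomialSummandMap hT pr p y) := by
  induction y using TensorProduct.induction_on with
  | zero => simp
  | add x y hx hy => rw [smul_add, map_add, map_add, map_add, hx, hy]
  | tmul g w =>
    rw [TensorProduct.smul_tmul', smul_eq_mul, polynomialSummandMap_tmul, polynomialSummandMap_tmul,
      map_mul, map_mul, MvPolynomial.rename_X, polynomialAction_X]
    rfl

/-- The index of a monomial times a basis element of a layer. -/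
noncomputable def layerIndexOf
    (x : Σ p : Fin c, ({i : Fin c // p ≤ i} →₀ ℕ) × Σ n, ι p n) : LayerIndex ι :=
  (x.2.1.mapDomain Subtype.val, ⟨x.1, x.2.2⟩)

theorem layerIndexOf_injective : Function.Injective (layerIndexOf (ι := ι)) := by
  rintro ⟨p, α, ω⟩ ⟨p', α', ω'⟩ h
  simp only [layerIndexOf, Prod.mk.injEq, Sigma.mk.injEq] at h
  obtain ⟨h1, rfl, h2⟩ := h
  obtain rfl := eq_of_heq h2
  rw [Finsupp.mapDomain_injective Subtype.val_injective h1]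

theorem layerIndexOf_mem (x : Σ p : Fin c, ({i : Fin c // p ≤ i} →₀ ℕ) × Σ n, ι p n) :
    layerIndexOf x ∈ layerIndices ι (Fin.last c) := by
  refine ⟨Fin.castSucc_lt_last _, fun i hi => ⟨?_, Fin.castSucc_lt_last _⟩⟩
  obtain ⟨j, -, rfl⟩ := Finset.mem_image.1 (Finsupp.mapDomain_support hi)
  exact j.2

theorem exists_layerIndexOf_eq {θ : LayerIndex ι} (hθ : θ ∈ layerIndices ι (Fin.last c)) :
    ∃ x, layerIndexOf x = θ := by
  obtain ⟨α, p, ω⟩ := θ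
  refine ⟨⟨p, α.comapDomain Subtype.val Subtype.val_injective.injOn, ω⟩, Prod.ext ?_ rfl⟩
  refine Finsupp.mapDomain_comapDomain _ Subtype.val_injective _ fun i hi => ?_
  exact ⟨⟨i, (hθ.2 i hi).1⟩, rfl⟩

theorem polynomialSummandMap_monomial_tmul (hT : PullCommute T)
    (x : Σ p : Fin c, ({i : Fin c // p ≤ i} →₀ ℕ) × Σ n, ι p n) (w : HomB B x.1)
    (hw : HomB.toGradedDual B x.1 w = of (G := fun n => layer B n x.1) x.2.2.1
      (β x.1 x.2.2.1 x.2.2.2)) :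
    polynomialSummandMap hT pr x.1 (MvPolynomial.monomial x.2.1 1 ⊗ₜ w) =
      layerFamily β hT pr (layerIndexOf x) := by
  rw [polynomialSummandMap_tmul, hw, restrict_of, MvPolynomial.rename_monomial]
  rfl

/-- The graded dual of a layered module as a direct sum over polynomial rings. -/
theorem GradedDual.IsLayered.exists_polynomialSum_equiv (hT : IsLayered β T pr (Fin.last c)) :
    ∃ ν : PolynomialSum B ≃ₗ[IsLocalRing.ResidueField S] GradedDual S G,
      (∀ n φ, ν.symm (of n φ) ∈ PolynomialSum.degree B n) ∧
      ∀ (p i : Fin c) (hpi : p ≤ i) (y : PolynomialSummand B p),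
        ν (DirectSum.of (fun p => PolynomialSummand B p) p ((MvPolynomial.X ⟨i, hpi⟩ :
          MvPolynomial {i : Fin c // p ≤ i} (IsLocalRing.ResidueField S)) • y)) =
        pull 2 (T i) (ν (DirectSum.of (fun p => PolynomialSummand B p) p y)) := by
  let b : Module.Basis (Σ p : Fin c, ({i : Fin c // p ≤ i} →₀ ℕ) × Σ n, ι p n)
      (IsLocalRing.ResidueField S) (PolynomialSum B) := DFinsupp.basis fun p =>
    (MvPolynomial.basisMonomials {i : Fin c // p ≤ i} (IsLocalRing.ResidueField S)).tensorProduct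
      ((GradedDual.basis (β p)).map (HomB.gradedDualEquiv B p).symm)
  let ν₀ : PolynomialSum B →ₗ[IsLocalRing.ResidueField S] GradedDual S G :=
    DirectSum.toModule _ _ _ (polynomialSummandMap hT.comm pr)
  have hν₀ : ∀ p y, ν₀ (DirectSum.of (fun p => PolynomialSummand B p) p y) =
      polynomialSummandMap hT.comm pr p y := fun p y => DirectSum.toModule_lof _ _ _
  have hbx : ∀ x, b x = DirectSum.of (fun p => PolynomialSummand B p) x.1
      (MvPolynomial.monomial x.2.1 1 ⊗ₜ (HomB.gradedDualEquiv B x.1).symm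
        (of (G := fun n => layer B n x.1) x.2.2.1 (β x.1 x.2.2.1 x.2.2.2))) := fun x => by
    refine (DFinsupp.basis_apply _ x).trans (congrArg (DFinsupp.single x.1) ?_)
    rw [Module.Basis.tensorProduct_apply, MvPolynomial.coe_basisMonomials, Module.Basis.map_apply,
      basis_apply]
  have hw : ∀ (p : Fin c) (y : GradedDual S fun n => layer B n p),
      HomB.toGradedDual B p ((HomB.gradedDualEquiv B p).symm y) = y := fun p y => by
    rw [← HomB.gradedDualEquiv_apply, LinearEquiv.apply_symm_apply]
  have hb : ∀ x, ν₀ (b x) = layerFamily β hT.comm pr (layerIndexOf x) := fun x => by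
    rw [hbx, hν₀]
    exact polynomialSummandMap_monomial_tmul hT.comm x _ (hw _ _)
  -- At the last stage the upper bound on the variables is void, so the layer indices are exactly
  -- the pairs of a monomial in the χ_i with i ≥ p and a basis form of the layer p.
  let b' : Module.Basis (Σ p : Fin c, ({i : Fin c // p ≤ i} →₀ ℕ) × Σ n, ι p n)
      (IsLocalRing.ResidueField S) (GradedDual S G) := Module.Basis.mk
    (v := fun x => layerFamily β hT.comm pr (layerIndexOf x))
    (LinearIndependent.comp hT.linearIndepOn (fun x => ⟨layerIndexOf x, layerIndexOf_mem x⟩)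
      fun x y h => layerIndexOf_injective (congrArg Subtype.val h))
    fun y _ => by
      refine mem_of_forall_of_mem _ (fun n φ => ?_) y
      refine Submodule.span_mono ?_ (hT.mem_span n φ)
      rintro _ ⟨θ, ⟨hθ, -⟩, rfl⟩
      obtain ⟨x, rfl⟩ := exists_layerIndexOf_eq hθ
      exact ⟨x, rfl⟩
  let ν := b.equiv b' (Equiv.refl _)
  have hν : ∀ y, ν y = ν₀ y := fun y => by
    refine LinearMap.congr_fun (f := ν.toLinearMap) (b.ext fun x => ?_) y
    rw [hb]
    refine (b.equiv_apply x b' (Equiv.refl _)).trans ?_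
    exact Module.Basis.mk_apply _ _ _
  refine ⟨ν, fun n φ => ?_, fun p i hpi y => ?_⟩
  · have h1 : Submodule.span (IsLocalRing.ResidueField S)
        (layerFamily β hT.comm pr '' {θ | θ ∈ layerIndices ι (Fin.last c) ∧ θ.degree = n}) ≤
        (PolynomialSum.degree B n).comap ν.symm.toLinearMap := by
      rw [Submodule.span_le]
      rintro _ ⟨θ, ⟨hθ, rfl⟩, rfl⟩
      obtain ⟨x, rfl⟩ := exists_layerIndexOf_eq hθ
      rw [← hb, ← hν, SetLike.mem_coe, Submodule.mem_comap, LinearEquiv.coe_coe,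
        LinearEquiv.symm_apply_apply, hbx]
      -- A basis form is nonzero, so it lives in degree 0 or 1 and comes from a homogeneous element
      -- of Hom(B(p), k).
      obtain ⟨s, hs, w, hw', e⟩ := HomB.exists_mem_degree B x.1 x.2.2.1 _
        ((β x.1 x.2.2.1).ne_zero x.2.2.2)
      rw [← e, ← HomB.gradedDualEquiv_apply, LinearEquiv.symm_apply_apply]
      refine Submodule.subset_span ⟨x.1, x.2.1.degree, s, ?_, _,
        MvPolynomial.isHomogeneous_monomial _ rfl, w, hw', rfl⟩
      rw [LayerIndex.degree, ← hs]
      simp [layerIndexOf, Finsupp.degree_mapDomain]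
    exact h1 (hT.mem_span n φ)
  · rw [hν, hν, hν₀, hν₀]
    exact polynomialSummandMap_X_smul hT.comm p ⟨i, hpi⟩ y

end PolynomialSum

/-! ### Ext over the complete intersection -/

instance isScalarTower_directSum {S K : Type*} [Semiring S] [Semiring K] [SMul S K] {ι : Type*}
    {M : ι → Type*} [∀ i, AddCommMonoid (M i)] [∀ i, Module S (M i)] [∀ i, Module K (M i)]
    [∀ i, IsScalarTower S K (M i)] : IsScalarTower S K (DirectSum ι M) :=
  ⟨fun s a x => DFinsupp.ext fun i => smul_assoc s a (x i)⟩

namespace HigherMatrixFactorization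

variable {S : Type u} [CommRing S] {c : ℕ} {f : Fin c → S}
    {A : Fin 2 → Type u} [∀ s, AddCommGroup (A s)] [∀ s, Module S (A s)]
    [∀ s, Module.Free S (A s)] [∀ s, Module.Finite S (A s)]
    (H : HigherMatrixFactorization f A)

/-- The projection to the module of the higher matrix factorization. -/
noncomputable def cokerMap :
    A 0 →ₗ[S] ModuleCat.of (S ⧸ Ideal.span (Set.range f)) H.coker where
  toFun x := (LinearMap.range (H.d.baseChange (S ⧸ Ideal.span (Set.range f)))).mkQ (1 ⊗ₜ x)
  map_add' x y := by rw [tmul_add, map_add]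
  map_smul' s x := by
    rw [tmul_smul, ← algebraMap_smul (S ⧸ Ideal.span (Set.range f)), map_smul]
    rfl

theorem cokerMap_surjective : Function.Surjective H.cokerMap := fun y => by
  obtain ⟨z, rfl⟩ := Submodule.mkQ_surjective _ y
  obtain ⟨x, rfl⟩ := (TensorProduct.isBaseChange S (A 0)
    (S ⧸ Ideal.span (Set.range f))).surjective_quotient z
  exact ⟨x, rfl⟩

theorem cokerMap_eq_zero_iff (x : A 0) : H.cokerMap x = 0 ↔
    ∃ y, H.d y - x ∈ (Ideal.span (Set.range f) • ⊤ : Submodule S (A 0)) := by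
  refine (Submodule.Quotient.mk_eq_zero _).trans ?_
  rw [LinearMap.mem_range]
  constructor
  · rintro ⟨z, hz⟩
    obtain ⟨y, rfl⟩ := (TensorProduct.isBaseChange S (A 1)
      (S ⧸ Ideal.span (Set.range f))).surjective_quotient z
    refine ⟨y, ((TensorProduct.isBaseChange S (A 0)
      (S ⧸ Ideal.span (Set.range f))).eq_zero_iff_quotient _).1 ?_⟩
    rw [map_sub, sub_eq_zero]
    exact hz
  · rintro ⟨y, hy⟩
    refine ⟨1 ⊗ₜ y, ?_⟩
    rw [← (TensorProduct.isBaseChange S (A 0)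
      (S ⧸ Ideal.span (Set.range f))).eq_zero_iff_quotient, map_sub, sub_eq_zero] at hy
    exact hy

variable [IsLocalRing S] [IsNoetherianRing S] {H}

theorem nonempty_minimalResolution (hf : RingTheory.Sequence.IsRegular S (List.ofFn f))
    (hH : H.IsMinimal) {B : ∀ s, Fin c → Submodule S (A s)} (hB : H.IsSplitting B)
    {ι : Fin c → ℕ → Type*} (β : ∀ q n, Module.Basis (ι q n) (IsLocalRing.ResidueField S)
      (layer B n q →ₗ[S] IsLocalRing.ResidueField S)) (p : Fin (c + 1)) :
    Nonempty (H.MinimalResolution B β p) := by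
  induction p using Fin.induction with
  | zero => exact H.nonempty_minimalResolution_zero B β
  | succ p ih => exact ih.elim fun P => P.nonempty_succ hf hH hB

/-- The isomorphism is constructed from the data D₀ of one minimal resolution, where CI operators
are composition with the T_j on forms. Any other data D has the same operators by `ciOperator_eq`,
so the isomorphism serves all D. -/
theorem exists_totalExt_equiv_polynomialSum
    (hf : RingTheory.Sequence.IsRegular S (List.ofFn f)) (hH : H.IsMinimal)
    {B : ∀ s, Fin c → Submodule S (A s)} (hB : H.IsSplitting B) :
    ∃ Φ : TotalExt (ModuleCat.of (S ⧸ Ideal.span (Set.range f)) H.coker)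
          (residueFieldQuot (span_range_le_maximalIdeal f hf)) ≃ₗ[S] PolynomialSum B,
      (∀ n ξ, Φ (TotalExt.of _ _ n ξ) ∈ PolynomialSum.degree B n) ∧
      ∀ (D : CIResolution f (ModuleCat.of (S ⧸ Ideal.span (Set.range f)) H.coker))
        (p i : Fin c) (hpi : p ≤ i) (y : PolynomialSummand B p),
        Φ (D.ciOperator (residueFieldQuot (span_range_le_maximalIdeal f hf))
            hf.toIsWeaklyRegular i
            (Φ.symm (DirectSum.of (fun p => PolynomialSummand B p) p y))) =
          DirectSum.of (fun p => PolynomialSummand B p) p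
            ((MvPolynomial.X ⟨i, hpi⟩ :
              MvPolynomial {i : Fin c // p ≤ i} (IsLocalRing.ResidueField S)) • y) := by
  obtain ⟨P⟩ := nonempty_minimalResolution hf hH hB (fun q n => Module.Basis.ofVectorSpace
    (IsLocalRing.ResidueField S) (layer B n q →ₗ[S] IsLocalRing.ResidueField S)) (Fin.last c)
  let e₀ : P.G 0 ≃ₗ[S] A 0 := P.e₀.trans (LinearEquiv.ofTop _ (H.fil_last 0))
  let e₁ : P.G 1 ≃ₗ[S] A 1 := P.e₁.trans (LinearEquiv.ofTop _ (H.fil_last 1))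
  have he : ∀ x, e₀ (P.del 0 x) = H.d (e₁ x) := fun x => congrArg Subtype.val (P.e_del x)
  obtain ⟨res, red, hbc, hred⟩ := CIResolution.exists_of_exact
    (M := ModuleCat.of (S ⧸ Ideal.span (Set.range f)) H.coker) P.G P.del P.T
    P.isMinimalLifting.del_del (by rw [← stageIdeal_last]; exact P.exact)
    (H.cokerMap ∘ₗ e₀.toLinearMap) (H.cokerMap_surjective.comp e₀.surjective)
    (fun x => (H.cokerMap_eq_zero_iff _).2 ⟨e₁ x, by
      rw [← he]
      convert Submodule.zero_mem _
      exact sub_self _⟩)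
    (fun x hx => by
      obtain ⟨y, hy⟩ := (H.cokerMap_eq_zero_iff _).1 hx
      refine ⟨e₁.symm y, ?_⟩
      have h1 := LinearMap.apply_mem_smul_top _ e₀.symm.toLinearMap hy
      have h2 : e₀.symm (H.d y) = P.del 0 (e₁.symm y) := by
        rw [LinearEquiv.symm_apply_eq, he, LinearEquiv.apply_symm_apply]
      rw [map_sub] at h1
      simpa [h2] using h1)
  let D₀ : CIResolution f (ModuleCat.of (S ⧸ Ideal.span (Set.range f)) H.coker) :=
    { res := res
      lift := P.G
      red := red
      isBaseChange := hbc
      del := P.del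
      red_del := hred
      t := P.T
      del_del := P.isMinimalLifting.del_del }
  let hI := span_range_le_maximalIdeal f hf
  have hY : ∀ n (φ : D₀.lift n →ₗ[S] residueFieldQuot hI) x, φ (D₀.del n x) = 0 :=
    fun n φ x => P.isMinimalLifting.minimal n
      ((residueFieldQuotEquiv hI).symm.toLinearMap ∘ₗ φ) x
  obtain ⟨ν, hν, hνX⟩ := P.isLayered.exists_polynomialSum_equiv
  refine ⟨D₀.totalExtEquiv hI hY ≪≫ₗ (ν.restrictScalars S).symm, fun n ξ => ?_,
    fun D p i hpi y => ?_⟩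
  · rw [LinearEquiv.trans_apply, D₀.totalExtEquiv_of]
    exact hν n _
  · rw [D.ciOperator_eq D₀, LinearEquiv.trans_apply, D₀.totalExtEquiv_ciOperator,
      LinearEquiv.symm_apply_eq]
    refine Eq.trans ?_ (hνX p i hpi y).symm
    refine congrArg _ ?_
    exact LinearEquiv.apply_symm_apply _ _

end HigherMatrixFactorization

/-! ### Lengths of Ext modules -/

section ExtLength

variable {S : Type u} [CommRing S] (Y : ModuleCat.{u} S)
  {X X₁ X₂ X₃ : Type u} [AddCommGroup X] [Module S X] [AddCommGroup X₁] [Module S X₁]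
  [AddCommGroup X₂] [Module S X₂] [AddCommGroup X₃] [Module S X₃]

/-- The length of `Ext^n(X, Y)`. -/
noncomputable def extLength (X : Type u) [AddCommGroup X] [Module S X] (n : ℕ) : ℕ∞ :=
  Module.length S (Abelian.Ext.{u} (ModuleCat.of S X) Y n)

/-- The map `Ext^n(X₂, Y) → Ext^n(X₁, Y)` induced by `g : X₁ → X₂`. -/
noncomputable def extMap (g : X₁ →ₗ[S] X₂) (n : ℕ) :
    Abelian.Ext.{u} (ModuleCat.of S X₂) Y n →ₗ[S] Abelian.Ext.{u} (ModuleCat.of S X₁) Y n :=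
  (Abelian.Ext.mk₀ (ModuleCat.ofHom g)).precompOfLinear S Y (zero_add n)

theorem extMap_apply (g : X₁ →ₗ[S] X₂) (n : ℕ)
    (x : Abelian.Ext.{u} (ModuleCat.of S X₂) Y n) :
    extMap Y g n x = (Abelian.Ext.mk₀ (ModuleCat.ofHom g)).comp x (zero_add n) := rfl

theorem extMap_id (n : ℕ) : extMap Y (LinearMap.id (R := S) (M := X)) n = LinearMap.id :=
  LinearMap.ext fun x => Abelian.Ext.mk₀_id_comp x

theorem extMap_comp (g : X₂ →ₗ[S] X₃) (e : X₁ →ₗ[S] X₂) (n : ℕ) :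
    extMap Y (g ∘ₗ e) n = extMap Y e n ∘ₗ extMap Y g n :=
  LinearMap.ext fun x => (Abelian.Ext.mk₀_comp_mk₀_assoc (ModuleCat.ofHom e) (ModuleCat.ofHom g)
    x).symm

theorem extMap_add (g e : X₁ →ₗ[S] X₂) (n : ℕ) :
    extMap Y (g + e) n = extMap Y g n + extMap Y e n :=
  LinearMap.ext fun x => by
    rw [LinearMap.add_apply, extMap_apply, extMap_apply, extMap_apply, ModuleCat.ofHom_add,
      Abelian.Ext.mk₀_add, Abelian.Ext.add_comp]

theorem extMap_smul (a : S) (g : X₁ →ₗ[S] X₂) (n : ℕ) :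
    extMap Y (a • g) n = a • extMap Y g n :=
  LinearMap.ext fun x => by
    rw [LinearMap.smul_apply, extMap_apply, extMap_apply, ← Abelian.Ext.smul_comp,
      ← Abelian.Ext.mk₀_smul]
    rfl

theorem extMap_zero (n : ℕ) : extMap Y (0 : X₁ →ₗ[S] X₂) n = 0 := by
  have h := extMap_smul Y (0 : S) (0 : X₁ →ₗ[S] X₂) n
  rwa [zero_smul, zero_smul] at h

theorem extMap_sum {κ : Type*} (s : Finset κ) (g : κ → X₁ →ₗ[S] X₂) (n : ℕ) :
    extMap Y (∑ i ∈ s, g i) n = ∑ i ∈ s, extMap Y (g i) n := by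
  classical
  induction s using Finset.induction_on with
  | empty => exact extMap_zero Y n
  | insert i s hi ih => rw [Finset.sum_insert hi, Finset.sum_insert hi, extMap_add, ih]

/-- Isomorphic modules have isomorphic Ext modules. -/
noncomputable def extEquiv (e : X₁ ≃ₗ[S] X₂) (n : ℕ) :
    Abelian.Ext.{u} (ModuleCat.of S X₂) Y n ≃ₗ[S] Abelian.Ext.{u} (ModuleCat.of S X₁) Y n :=
  LinearEquiv.ofLinearMap (extMap Y e.toLinearMap n) (extMap Y e.symm.toLinearMap n)
    (by rw [← extMap_comp, LinearEquiv.symm_comp, extMap_id])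
    (by rw [← extMap_comp, LinearEquiv.comp_symm, extMap_id])

theorem extLength_eq_of_equiv (e : X₁ ≃ₗ[S] X₂) (n : ℕ) : extLength Y X₁ n = extLength Y X₂ n :=
  (extEquiv Y e n).symm.length_eq

theorem extLength_eq_zero_of_subsingleton [Subsingleton X] (n : ℕ) : extLength Y X n = 0 := by
  refine Module.length_eq_zero_iff.2 ⟨fun x y => ?_⟩
  have h : extMap Y (LinearMap.id (R := S) (M := X)) n = 0 := by
    rw [Subsingleton.elim (LinearMap.id (R := S) (M := X)) 0, extMap_zero]
  rw [extMap_id] at h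
  exact (LinearMap.congr_fun h x).trans (LinearMap.congr_fun h y).symm

theorem extLength_prod (n : ℕ) :
    extLength Y (X₁ × X₂) n = extLength Y X₁ n + extLength Y X₂ n := by
  refine Module.length_eq_add_of_exact (extMap Y (LinearMap.fst S X₁ X₂) n)
    (extMap Y (LinearMap.inr S X₁ X₂) n) ?_ ?_ ?_
  · refine Function.LeftInverse.injective (g := extMap Y (LinearMap.inl S X₁ X₂) n) fun x => ?_
    rw [← LinearMap.comp_apply, ← extMap_comp, LinearMap.fst_comp_inl, extMap_id,
      LinearMap.id_apply]
  · refine Function.RightInverse.surjective (g := extMap Y (LinearMap.snd S X₁ X₂) n) fun x => ?_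
    rw [← LinearMap.comp_apply, ← extMap_comp, LinearMap.snd_comp_inr, extMap_id,
      LinearMap.id_apply]
  · refine fun x => ⟨fun h => ⟨extMap Y (LinearMap.inl S X₁ X₂) n x, ?_⟩, ?_⟩
    · have e : (LinearMap.inl S X₁ X₂ ∘ₗ LinearMap.fst S X₁ X₂ +
          LinearMap.inr S X₁ X₂ ∘ₗ LinearMap.snd S X₁ X₂ : X₁ × X₂ →ₗ[S] X₁ × X₂) =
          LinearMap.id := by
        ext <;> simp
      have e' := LinearMap.congr_fun (extMap_id (X := X₁ × X₂) Y n) x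
      rw [← e, extMap_add, extMap_comp, extMap_comp, LinearMap.add_apply, LinearMap.comp_apply,
        LinearMap.comp_apply, h, map_zero, add_zero] at e'
      exact e'
    · rintro ⟨y, rfl⟩
      rw [← LinearMap.comp_apply, ← extMap_comp, LinearMap.fst_comp_inr, extMap_zero,
        LinearMap.zero_apply]

variable {g : X₁ →ₗ[S] X₂} {e : X₂ →ₗ[S] X₃}

/-- A short exact sequence of modules. -/
abbrev shortComplexOfExact (g : X₁ →ₗ[S] X₂) (e : X₂ →ₗ[S] X₃) (hex : Function.Exact g e) :
    ShortComplex (ModuleCat.{u} S) :=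
  ShortComplex.mk (ModuleCat.ofHom g) (ModuleCat.ofHom e) (by
    ext x
    exact (hex _).2 ⟨x, rfl⟩)

theorem shortExact_of_exact (hg : Function.Injective g) (he : Function.Surjective e)
    (hex : Function.Exact g e) : (shortComplexOfExact g e hex).ShortExact where
  exact := (ShortComplex.ShortExact.moduleCat_exact_iff_function_exact _).2 hex
  mono_f := (ModuleCat.mono_iff_injective _).2 hg
  epi_g := (ModuleCat.epi_iff_surjective _).2 he

theorem extLength_zero_of_exact (hg : Function.Injective g) (he : Function.Surjective e)
    (hex : Function.Exact g e) (h : extMap Y g 0 = 0) :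
    extLength Y X₃ 0 = extLength Y X₂ 0 := by
  have hT := shortExact_of_exact hg he hex
  have := hT.epi_g
  exact (LinearEquiv.ofBijective (extMap Y e 0)
    ⟨Abelian.Ext.precomp_mk₀_injective_of_epi Y (ModuleCat.ofHom e), fun x =>
      Abelian.Ext.contravariant_sequence_exact₂ hT Y x (LinearMap.congr_fun h x)⟩).length_eq

/-- As `g` induces 0 on Ext, the long exact sequence breaks into 0 → Ext^n(X₁) → Ext^{n+1}(X₃) →
Ext^{n+1}(X₂) → 0. -/
theorem extLength_succ_of_exact (hg : Function.Injective g) (he : Function.Surjective e)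
    (hex : Function.Exact g e) (h : ∀ n, extMap Y g n = 0) (n : ℕ) :
    extLength Y X₃ (n + 1) = extLength Y X₁ n + extLength Y X₂ (n + 1) := by
  have hT := shortExact_of_exact hg he hex
  refine Module.length_eq_add_of_exact (hT.extClass.precompOfLinear S Y (add_comm 1 n))
    (extMap Y e (n + 1)) ?_ ?_ ?_
  · rw [← LinearMap.ker_eq_bot, LinearMap.ker_eq_bot']
    intro x hx
    obtain ⟨y, rfl⟩ := Abelian.Ext.contravariant_sequence_exact₁ hT Y x (add_comm 1 n) hx
    exact LinearMap.congr_fun (h n) y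
  · intro x
    exact Abelian.Ext.contravariant_sequence_exact₂ hT Y x (LinearMap.congr_fun (h (n + 1)) x)
  · intro x
    refine ⟨fun hx => Abelian.Ext.contravariant_sequence_exact₃ hT Y x hx (add_comm 1 n), ?_⟩
    rintro ⟨y, rfl⟩
    exact hT.comp_extClass_assoc y (add_comm 1 n)

end ExtLength

/-! ### Ext over S with values in the residue field -/

section ResidueField

variable {S : Type u} [CommRing S] [IsLocalRing S]

/-- Multiplication by a on Ext is induced by multiplication by a on the residue field, which is 0.
-/
theorem maximalIdeal_smul_ext_eq_zero {X : ModuleCat.{u} S} {n : ℕ} {a : S}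
    (ha : a ∈ IsLocalRing.maximalIdeal S)
    (x : Abelian.Ext.{u} X (ModuleCat.of S (IsLocalRing.ResidueField S)) n) : a • x = 0 := by
  rw [Abelian.Ext.smul_eq_comp_mk₀]
  have h : a • 𝟙 (ModuleCat.of S (IsLocalRing.ResidueField S)) = 0 := by
    ext x
    exact LinearMap.residueField_apply_eq_zero (N := IsLocalRing.ResidueField S) le_rfl
      LinearMap.id (Submodule.smul_mem_smul ha Submodule.mem_top)
  rw [h, Abelian.Ext.mk₀_zero, Abelian.Ext.comp_zero]

variable {F Q : Type u} [AddCommGroup F] [Module S F] [Module.Free S F] [AddCommGroup Q]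
  [Module S Q]

/-- A map from a free module over `S / J` to an `S / J`-module, with image in `𝔪 Q`, induces `0`
on `Ext(-, k)`. -/
theorem extMap_eq_zero [IsNoetherianRing S] {J : Ideal S} (hQ : ∀ a ∈ J, ∀ x : Q, a • x = 0)
    (g : (F ⧸ (J • ⊤ : Submodule S F)) →ₗ[S] Q)
    (hg : ∀ x, g x ∈ (IsLocalRing.maximalIdeal S • ⊤ : Submodule S Q)) (n : ℕ) :
    extMap (ModuleCat.of S (IsLocalRing.ResidueField S)) g n = 0 := by
  obtain ⟨r, a, ha⟩ := Submodule.fg_iff_exists_fin_generating_family.1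
    (IsNoetherian.noetherian (IsLocalRing.maximalIdeal S))
  have ha' : Ideal.span (a '' Set.univ) = IsLocalRing.maximalIdeal S := by
    rw [Set.image_univ]
    exact ha
  obtain ⟨t, -, ht⟩ := LinearMap.exists_sum_smul_of_forall_mem a Set.univ
    (g ∘ₗ Submodule.mkQ _) (fun x => by
      rw [ha']
      exact hg _)
  -- Write g = ∑ a_j t_j on F, for generators a_j of the maximal ideal. As J kills Q, each t_j
  -- descends to F/JF, and the factors a_j then kill the induced maps on Ext.
  have htJ : ∀ j, (J • ⊤ : Submodule S F) ≤ LinearMap.ker (t j) := fun j =>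
    Submodule.smul_le.2 fun s hs x _ => by
      rw [LinearMap.mem_ker, map_smul]
      exact hQ s hs _
  have e : g = ∑ j, a j • Submodule.liftQ _ (t j) (htJ j) := by
    refine Submodule.linearMap_qext _ (LinearMap.ext fun x => (ht x).trans ?_)
    rw [LinearMap.comp_apply, LinearMap.sum_apply]
    exact Finset.sum_congr rfl fun j _ => rfl
  rw [e, extMap_sum]
  refine Finset.sum_eq_zero fun j _ => ?_
  rw [extMap_smul]
  refine LinearMap.ext fun x => maximalIdeal_smul_ext_eq_zero ?_ _
  rw [← ha]
  exact Submodule.subset_span ⟨j, rfl⟩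

/-- The factor `Nat.choose 0 n`, which is 1 for n = 0 and 0 otherwise, is the case of no elements in
the Koszul formula. -/
theorem extLength_of_free [Module.Finite S F] (n : ℕ) :
    extLength (ModuleCat.of S (IsLocalRing.ResidueField S)) F n =
      ((Module.finrank S F * Nat.choose 0 n : ℕ) : ℕ∞) := by
  have : Projective (ModuleCat.of S F) :=
    ModuleCat.projective_of_free (Module.Free.chooseBasis S F)
  match n with
  | 0 =>
    let b := Module.Free.chooseBasis S F
    let e : Abelian.Ext.{u} (ModuleCat.of S F) (ModuleCat.of S (IsLocalRing.ResidueField S)) 0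
        ≃ₗ[S] (Module.Free.ChooseBasisIndex S F → IsLocalRing.ResidueField S) :=
      Abelian.Ext.linearEquiv₀ ≪≫ₗ ModuleCat.homLinearEquiv ≪≫ₗ (b.constr S).symm
    refine e.length_eq.trans ?_
    rw [Module.length_pi, Module.length_eq_of_surjective (R := IsLocalRing.ResidueField S)
      IsLocalRing.residue_surjective, Module.length_eq_one, Module.finrank_eq_card_chooseBasisIndex]
    simp
  | n + 1 =>
    refine (Module.length_eq_zero_iff.2 ⟨fun x y => ?_⟩).trans (by simp)
    rw [Abelian.Ext.eq_zero_of_projective x, Abelian.Ext.eq_zero_of_projective y]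

end ResidueField

/-! ### Ext over the ambient ring -/

theorem smul_quotient_smul_top_eq_zero {S : Type*} [CommRing S] {M : Type*} [AddCommGroup M] [Module S M] {J : Ideal S}
    {N : Submodule S M} (hN : (J • ⊤ : Submodule S M) ≤ N) (a : S) (ha : a ∈ J) (x : M ⧸ N) :
    a • x = 0 := by
  obtain ⟨y, rfl⟩ := N.mkQ_surjective x
  rw [← map_smul]
  exact (Submodule.Quotient.mk_eq_zero _).2 (hN (Submodule.smul_mem_smul ha Submodule.mem_top))

section StageIdeal

variable {S : Type u} [CommRing S] [IsLocalRing S] [IsNoetherianRing S] {c : ℕ} {f : Fin c → S}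
  (F : Type u) [AddCommGroup F] [Module S F] [Module.Free S F] [Module.Finite S F]

/-- The Ext modules of `F / (f_1, …, f_p) F`, by the Koszul resolution. -/
theorem extLength_quotient_stageIdeal (hf : RingTheory.Sequence.IsRegular S (List.ofFn f))
    (p : Fin (c + 1)) (n : ℕ) :
    extLength (ModuleCat.of S (IsLocalRing.ResidueField S))
      (F ⧸ (stageIdeal f p • ⊤ : Submodule S F)) n =
      ((Module.finrank S F * Nat.choose p n : ℕ) : ℕ∞) := by
  induction p using Fin.induction generalizing n with
  | zero =>
    have h : (stageIdeal f 0 • ⊤ : Submodule S F) = ⊥ := by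
      have : stageIdeal f 0 = ⊥ := by
        rw [stageIdeal, Ideal.span_eq_bot]
        rintro _ ⟨q, hq, rfl⟩
        exact absurd hq (Fin.not_lt_zero _)
      rw [this, Submodule.bot_smul]
    exact (extLength_eq_of_equiv _ (Submodule.quotEquivOfEqBot _ h) n).trans (extLength_of_free n)
  | succ p ih =>
    have hle : (stageIdeal f p.castSucc • ⊤ : Submodule S F) ≤ stageIdeal f p.succ • ⊤ := by
      rw [stageIdeal_succ, stageIdeal_castSucc]
      exact Submodule.smul_mono_left le_sup_left
    -- Multiplication by f_p is injective on F/I_{p-1}F with cokernel F/I_pF, and induces 0 on Ext.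
    -- The resulting recursion for the lengths is Pascal's rule.
    let g : (F ⧸ (stageIdeal f p.castSucc • ⊤ : Submodule S F)) →ₗ[S]
      (F ⧸ (stageIdeal f p.castSucc • ⊤ : Submodule S F)) := f p • LinearMap.id
    let e := Submodule.factor hle
    have hg : Function.Injective g := by
      rw [← LinearMap.ker_eq_bot, LinearMap.ker_eq_bot']
      intro x hx
      obtain ⟨y, rfl⟩ := Submodule.mkQ_surjective _ x
      refine (Submodule.Quotient.mk_eq_zero _).2 ?_
      refine mem_smul_top_of_smul_mem _ (f p) (fun a ha => ?_)
        ((Submodule.Quotient.mk_eq_zero _).1 hx)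
      rw [stageIdeal_castSucc] at ha ⊢
      exact HigherMatrixFactorization.prevIdeal_regular hf p a ha
    have he : Function.Surjective e := Submodule.factor_surjective hle
    have hex : Function.Exact g e := by
      intro x
      obtain ⟨y, rfl⟩ := Submodule.mkQ_surjective _ x
      constructor
      · intro h
        have h1 : y ∈ (stageIdeal f p.succ • ⊤ : Submodule S F) :=
          (Submodule.Quotient.mk_eq_zero _).1 h
        rw [stageIdeal_succ, ← stageIdeal_castSucc] at h1
        obtain ⟨w, hw⟩ := exists_sub_smul_mem_of_mem_sup_span_singleton_smul _ _ h1
        exact ⟨Submodule.mkQ _ w, ((Submodule.Quotient.eq _).2 hw).symm⟩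
      · rintro ⟨z, hz⟩
        obtain ⟨w, rfl⟩ := Submodule.mkQ_surjective _ z
        rw [← hz]
        refine (Submodule.Quotient.mk_eq_zero _).2 ?_
        rw [stageIdeal_succ]
        exact smul_mem_sup_span_singleton_smul _ _ w
    have h0 : ∀ n, extMap (ModuleCat.of S (IsLocalRing.ResidueField S)) g n = 0 :=
      extMap_eq_zero (smul_quotient_smul_top_eq_zero le_rfl) g fun x =>
        Submodule.smul_mem_smul (span_range_le_maximalIdeal f hf (Ideal.subset_span ⟨p, rfl⟩))
          Submodule.mem_top
    match n with
    | 0 =>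
      rw [extLength_zero_of_exact _ hg he hex (h0 0), ih]
      simp
    | n + 1 =>
      rw [extLength_succ_of_exact _ hg he hex h0, ih, ih, Fin.val_succ, Nat.choose_succ_succ,
        Fin.val_castSucc, mul_add, Nat.cast_add]

end StageIdeal

/-! ### The stages M(p) as modules over S -/

namespace HigherMatrixFactorization

variable {S : Type u} [CommRing S] {c : ℕ} {f : Fin c → S}
    {A : Fin 2 → Type u} [∀ s, AddCommGroup (A s)] [∀ s, Module S (A s)]
    [∀ s, Module.Free S (A s)] [∀ s, Module.Finite S (A s)]
    (H : HigherMatrixFactorization f A)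

/-- The submodule `d(A_1(p)) + (f_1, …, f_p) A_0(p)` of `A_0(p)`. -/
def stageRange (p : Fin (c + 1)) : Submodule S (H.fil 0 p) :=
  LinearMap.range (H.d.restrict (H.d_mem p)) ⊔ stageIdeal f p • ⊤

theorem mem_stageRange_iff (p : Fin (c + 1)) (x : H.fil 0 p) : x ∈ H.stageRange p ↔
    ∃ y, x - H.d.restrict (H.d_mem p) y ∈ (stageIdeal f p • ⊤ : Submodule S (H.fil 0 p)) := by
  rw [stageRange, Submodule.mem_sup]
  constructor
  · rintro ⟨_, ⟨y, rfl⟩, z, hz, rfl⟩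
    exact ⟨y, by simpa using hz⟩
  · rintro ⟨y, hy⟩
    exact ⟨_, ⟨y, rfl⟩, _, hy, add_sub_cancel _ _⟩

/-- The module of the `p`-th stage of a higher matrix factorization. -/
abbrev StageCoker (p : Fin (c + 1)) : Type u := H.fil 0 p ⧸ H.stageRange p

/-- As an `S`-module, the module of a higher matrix factorization is its last stage. -/
theorem nonempty_stageCoker_last_equiv : Nonempty (H.StageCoker (Fin.last c) ≃ₗ[S] H.coker) := by
  let g : H.fil 0 (Fin.last c) →ₗ[S] H.coker := H.cokerMap ∘ₗ (H.fil 0 (Fin.last c)).subtype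
  have hg : Function.Surjective g := fun y => by
    obtain ⟨x, rfl⟩ := H.cokerMap_surjective y
    exact ⟨⟨x, by rw [H.fil_last]; exact Submodule.mem_top⟩, rfl⟩
  have hk : H.stageRange (Fin.last c) = LinearMap.ker g := by
    ext x
    rw [LinearMap.mem_ker, mem_stageRange_iff, stageIdeal_last]
    refine Iff.trans ?_ (H.cokerMap_eq_zero_iff (x : A 0)).symm
    constructor
    · rintro ⟨y, hy⟩
      have h := LinearMap.apply_mem_smul_top _ (H.fil 0 (Fin.last c)).subtype hy
      refine ⟨y, ?_⟩
      rw [← neg_sub]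
      exact neg_mem h
    · rintro ⟨y, hy⟩
      refine ⟨⟨y, by rw [H.fil_last]; exact Submodule.mem_top⟩, ?_⟩
      have h := LinearMap.apply_mem_smul_top _ (LinearMap.codRestrict (H.fil 0 (Fin.last c))
        LinearMap.id fun x => by rw [H.fil_last]; exact Submodule.mem_top) hy
      rw [← neg_sub]
      exact neg_mem h
  exact ⟨Submodule.quotEquivOfEq _ _ hk ≪≫ₗ g.quotKerEquivOfSurjective hg⟩

variable {H} {B : ∀ s, Fin c → Submodule S (A s)} (hB : H.IsSplitting B) (p : Fin c)

/-- The reduction of `A_0(p) = A_0(p-1) ⊕ B_0(p)` to `M(p-1) ⊕ B_0(p) / (f_1, …, f_{p-1})`. -/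
noncomputable def IsSplitting.reduction : H.fil 0 p.succ →ₗ[S]
    H.StageCoker p.castSucc × (B 0 p ⧸ (stageIdeal f p.castSucc • ⊤ : Submodule S (B 0 p))) :=
  ((H.stageRange p.castSucc).mkQ.prodMap (Submodule.mkQ _)) ∘ₗ (hB.equiv 0 p).symm.toLinearMap

theorem IsSplitting.reduction_surjective : Function.Surjective (hB.reduction p) :=
  (Prod.map_surjective.2 ⟨Submodule.mkQ_surjective _, Submodule.mkQ_surjective _⟩).comp
    (hB.equiv 0 p).symm.surjective

/-- Since d preserves the filtrations, the elements of A_1(p-1) have images with component 0 in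
B_0(p). So the kernel is d(A_1(p-1)) + I_{p-1} A_0(p). -/
theorem IsSplitting.reduction_eq_zero_iff (x : H.fil 0 p.succ) : hB.reduction p x = 0 ↔
    ∃ y : H.fil 1 p.castSucc, x - H.d.restrict (H.d_mem p.succ) (hB.equiv 1 p (y, 0)) ∈
      (stageIdeal f p.castSucc • ⊤ : Submodule S (H.fil 0 p.succ)) := by
  have hd : ∀ y : H.fil 1 p.castSucc, (hB.equiv 0 p).symm
      (H.d.restrict (H.d_mem p.succ) (hB.equiv 1 p (y, 0))) =
      (H.d.restrict (H.d_mem p.castSucc) y, 0) := fun y => by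
    rw [LinearEquiv.symm_apply_eq]
    refine Subtype.ext ?_
    rw [coe_equiv, LinearMap.coe_restrict_apply, coe_equiv, LinearMap.coe_restrict_apply]
    simp
  refine Prod.ext_iff.trans ((and_congr ((Submodule.Quotient.mk_eq_zero _).trans
    (H.mem_stageRange_iff _ _)) (Submodule.Quotient.mk_eq_zero _)).trans ?_)
  constructor
  · rintro ⟨⟨y, hy⟩, h⟩
    refine ⟨y, ?_⟩
    have h1 : (hB.equiv 0 p).symm
        (x - H.d.restrict (H.d_mem p.succ) (hB.equiv 1 p (y, 0))) ∈
        (stageIdeal f p.castSucc • ⊤ : Submodule S (H.fil 0 p.castSucc × B 0 p)) := by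
      rw [prod_mem_smul_top_iff, map_sub, hd]
      refine ⟨hy, ?_⟩
      rw [Prod.snd_sub, sub_zero]
      exact h
    have h2 := LinearMap.apply_mem_smul_top _ (hB.equiv 0 p).toLinearMap h1
    rwa [LinearEquiv.coe_coe, LinearEquiv.apply_symm_apply] at h2
  · rintro ⟨y, hy⟩
    have h1 := LinearMap.apply_mem_smul_top _ (hB.equiv 0 p).symm.toLinearMap hy
    rw [LinearEquiv.coe_coe, map_sub, hd, prod_mem_smul_top_iff, Prod.snd_sub, sub_zero] at h1
    exact ⟨⟨y, h1.1⟩, h1.2⟩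

/-- The map from `B_1(p) / (f_1, …, f_{p-1})` induced by `d`. -/
noncomputable def IsSplitting.reductionMap :
    (B 1 p ⧸ (stageIdeal f p.castSucc • ⊤ : Submodule S (B 1 p))) →ₗ[S]
    H.StageCoker p.castSucc × (B 0 p ⧸ (stageIdeal f p.castSucc • ⊤ : Submodule S (B 0 p))) :=
  Submodule.liftQ _ (hB.reduction p ∘ₗ H.d.restrict (H.d_mem p.succ) ∘ₗ
    (hB.equiv 1 p).toLinearMap ∘ₗ LinearMap.inr S _ _) fun x hx => by
      rw [LinearMap.mem_ker, LinearMap.comp_apply, reduction_eq_zero_iff]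
      refine ⟨0, ?_⟩
      rw [show ((0, 0) : H.fil 1 p.castSucc × B 1 p) = 0 from rfl, map_zero, map_zero, sub_zero]
      exact LinearMap.apply_mem_smul_top _ _ hx

theorem IsSplitting.reductionMap_mk (y : B 1 p) : hB.reductionMap p (Submodule.Quotient.mk y) =
    hB.reduction p (H.d.restrict (H.d_mem p.succ) (hB.equiv 1 p (0, y))) := rfl

theorem IsSplitting.reductionMap_mem [IsLocalRing S] (hH : H.IsMinimal)
    (x : B 1 p ⧸ (stageIdeal f p.castSucc • ⊤ : Submodule S (B 1 p))) :
    hB.reductionMap p x ∈ (IsLocalRing.maximalIdeal S • ⊤ : Submodule S (H.StageCoker p.castSucc ×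
      (B 0 p ⧸ (stageIdeal f p.castSucc • ⊤ : Submodule S (B 0 p))))) := by
  obtain ⟨y, rfl⟩ := Submodule.mkQ_surjective _ x
  refine LinearMap.apply_mem_smul_top _ (hB.reduction p) ?_
  have := H.fil_free 0 p.succ
  let b := Module.Free.chooseBasis S (H.fil 0 p.succ)
  refine (b.mem_smul_top_iff _ _).2 fun i => ?_
  -- A coordinate followed by the residue map is a form, and forms vanish on the image of d. This
  -- places the image in the maximal ideal times A_0(p), not merely times A_0.
  exact (IsLocalRing.residue_eq_zero_iff _).1
    (hH.d_apply_eq_zero hB p.succ (Algebra.linearMap S (IsLocalRing.ResidueField S) ∘ₗ b.coord i) _)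

/-- The projection to the next stage. -/
theorem IsSplitting.exists_projection : ∃ e : H.StageCoker p.castSucc ×
    (B 0 p ⧸ (stageIdeal f p.castSucc • ⊤ : Submodule S (B 0 p))) →ₗ[S] H.StageCoker p.succ,
    Function.Surjective e ∧ Function.Exact (hB.reductionMap p) e := by
  have hle : (stageIdeal f p.castSucc • ⊤ : Submodule S (H.fil 0 p.succ)) ≤
      stageIdeal f p.succ • ⊤ := by
    rw [stageIdeal_succ, stageIdeal_castSucc]
    exact Submodule.smul_mono_left le_sup_left
  have hk : LinearMap.ker (hB.reduction p) ≤ H.stageRange p.succ := fun x hx => by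
    obtain ⟨y, hy⟩ := (hB.reduction_eq_zero_iff p x).1 hx
    exact (H.mem_stageRange_iff _ _).2 ⟨_, hle hy⟩
  let e := (LinearMap.ker (hB.reduction p)).liftQ (H.stageRange p.succ).mkQ (by
      rwa [Submodule.ker_mkQ]) ∘ₗ
    ((hB.reduction p).quotKerEquivOfSurjective (hB.reduction_surjective p)).symm.toLinearMap
  have he : ∀ x, e (hB.reduction p x) = (H.stageRange p.succ).mkQ x := fun x => by
    have h : ((hB.reduction p).quotKerEquivOfSurjective (hB.reduction_surjective p)).symm
        (hB.reduction p x) = Submodule.Quotient.mk x := by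
      rw [LinearEquiv.symm_apply_eq]
      rfl
    exact congrArg _ h
  refine ⟨e, fun y => ?_, fun y => ?_⟩
  · obtain ⟨x, rfl⟩ := Submodule.mkQ_surjective _ y
    exact ⟨_, he x⟩
  · obtain ⟨x, rfl⟩ := hB.reduction_surjective p y
    rw [he]
    refine (Submodule.Quotient.mk_eq_zero _).trans ((H.mem_stageRange_iff _ _).trans ?_)
    constructor
    · rintro ⟨y, hy⟩
      rw [stageIdeal_succ] at hy
      obtain ⟨w, hw⟩ := exists_sub_smul_mem_of_mem_sup_span_singleton_smul _ _ hy
      -- Passing from I_{p-1} to I_p adds nothing to the relations of M(p): f_p w ≡ d h_p w modulo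
      -- I_{p-1}, so x ≡ d(y + h_p w).
      have h1 := sub_mem hw (H.d_h p w)
      obtain ⟨z, hz⟩ := (hB.equiv 1 p).surjective (y + H.h p w)
      refine ⟨Submodule.Quotient.mk z.2, ?_⟩
      rw [reductionMap_mk, eq_comm, ← sub_eq_zero, ← map_sub, reduction_eq_zero_iff]
      refine ⟨z.1, ?_⟩
      have hzd : H.d.restrict (H.d_mem p.succ) (hB.equiv 1 p (0, z.2)) +
          H.d.restrict (H.d_mem p.succ) (hB.equiv 1 p (z.1, 0)) =
          H.d.restrict (H.d_mem p.succ) y + H.d.restrict (H.d_mem p.succ) (H.h p w) := by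
        rw [← map_add, ← map_add, ← map_add, ← hz, Prod.mk_add_mk, zero_add, add_zero]
      rw [sub_sub, hzd, stageIdeal_castSucc]
      convert h1 using 1
      module
    · rintro ⟨z, hz⟩
      obtain ⟨z, rfl⟩ := Submodule.mkQ_surjective _ z
      have hz' : hB.reduction p (x -
          H.d.restrict (H.d_mem p.succ) (hB.equiv 1 p (0, z))) = 0 := by
        rw [map_sub, sub_eq_zero]
        exact hz.symm
      obtain ⟨y, hy⟩ := (hB.reduction_eq_zero_iff p _).1 hz'
      refine ⟨hB.equiv 1 p (0, z) + hB.equiv 1 p (y, 0), ?_⟩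
      rw [map_add, ← sub_sub]
      exact hle hy

variable [IsLocalRing S] [IsNoetherianRing S]

/-- An element y of the kernel has the same image under d as some z in A_1(p-1), modulo I_{p-1}.
Then y - z is a cycle modulo I_{p-1}, and its component y in B_1(p) vanishes there. -/
theorem IsSplitting.reductionMap_injective
    (hf : RingTheory.Sequence.IsRegular S (List.ofFn f)) :
    Function.Injective (hB.reductionMap p) := by
  rw [← LinearMap.ker_eq_bot, LinearMap.ker_eq_bot']
  intro x hx
  obtain ⟨y, rfl⟩ := Submodule.mkQ_surjective _ x
  obtain ⟨z, hz⟩ := (hB.reduction_eq_zero_iff p _).1 hx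
  rw [stageIdeal_castSucc] at hz
  refine (Submodule.Quotient.mk_eq_zero _).2 ?_
  have h := hB.snd_mem_of_d_mem hf p (hB.equiv 1 p (0, y) - hB.equiv 1 p (z, 0)) (by
    rw [map_sub]
    exact hz)
  rw [stageIdeal_castSucc]
  simpa using h

/-- The Ext modules of a stage, in terms of those of the previous stage. -/
theorem IsSplitting.extLength_stageCoker_succ (hB : H.IsSplitting B)
    (hf : RingTheory.Sequence.IsRegular S (List.ofFn f)) (hH : H.IsMinimal) (n : ℕ) :
    extLength (ModuleCat.of S (IsLocalRing.ResidueField S)) (H.StageCoker p.succ) n =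
      extLength (ModuleCat.of S (IsLocalRing.ResidueField S)) (H.StageCoker p.castSucc) n +
        ((∑ x ∈ Finset.HasAntidiagonal.antidiagonal n,
          Nat.choose p x.1 * Module.finrank S (layer B x.2 p) : ℕ) : ℕ∞) := by
  have := hB.free 0 p
  have := hB.free 1 p
  have h0 : ∀ n, extMap (ModuleCat.of S (IsLocalRing.ResidueField S)) (hB.reductionMap p) n = 0 :=
    extMap_eq_zero (fun a ha x => by
      rw [show a • x = (a • x.1, a • x.2) from rfl,
        smul_quotient_smul_top_eq_zero le_sup_right a ha x.1,
        smul_quotient_smul_top_eq_zero le_rfl a ha x.2]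
      rfl) _ (hB.reductionMap_mem p hH)
  obtain ⟨e, he, hex⟩ := hB.exists_projection p
  have hinj := hB.reductionMap_injective p hf
  have hzero : ∀ m, Module.finrank S (layer B (m + 2) p) = 0 :=
    fun m => Module.finrank_zero_of_subsingleton
  match n with
  | 0 =>
    rw [extLength_zero_of_exact _ hinj he hex (h0 0), extLength_prod,
      extLength_quotient_stageIdeal _ hf, Finset.Nat.antidiagonal_zero, Finset.sum_singleton,
      mul_comm]
    rfl
  | n + 1 =>
    -- Once the term of layer degree 0 is split off, the shifted sum has only the contribution of
    -- layer degree 1, since higher layers are 0.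
    have hsum : ∑ x ∈ Finset.HasAntidiagonal.antidiagonal n,
        Nat.choose p x.1 * Module.finrank S (layer B (x.2 + 1) p) =
        Nat.choose p n * Module.finrank S (layer B 1 p) := by
      rw [Finset.sum_eq_single (n, 0)]
      · rintro ⟨i, j⟩ hx hne
        obtain _ | j := j
        · rw [Finset.HasAntidiagonal.mem_antidiagonal, add_zero] at hx
          exact absurd (congrArg (fun k => (k, 0)) hx) hne
        · rw [hzero, mul_zero]
      · simp
    rw [extLength_succ_of_exact _ hinj he hex h0, extLength_prod,
      extLength_quotient_stageIdeal _ hf, extLength_quotient_stageIdeal _ hf,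
      Finset.Nat.sum_antidiagonal_succ', hsum, add_left_comm, ← Nat.cast_add, add_comm
      (Module.finrank S (B 1 p) * _), mul_comm (Module.finrank S (B 0 p)),
      mul_comm (Module.finrank S (B 1 p))]
    rfl

theorem IsSplitting.extLength_stageCoker (hB : H.IsSplitting B)
    (hf : RingTheory.Sequence.IsRegular S (List.ofFn f))
    (hH : H.IsMinimal) (n : ℕ) (p : Fin (c + 1)) :
    extLength (ModuleCat.of S (IsLocalRing.ResidueField S)) (H.StageCoker p) n =
      ((∑ q : Fin c with q.castSucc < p, ∑ x ∈ Finset.HasAntidiagonal.antidiagonal n,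
          Nat.choose q x.1 * Module.finrank S (layer B x.2 q) : ℕ) : ℕ∞) := by
  induction p using Fin.induction with
  | zero =>
    have : Subsingleton (H.fil 0 0) := by
      rw [H.fil_zero]
      infer_instance
    have : Subsingleton (H.StageCoker 0) := (Submodule.mkQ_surjective _).subsingleton
    rw [extLength_eq_zero_of_subsingleton]
    simp
  | succ p ih =>
    have h : (Finset.univ.filter fun q : Fin c => q.castSucc < p.succ) =
        insert p (Finset.univ.filter fun q : Fin c => q.castSucc < p.castSucc) := by
      ext q
      simp [Fin.castSucc_lt_succ_iff, le_iff_eq_or_lt]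
    rw [hB.extLength_stageCoker_succ p hf hH, ih, h, Finset.sum_insert (by simp), add_comm,
      ← Nat.cast_add]

theorem IsSplitting.extLength_coker (hB : H.IsSplitting B)
    (hf : RingTheory.Sequence.IsRegular S (List.ofFn f))
    (hH : H.IsMinimal) (n : ℕ) :
    extLength (ModuleCat.of S (IsLocalRing.ResidueField S)) H.coker n =
      ((∑ q : Fin c, ∑ x ∈ Finset.HasAntidiagonal.antidiagonal n,
          Nat.choose q x.1 * Module.finrank S (layer B x.2 q) : ℕ) : ℕ∞) := by
  obtain ⟨e⟩ := H.nonempty_stageCoker_last_equiv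
  rw [← extLength_eq_of_equiv _ e, hB.extLength_stageCoker hf hH]
  simp [Fin.castSucc_lt_last]

end HigherMatrixFactorization

/-! ### The decomposition over exterior algebras -/

/-- A module of finite length killed by the maximal ideal is a vector space. -/
theorem nonempty_linearEquiv_finsupp_of_length_eq {S : Type*} [CommRing S] [IsLocalRing S]
    {N : Type*} [AddCommGroup N] [Module S N]
    (hN : ∀ a ∈ IsLocalRing.maximalIdeal S, ∀ x : N, a • x = 0) (η : Type*) [Fintype η]
    (h : Module.length S N = Fintype.card η) :
    Nonempty (N ≃ₗ[S] (η →₀ IsLocalRing.ResidueField S)) := by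
  have hN' : Module.IsTorsionBySet S N (IsLocalRing.maximalIdeal S) := fun x a => hN a a.2 x
  let : Module (IsLocalRing.ResidueField S) N := hN'.module
  have : IsScalarTower S (IsLocalRing.ResidueField S) N := hN'.isScalarTower
  rw [Module.length_eq_of_surjective (R := IsLocalRing.ResidueField S)
    IsLocalRing.residue_surjective] at h
  have h1 : IsFiniteLength (IsLocalRing.ResidueField S) N :=
    Module.length_ne_top_iff.1 (h ▸ ENat.natCast_ne_top _)
  have h2 := (isFiniteLength_iff_isNoetherian_isArtinian.1 h1).1
  rw [Module.length_eq_finrank] at h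
  let b := (Module.finBasisOfFinrankEq (IsLocalRing.ResidueField S) N
    (Nat.cast_injective h)).reindex (Fintype.equivFin η).symm
  exact ⟨b.repr.restrictScalars S⟩

section DualBasis

variable {S : Type*} [CommRing S] [IsLocalRing S] (F : Type*) [AddCommGroup F] [Module S F]
  [Module.Free S F] [Module.Finite S F]

/-- The dual of a basis of a free module. -/
noncomputable def residueDualBasis : Module.Basis (Fin (Module.finrank S F))
    (IsLocalRing.ResidueField S) (F →ₗ[S] IsLocalRing.ResidueField S) :=
  Module.Basis.ofEquivFun
    ((Module.finBasis S F).constr (IsLocalRing.ResidueField S)).symm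

end DualBasis

/-- A basis of the exterior algebra on `p` generators, by degrees. -/
noncomputable def exteriorAlgebraBasis (K : Type*) [Field K] {c : ℕ} (p : Fin c) :
    Module.Basis (Σ a, Fin (Nat.choose p a)) K (ExteriorAlgebra K ({i : Fin c // i < p} → K)) :=
  (DirectSum.Decomposition.isInternal
      fun a : ℕ => ⋀[K]^a ({i : Fin c // i < p} → K)).collectedBasis fun a =>
    Module.finBasisOfFinrankEq K _ (by
      rw [exteriorPower.finrank_eq, Module.finrank_fintype_fun_eq_card, Fintype.card_subtype,
        Finset.filter_gt_eq_Iio, Fin.card_Iio])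

theorem exteriorAlgebraBasis_mem (K : Type*) [Field K] {c : ℕ} (p : Fin c)
    (x : Σ a, Fin (Nat.choose p a)) :
    exteriorAlgebraBasis K p x ∈ ⋀[K]^x.1 ({i : Fin c // i < p} → K) :=
  DirectSum.IsInternal.collectedBasis_mem _ _ _

section ExteriorSum

/-- Pairs of graded indices, sorted by the total degree. -/
abbrev TotalDegreeIndex {κ : Type*} (α β : κ → ℕ → Type*) (n : ℕ) :=
  Σ (p : κ) (x : {x : ℕ × ℕ // x ∈ Finset.HasAntidiagonal.antidiagonal n}),
    α p x.1.1 × β p x.1.2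

/-- Sorting pairs of graded indices by the total degree. -/
def totalDegreeIndexEquiv {κ : Type*} (α β : κ → ℕ → Type*) :
    (Σ n, TotalDegreeIndex α β n) ≃ Σ p, (Σ a, α p a) × Σ b, β p b where
  toFun x := ⟨x.2.1, ⟨x.2.2.1.1.1, x.2.2.2.1⟩, ⟨x.2.2.1.1.2, x.2.2.2.2⟩⟩
  invFun y := ⟨y.2.1.1 + y.2.2.1, y.1, ⟨(y.2.1.1, y.2.2.1),
    Finset.HasAntidiagonal.mem_antidiagonal.2 rfl⟩, y.2.1.2, y.2.2.2⟩
  left_inv := by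
    rintro ⟨n, p, ⟨⟨a, b⟩, h⟩, i, j⟩
    obtain rfl := Finset.HasAntidiagonal.mem_antidiagonal.1 h
    rfl
  right_inv _ := rfl

theorem card_totalDegreeIndex {κ : Type*} [Fintype κ] (α β : κ → ℕ → ℕ) (n : ℕ) :
    Fintype.card (TotalDegreeIndex (fun p a => Fin (α p a)) (fun p b => Fin (β p b)) n) =
      ∑ p, ∑ x ∈ Finset.HasAntidiagonal.antidiagonal n, α p x.1 * β p x.2 := by
  simp only [Fintype.card_sigma, Fintype.card_prod, Fintype.card_fin]
  refine Finset.sum_congr rfl fun p _ => ?_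
  exact Finset.sum_coe_sort _ fun x : ℕ × ℕ => α p x.1 * β p x.2

variable {S : Type u} [CommRing S] [IsLocalRing S] {c : ℕ} {A : Fin 2 → Type u}
  [∀ s, AddCommGroup (A s)] [∀ s, Module S (A s)] {B : ∀ s, Fin c → Submodule S (A s)}

/-- A homogeneous basis of the direct sum over exterior algebras. -/
theorem ExteriorSum.exists_basis {ι : Fin c → ℕ → Type*}
    (β : ∀ q n, Module.Basis (ι q n) (IsLocalRing.ResidueField S)
      (layer B n q →ₗ[S] IsLocalRing.ResidueField S)) :
    ∃ b : Module.Basis (Σ n, TotalDegreeIndex (fun (p : Fin c) a => Fin (Nat.choose p a)) ι n)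
      (IsLocalRing.ResidueField S) (ExteriorSum B), ∀ x, b x ∈ ExteriorSum.degree B x.1 := by
  let b₀ : Module.Basis (Σ p : Fin c, (Σ a, Fin (Nat.choose p a)) × Σ n, ι p n)
      (IsLocalRing.ResidueField S) (ExteriorSum B) := DFinsupp.basis fun p =>
    (exteriorAlgebraBasis (IsLocalRing.ResidueField S) p).tensorProduct
      ((GradedDual.basis (β p)).map (HomB.gradedDualEquiv B p).symm)
  refine ⟨b₀.reindex (totalDegreeIndexEquiv _ _).symm, ?_⟩
  intro x
  obtain ⟨x, rfl⟩ := (totalDegreeIndexEquiv _ _).symm.surjective x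
  rw [Module.Basis.reindex_apply, Equiv.symm_symm, Equiv.apply_symm_apply]
  obtain ⟨s, hs, w, hw, e⟩ := HomB.exists_mem_degree B x.1 x.2.2.1 _
    ((β x.1 x.2.2.1).ne_zero x.2.2.2)
  refine Submodule.subset_span ⟨x.1, x.2.1.1, s, ?_, _,
    exteriorAlgebraBasis_mem (IsLocalRing.ResidueField S) x.1 x.2.1, w, hw, ?_⟩
  · rw [← hs]
    rfl
  · refine (DFinsupp.basis_apply _ x).trans (congrArg (DFinsupp.single x.1) ?_)
    rw [Module.Basis.tensorProduct_apply, Module.Basis.map_apply, GradedDual.basis_apply, ← e,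
      ← HomB.gradedDualEquiv_apply, LinearEquiv.symm_apply_apply]

end ExteriorSum

/-- Graded modules of the same dimensions are isomorphic as graded modules. -/
theorem exists_directSum_equiv_of_basis {S K : Type*} [CommRing S] [CommRing K] [Algebra S K]
    {N : ℕ → Type*} [∀ n, AddCommGroup (N n)] [∀ n, Module S (N n)] {η : ℕ → Type*}
    (e : ∀ n, N n ≃ₗ[S] (η n →₀ K)) {E : Type*} [AddCommGroup E] [Module K E] [Module S E]
    [IsScalarTower S K E] (b : Module.Basis (Σ n, η n) K E) (deg : ℕ → Submodule K E)
    (hb : ∀ x, b x ∈ deg x.1) :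
    ∃ Φ : DirectSum ℕ N ≃ₗ[S] E, ∀ n ξ, Φ (DirectSum.of N n ξ) ∈ deg n := by
  refine ⟨DFinsupp.mapRange.linearEquiv e ≪≫ₗ (sigmaFinsuppLequivDFinsupp S).symm ≪≫ₗ
    b.repr.symm.restrictScalars S, fun n ξ => ?_⟩
  have h1 : DFinsupp.mapRange.linearEquiv e (DirectSum.of N n ξ) = DFinsupp.single n (e n ξ) :=
    DFinsupp.mapRange_single (hf := fun i => map_zero (e i))
  rw [LinearEquiv.trans_apply, LinearEquiv.trans_apply, h1]
  induction e n ξ using Finsupp.induction_linear with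
  | zero =>
    rw [DFinsupp.single_zero, map_zero, map_zero]
    exact zero_mem _
  | add x y hx hy =>
    rw [DFinsupp.single_add, map_add, map_add]
    exact add_mem hx hy
  | single i a =>
    have h2 : (sigmaFinsuppLequivDFinsupp S).symm
        (DFinsupp.single n (Finsupp.single i a) : Π₀ n, η n →₀ K) =
        Finsupp.single ⟨n, i⟩ a :=
      (Equiv.symm_apply_eq _).2 (sigmaFinsuppEquivDFinsupp_single ⟨n, i⟩ a).symm
    rw [h2]
    refine (congrArg (· ∈ deg n) (b.repr_symm_single ⟨n, i⟩ a)).mpr ?_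
    exact Submodule.smul_mem _ a (hb ⟨n, i⟩)

/-- Both sides are graded vector spaces over k with the same finite dimension in each degree. The
length of Ext^n, a sum over the layers of binomial coefficients times ranks, is the number of
elements of degree n in a homogeneous basis of the exterior side. -/
theorem HigherMatrixFactorization.exists_totalExt_equiv_exteriorSum {S : Type u} [CommRing S]
    [IsLocalRing S] [IsNoetherianRing S] {c : ℕ} {f : Fin c → S}
    (hf : RingTheory.Sequence.IsRegular S (List.ofFn f))
    {A : Fin 2 → Type u} [∀ s, AddCommGroup (A s)] [∀ s, Module S (A s)]
    [∀ s, Module.Free S (A s)] [∀ s, Module.Finite S (A s)]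
    {H : HigherMatrixFactorization f A} (hH : H.IsMinimal)
    {B : ∀ s, Fin c → Submodule S (A s)} (hB : H.IsSplitting B) :
    ∃ Φ : TotalExt (ModuleCat.of S H.coker) (ModuleCat.of S (IsLocalRing.ResidueField S))
        ≃ₗ[S] ExteriorSum B,
      ∀ n ξ, Φ (TotalExt.of _ _ n ξ) ∈ ExteriorSum.degree B n := by
  have hfree : ∀ n q, Module.Free S (layer B n q) := free_layer B hB.free
  obtain ⟨b, hb⟩ := ExteriorSum.exists_basis (B := B) fun q n => residueDualBasis (layer B n q)
  have he : ∀ n, Nonempty (Abelian.Ext.{u} (ModuleCat.of S H.coker)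
      (ModuleCat.of S (IsLocalRing.ResidueField S)) n ≃ₗ[S]
      (TotalDegreeIndex (fun (p : Fin c) a => Fin (Nat.choose p a))
        (fun p n => Fin (Module.finrank S (layer B n p))) n →₀ IsLocalRing.ResidueField S)) :=
    fun n => nonempty_linearEquiv_finsupp_of_length_eq
      (fun a ha x => maximalIdeal_smul_ext_eq_zero ha x) _
      ((hB.extLength_coker hf hH n).trans (congrArg Nat.cast
        (card_totalDegreeIndex (fun (p : Fin c) a => Nat.choose p a)
          (fun p n => Module.finrank S (layer B n p)) n).symm))
  exact exists_directSum_equiv_of_basis (K := IsLocalRing.ResidueField S) (E := ExteriorSum B)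
    (fun n => (he n).some) b (ExteriorSum.degree B) hb

theorem mainTheorem7 {S : Type u} [CommRing S] [IsLocalRing S] [IsNoetherianRing S]
    {c : ℕ} (f : Fin c → S) (hf : RingTheory.Sequence.IsRegular S (List.ofFn f))
    (A : Fin 2 → Type u) [∀ s, AddCommGroup (A s)] [∀ s, Module S (A s)]
    [∀ s, Module.Free S (A s)] [∀ s, Module.Finite S (A s)]
    (H : HigherMatrixFactorization f A) (hH : H.IsMinimal)
    (B : ∀ s, Fin c → Submodule S (A s)) (hB : H.IsSplitting B) :
    (∃ Φ : TotalExt (ModuleCat.of S H.coker) (ModuleCat.of S (IsLocalRing.ResidueField S))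
        ≃ₗ[S] ExteriorSum B,
      ∀ n ξ, Φ (TotalExt.of _ _ n ξ) ∈ ExteriorSum.degree B n) ∧
    (∃ Φ : TotalExt (ModuleCat.of (S ⧸ Ideal.span (Set.range f)) H.coker)
          (residueFieldQuot (span_range_le_maximalIdeal f hf)) ≃ₗ[S] PolynomialSum B,
      (∀ n ξ, Φ (TotalExt.of _ _ n ξ) ∈ PolynomialSum.degree B n) ∧
      ∀ (D : CIResolution f (ModuleCat.of (S ⧸ Ideal.span (Set.range f)) H.coker))
        (p i : Fin c) (hpi : p ≤ i) (y : PolynomialSummand B p),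
        Φ (D.ciOperator (residueFieldQuot (span_range_le_maximalIdeal f hf))
            hf.toIsWeaklyRegular i
            (Φ.symm (DirectSum.of (fun p => PolynomialSummand B p) p y))) =
          DirectSum.of (fun p => PolynomialSummand B p) p
            ((MvPolynomial.X ⟨i, hpi⟩ :
              MvPolynomial {i : Fin c // p ≤ i} (IsLocalRing.ResidueField S)) • y)) :=
  ⟨HigherMatrixFactorization.exists_totalExt_equiv_exteriorSum hf hH hB,
    HigherMatrixFactorization.exists_totalExt_equiv_polynomialSum hf hH hB⟩
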